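/- **Setting.** For $q:\mathbb R\to\mathbb C$ in $H^2(\mathbb R)\cap H^{1,1}(\mathbb R)$, where $H^{1,1}(\mathbb R)=\{q:\ q,\ \partial_xq,\ \langle x\rangle q,\ \langle x\rangle\partial_x q\in L^2(\mathbb R)\}$ and $\langle x\rangle=\sqrt{1+x^2}$, consider the spectral problem $$\Phi_x=\Big[\big(-i\lambda^2+\tfrac i4|q|^2\big)\sigma_3+\lambda\begin{pmatrix}0&q\\-\bar q&0\end{pmatrix}\Big]\Phi,\qquad \sigma_3=\begin{pmatrix}1&0\\0&-1\end{pmatrix}.$$ The Jost functions $\varphi_\pm(x;\lambda)$, $\phi_\pm(x;\lambda)$ are the bounded $\mathbb C^2$-valued functions of $x$ such that $\varphi_\pm e^{-i\lambda^2x}$ and $\phi_\pm e^{i\lambda^2x}$ solve the spectral problem and $\varphi_\pm\to e_1=(1,0)^T$, $\phi_\pm\to e_2=(0,1)^T$ as $x\to\pm\infty$. The functions $\varphi_-,\phi_+$ are considered for $\operatorname{Im}\lambda^2\ge0$, and $\varphi_+$ for $\lambda\in\mathbb R\cup i\mathbb R$. The scattering coefficients are $$a(\lambda)=\det\big(\varphi_-e^{-i\lambda^2x},\,\phi_+e^{i\lambda^2x}\big)\quad(\operatorname{Im}\lambda^2\ge0),\qquad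 b(\lambda)=\det\big(\varphi_+e^{-i\lambda^2x},\,\varphi_-e^{-i\lambda^2x}\big)\quad(\lambda\in\mathbb R\cup i\mathbb R);$$ both are independent of $x$. Let $\mathbb C_I=\{\lambda:\operatorname{Re}\lambda>0,\ \operatorname{Im}\lambda>0\}$, and let $Z_N$ be the set of $q\in H^2(\mathbb R)\cap H^{1,1}(\mathbb R)$ for which $a$ has exactly $N$ zeros in $\mathbb C_I$, all of them simple. For a $\mathbb C^2$-valued function $\Phi=(f,g)^T$ on $\mathbb R$ and $\lambda_1\in\mathbb C_I$ put $$B(\Phi,\lambda_1)q=\frac{\bar\lambda_1|f|^2+\lambda_1|g|^2}{\lambda_1|f|^2+\bar\lambda_1|g|^2}\,q-2i\,\frac{(\lambda_1^2-\bar\lambda_1^2)f\bar g}{\lambda_1|f|^2+\bar\lambda_1|g|^2}.$$ **Proposition 4.3.** Let $q\in Z_1$, let $\lambda_1\in\mathbb C_I$ be the zero of $a$, and let $\Phi_1(x)=\varphi_-(x;\lambda_1)e^{-i\lambda_1^2x}$. Then the Darboux-transformed potential $q^{(1)}=B(\Phi_1,\lambda_1)q$ lies in $Z_0$. Its scattering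 coefficients $a^{(1)},b^{(1)}$ are $$a^{(1)}(\lambda)=a(\lambda)\,\frac{\lambda_1}{\bar\lambda_1}\,\frac{\lambda^2-\bar\lambda_1^2}{\lambda^2-\lambda_1^2}\qquad(\operatorname{Im}\lambda^2\ge0),$$ where at $\lambda=\pm\lambda_1$ the right-hand side is understood as its limit, and $$b^{(1)}(\lambda)=b(\lambda)\qquad(\lambda\in\mathbb R\cup i\mathbb R).$$ -/

import Mathlib

open MeasureTheory Filter Topology
open scoped ComplexConjugate ContDiff

namespace CLL

noncomputable section

/-! ### Weak derivatives, Sobolev spaces and weighted Sobolev spaces on the line -/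

/-- `g` is the weak derivative of order `j` of `f` on `ℝ`, tested against real-valued smooth
functions with compact support. -/
def IsWeakDeriv (j : ℕ) (f g : ℝ → ℂ) : Prop :=
  LocallyIntegrable f ∧ LocallyIntegrable g ∧
    ∀ η : ℝ → ℝ, ContDiff ℝ ∞ η → HasCompactSupport η →
      ∫ x, ((iteratedDeriv j η x : ℝ) : ℂ) * f x = (-1) ^ j * ∫ x, ((η x : ℝ) : ℂ) * g x

/-- The Japanese bracket `⟨x⟩ = √(1 + x²)`. -/
def bracket (x : ℝ) : ℝ := Real.sqrt (1 + |x| ^ 2)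

/-- Membership in `L^{2,s}(ℝ)`: both `f` and `⟨x⟩^s f` are square integrable. -/
def MemL2s (s : ℕ) (f : ℝ → ℂ) : Prop :=
  MemLp f 2 ∧ MemLp (fun x => ((bracket x ^ s : ℝ) : ℂ) * f x) 2

/-- Membership in `H^m(ℝ)`: `f` and its weak derivatives up to order `m` are square integrable. -/
def MemSobolev (m : ℕ) (f : ℝ → ℂ) : Prop :=
  MemLp f 2 ∧ ∀ j : ℕ, 1 ≤ j → j ≤ m → ∃ g, IsWeakDeriv j f g ∧ MemLp g 2

/-- Membership in `H^{k,s}(ℝ)`: `f` and its weak derivatives up to order `k` are in `L^{2,s}(ℝ)`. -/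
def MemWeightedSobolev (k s : ℕ) (f : ℝ → ℂ) : Prop :=
  MemL2s s f ∧ ∀ j : ℕ, 1 ≤ j → j ≤ k → ∃ g, IsWeakDeriv j f g ∧ MemL2s s g

/-! ### The spectral problem -/

/-- The coefficient matrix `(-iλ² + (i/4)|q|²) σ₃ + λ Q` of the spectral problem with `r = q̄`. -/
def laxU (q : ℝ → ℂ) (lam : ℂ) (x : ℝ) : Matrix (Fin 2) (Fin 2) ℂ :=
  (-Complex.I * lam ^ 2 + Complex.I / 4 * (q x * conj (q x))) • !![1, 0; 0, -1]
    + lam • !![0, q x; -conj (q x), 0]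

/-- `Φ` is a solution of `Φ_x = U Φ`. Since `q` is a function defined almost everywhere, this is meant
in the usual (Carathéodory) sense: `Φ` is continuous and satisfies the integrated equation. -/
def IsSpectralSolution (q : ℝ → ℂ) (lam : ℂ) (Φ : ℝ → Fin 2 → ℂ) : Prop :=
  Continuous Φ ∧ ∀ x y : ℝ,
    IntervalIntegrable (fun s => (laxU q lam s).mulVec (Φ s)) volume x y ∧
    Φ y - Φ x = ∫ s in x..y, (laxU q lam s).mulVec (Φ s)

/-- `v` is a bounded function such that `v(x) e^{-iλ²x}` solves the spectral problem and
`v → e₁` along `l` (`l = atBot` or `l = atTop`). -/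
def IsJostFirst (l : Filter ℝ) (q : ℝ → ℂ) (lam : ℂ) (v : ℝ → Fin 2 → ℂ) : Prop :=
  (∃ M : ℝ, ∀ x, ‖v x‖ ≤ M) ∧
  IsSpectralSolution q lam (fun x => Complex.exp (-Complex.I * lam ^ 2 * x) • v x) ∧
  Tendsto v l (𝓝 ![1, 0])

/-- `v` is a bounded function such that `v(x) e^{iλ²x}` solves the spectral problem and
`v → e₂` along `l`. -/
def IsJostSecond (l : Filter ℝ) (q : ℝ → ℂ) (lam : ℂ) (v : ℝ → Fin 2 → ℂ) : Prop :=
  (∃ M : ℝ, ∀ x, ‖v x‖ ≤ M) ∧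
  IsSpectralSolution q lam (fun x => Complex.exp (Complex.I * lam ^ 2 * x) • v x) ∧
  Tendsto v l (𝓝 ![0, 1])

/-- The Jost function `φ₋(x; λ)`, used for `Im λ² ≥ 0`. -/
def varphiMinus (q : ℝ → ℂ) (lam : ℂ) : ℝ → Fin 2 → ℂ :=
  Classical.epsilon (IsJostFirst atBot q lam)

/-- The Jost function `φ₊(x; λ)` (first column), used for `Im λ² ≤ 0`. -/
def varphiPlus (q : ℝ → ℂ) (lam : ℂ) : ℝ → Fin 2 → ℂ :=
  Classical.epsilon (IsJostFirst atTop q lam)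

/-- The Jost function `ϕ₊(x; λ)` (second column), used for `Im λ² ≥ 0`. -/
def phiPlus (q : ℝ → ℂ) (lam : ℂ) : ℝ → Fin 2 → ℂ :=
  Classical.epsilon (IsJostSecond atTop q lam)

/-- The determinant of the matrix with columns `u` and `v`. -/
def det2 (u v : Fin 2 → ℂ) : ℂ := (Matrix.of ![u, v]).transpose.det

/-- The scattering coefficient `a(λ) = det(φ₋ e^{-iλ²x}, ϕ₊ e^{iλ²x})`, for `Im λ² ≥ 0`.
The determinant of two solutions does not depend on `x` as `U` has trace zero; it is taken at
`x = 0`, where both exponentials are `1`. -/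
def scatA (q : ℝ → ℂ) (lam : ℂ) : ℂ := det2 (varphiMinus q lam 0) (phiPlus q lam 0)

/-- The scattering coefficient `b(λ) = det(φ₊ e^{-iλ²x}, φ₋ e^{-iλ²x})`, for `λ ∈ ℝ ∪ iℝ`,
taken at `x = 0`. -/
def scatB (q : ℝ → ℂ) (lam : ℂ) : ℂ := det2 (varphiPlus q lam 0) (varphiMinus q lam 0)

/-- The open first quadrant. -/
def quadrantI : Set ℂ := {lam | 0 < lam.re ∧ 0 < lam.im}

/-- The set `ℝ ∪ iℝ`. -/
def contSpectrum : Set ℂ := {lam | lam.im = 0 ∨ lam.re = 0}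

/-- `Z_N`: the potentials in `H²(ℝ) ∩ H^{1,1}(ℝ)` for which `a` has exactly `N` zeros in the open first
quadrant, all of them simple. (`encard` is infinite on infinite sets.) -/
def Z (N : ℕ) : Set (ℝ → ℂ) :=
  {q | MemSobolev 2 q ∧ MemWeightedSobolev 1 1 q ∧
    {lam | lam ∈ quadrantI ∧ scatA q lam = 0}.encard = N ∧
    ∀ lam ∈ quadrantI, scatA q lam = 0 → deriv (scatA q) lam ≠ 0}

/-! ### The two-fold Darboux transformation of the potential -/

/-- The form `m_λ(f, g) = λ f₁ ḡ₁ + λ̄ f₂ ḡ₂`. -/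
def formM (lam : ℂ) (f g : Fin 2 → ℂ) : ℂ :=
  lam * f 0 * conj (g 0) + conj lam * f 1 * conj (g 1)

/-- `C_λ(Φ) = m_{λ̄}(Φ, Φ) / m_λ(Φ, Φ)`. -/
def coefC (lam : ℂ) (Φ : Fin 2 → ℂ) : ℂ := formM (conj lam) Φ Φ / formM lam Φ Φ

/-- `D_λ(Φ) = (λ² - λ̄²) f ḡ / m_λ(Φ, Φ)` for `Φ = (f, g)ᵀ`. -/
def coefD (lam : ℂ) (Φ : Fin 2 → ℂ) : ℂ :=
  (lam ^ 2 - conj lam ^ 2) * Φ 0 * conj (Φ 1) / formM lam Φ Φ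

/-- `B(Φ, λ) q = C_λ(Φ) q - 2i D_λ(Φ)`. -/
def darbouxB (Φ : ℝ → Fin 2 → ℂ) (lam : ℂ) (q : ℝ → ℂ) : ℝ → ℂ :=
  fun x => coefC lam (Φ x) * q x - 2 * Complex.I * coefD lam (Φ x)

/-- `Φ₁(x) = φ₋(x; λ₁) e^{-iλ₁²x}`. -/
def seedPhi (q : ℝ → ℂ) (lam₁ : ℂ) : ℝ → Fin 2 → ℂ :=
  fun x => Complex.exp (-Complex.I * lam₁ ^ 2 * x) • varphiMinus q lam₁ x

/-- The transformed potential `q⁽¹⁾ = B(Φ₁, λ₁) q`. -/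
def darbouxPotential (q : ℝ → ℂ) (lam₁ : ℂ) : ℝ → ℂ :=
  darbouxB (seedPhi q lam₁) lam₁ q

/-- The claimed scattering coefficient `a(λ) (λ₁/λ̄₁) (λ² - λ̄₁²)/(λ² - λ₁²)`. -/
def transformedA (q : ℝ → ℂ) (lam₁ lam : ℂ) : ℂ :=
  scatA q lam * (lam₁ / conj lam₁) * ((lam ^ 2 - conj lam₁ ^ 2) / (lam ^ 2 - lam₁ ^ 2))

end

end CLL

/-! The transformation is realised by a Darboux matrix T(λ) = [[λ²α - κᾱ, λγ], [-λγ̄, λ²ᾱ - κα]]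
with |α| = 1 and κ = |λ₁|², which carries solutions for q to solutions for q⁽¹⁾ = α²q + 2iαγ at
every λ. Its coefficients come from the seed Φ₁ = (f, g): with m = λ₁|f|² + λ̄₁|g|², nonzero because
Re λ₁ > 0, one takes α = m̄/|m| and γ = -(λ₁² - λ̄₁²)fḡ/|m| (`isDarboux_seed`,
`IsDarboux.isClassicalSolution`). Its determinant (λ² - λ₁²)(λ² - λ̄₁²) does not depend on x
(`det_seed`).

Since a(λ₁) = 0, the seed is at each point a multiple of φ₋ and also of ϕ₊ at λ₁, and α, γ are
homogeneous of degree zero in the seed. They can therefore be computed from φ₋ → e₁ at -∞ and from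
ϕ₊ → e₂ at +∞: γ vanishes at both ends, while α tends to λ̄₁/|λ₁| and to λ₁/|λ₁| (`exists_darboux`).
So T becomes diagonal at both ends, and T times a Jost function, divided by the limiting diagonal
entry, is the Jost function of q⁽¹⁾. Taking determinants gives both scattering coefficients
(`scatA_darbouxPotential`, `scatB_darbouxPotential`).

Where λ² = λ₁² the normalising entry vanishes. There the value of a⁽¹⁾ is obtained from its
continuity, which rests on Volterra estimates for the Jost functions (`continuousAt_scatA`).
Simplicity of the zero makes this value nonzero at λ₁, so no zero remains in the quadrant.

For membership in H² ∩ H^{1,1}: γ is controlled near -∞ by the second component of φ₋ and near +∞ by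
the first component of ϕ₊. As Im λ₁² > 0 these solve damped equations with forcing in L^{2,1}, so γ
lies in L^{2,1} (`IsJostLeft.weighted_integrableOn`), and the differential system for (α, γ)
bootstraps this to the regularity of q⁽¹⁾ (`isRegular_of_system`). All objects depend only on the
almost everywhere class of q, so q may be replaced by its C¹ representative and the spectral problem
becomes classical. -/

namespace CLL

/-! ### Absolutely continuous functions and weak derivatives -/

/-- `F` is an absolutely continuous antiderivative of the locally integrable function `f`. -/
structure IsAntideriv (F f : ℝ → ℂ) : Prop where
  locInt : LocallyIntegrable f
  sub_eq : ∀ x y : ℝ, F y - F x = ∫ s in x..y, f s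

lemma locInt_intervalIntegrable {f : ℝ → ℂ} (hf : LocallyIntegrable f) (a b : ℝ) :
    IntervalIntegrable f volume a b :=
  intervalIntegrable_iff.mpr
    ((hf.integrableOn_isCompact isCompact_uIcc).mono_set Set.uIoc_subset_uIcc)

lemma IsAntideriv.eq_add {F f : ℝ → ℂ} (h : IsAntideriv F f) (c : ℝ) :
    F = fun x => F c + ∫ s in c..x, f s := by
  ext x; rw [← h.sub_eq]; ring

lemma isAntideriv_primitive {f : ℝ → ℂ} (hf : LocallyIntegrable f) (c : ℂ) (a : ℝ) :
    IsAntideriv (fun x => c + ∫ s in a..x, f s) f where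
  locInt := hf
  sub_eq x y := by
    rw [add_sub_add_left_eq_sub, intervalIntegral.integral_interval_sub_left
      (locInt_intervalIntegrable hf _ _) (locInt_intervalIntegrable hf _ _)]

lemma IsAntideriv.continuous {F f : ℝ → ℂ} (h : IsAntideriv F f) : Continuous F := by
  rw [h.eq_add 0]
  exact continuous_const.add
    (intervalIntegral.continuous_primitive (fun a b => locInt_intervalIntegrable h.locInt a b) 0)

lemma IsAntideriv.ae_hasDerivAt {F f : ℝ → ℂ} (h : IsAntideriv F f) :
    ∀ᵐ x, HasDerivAt F (f x) x := by
  filter_upwards [_root_.LocallyIntegrable.ae_hasDerivAt_integral h.locInt] with x hx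
  rw [h.eq_add 0]
  exact (hx 0).const_add _

lemma absolutelyContinuous_ofReal {f : ℝ → ℝ} {a b : ℝ}
    (hf : AbsolutelyContinuousOnInterval f a b) :
    AbsolutelyContinuousOnInterval (fun x => (f x : ℂ)) a b := by
  simpa [AbsolutelyContinuousOnInterval, Complex.dist_eq, Real.dist_eq,
    ← Complex.ofReal_sub] using hf

lemma IsAntideriv.absolutelyContinuous {F f : ℝ → ℂ} (h : IsAntideriv F f) (a b : ℝ) :
    AbsolutelyContinuousOnInterval F a b := by
  have hi := locInt_intervalIntegrable h.locInt a b
  have hre : IntervalIntegrable (fun x => (f x).re) volume a b := ⟨hi.1.re, hi.2.re⟩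
  have him : IntervalIntegrable (fun x => (f x).im) volume a b := ⟨hi.1.im, hi.2.im⟩
  have h1 := absolutelyContinuous_ofReal
    (hre.absolutelyContinuousOnInterval_intervalIntegral (c := a) (by simp))
  have h2 := (absolutelyContinuous_ofReal
    (him.absolutelyContinuousOnInterval_intervalIntegral (c := a) (by simp))).const_smul Complex.I
  have h3 : AbsolutelyContinuousOnInterval (fun _ : ℝ => F a) a b := by
    simpa [AbsolutelyContinuousOnInterval] using tendsto_const_nhds
  -- Absolute continuity of primitives is applied to the real and imaginary parts separately.
  suffices hF : F = (fun _ => F a) + ((fun x => ((∫ s in a..x, (f s).re : ℝ) : ℂ)) +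
      fun x => Complex.I • ((∫ s in a..x, (f s).im : ℝ) : ℂ)) by
    rw [hF]
    exact h3.add (h1.add h2)
  funext x
  have hx := locInt_intervalIntegrable h.locInt a x
  have e : F x = F a + ∫ s in a..x, f s := by rw [← h.sub_eq]; ring
  rw [e]
  simp only [Pi.add_apply, smul_eq_mul]
  congr 1
  have e2 : ∫ s in a..x, f s = ∫ s in a..x, (((f s).re : ℂ) + Complex.I * ((f s).im : ℂ)) := by
    congr 1; ext s; rw [mul_comm, Complex.re_add_im]
  have hrex : IntervalIntegrable (fun x => ((f x).re : ℂ)) volume a x :=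
    ⟨hx.1.re.ofReal, hx.2.re.ofReal⟩
  have himx : IntervalIntegrable (fun x => ((f x).im : ℂ)) volume a x :=
    ⟨hx.1.im.ofReal, hx.2.im.ofReal⟩
  rw [e2, intervalIntegral.integral_add hrex (himx.const_mul _),
    intervalIntegral.integral_const_mul, intervalIntegral.integral_ofReal,
    intervalIntegral.integral_ofReal]

lemma locInt_mul_continuous {f g : ℝ → ℂ} (hf : LocallyIntegrable f) (hg : Continuous g) :
    LocallyIntegrable (fun x => g x * f x) := by
  have := (locallyIntegrableOn_univ.2 hf).continuousOn_smul isOpen_univ.isLocallyClosed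
    hg.continuousOn
  simpa [smul_eq_mul, locallyIntegrableOn_univ] using this

/-- Product rule for absolutely continuous functions: `F * G` minus the primitive of the candidate
derivative is absolutely continuous with derivative zero almost everywhere, hence constant. -/
lemma IsAntideriv.mul {F f G g : ℝ → ℂ} (hF : IsAntideriv F f) (hG : IsAntideriv G g) :
    IsAntideriv (fun x => F x * G x) (fun x => G x * f x + F x * g x) := by
  have hloc : LocallyIntegrable (fun x => G x * f x + F x * g x) :=
    (locInt_mul_continuous hF.locInt hG.continuous).add
      (locInt_mul_continuous hG.locInt hF.continuous)
  refine ⟨hloc, fun x y => ?_⟩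
  have hP := isAntideriv_primitive hloc 0 x
  have hac := ((hF.absolutelyContinuous x y).smul (hG.absolutelyContinuous x y)).sub
    (hP.absolutelyContinuous x y)
  obtain ⟨C, hC⟩ := hac.const_of_ae_hasDerivAt_zero (by
    filter_upwards [hF.ae_hasDerivAt, hG.ae_hasDerivAt, hP.ae_hasDerivAt] with s h1 h2 h3 _
    refine ((h1.smul h2).sub h3).congr_deriv ?_
    simp only [smul_eq_mul]; ring)
  have e1 := hC x (by simp)
  have e2 := hC y (by simp)
  simp at e1 e2
  rw [← e1] at e2
  linear_combination e2

lemma IsAntideriv.add {F f G g : ℝ → ℂ} (hF : IsAntideriv F f) (hG : IsAntideriv G g) :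
    IsAntideriv (fun x => F x + G x) (fun x => f x + g x) := by
  refine ⟨hF.locInt.add hG.locInt, fun x y => ?_⟩
  rw [intervalIntegral.integral_add (locInt_intervalIntegrable hF.locInt _ _)
    (locInt_intervalIntegrable hG.locInt _ _), ← hF.sub_eq, ← hG.sub_eq]
  ring

lemma isAntideriv_of_hasDerivAt {F f : ℝ → ℂ} (hf : Continuous f)
    (h : ∀ x, HasDerivAt F (f x) x) : IsAntideriv F f :=
  ⟨hf.locallyIntegrable, fun x y => (intervalIntegral.integral_eq_sub_of_hasDerivAt
    (fun t _ => h t) (hf.intervalIntegrable x y)).symm⟩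

lemma isAntideriv_testFun {η : ℝ → ℝ} (hη : ContDiff ℝ ∞ η) :
    IsAntideriv (fun x => (η x : ℂ)) (fun x => ((deriv η x : ℝ) : ℂ)) := by
  refine isAntideriv_of_hasDerivAt ?_ fun x => ?_
  · exact Complex.continuous_ofReal.comp (hη.continuous_deriv (by simp))
  · exact ((hη.differentiable (by simp)) x).hasDerivAt.ofReal_comp

lemma isWeakDeriv_one_iff {f g : ℝ → ℂ} : IsWeakDeriv 1 f g ↔
    LocallyIntegrable f ∧ LocallyIntegrable g ∧
    ∀ η : ℝ → ℝ, ContDiff ℝ ∞ η → HasCompactSupport η →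
      ∫ x, ((deriv η x : ℝ) : ℂ) * f x = - ∫ x, (η x : ℂ) * g x := by
  simp [IsWeakDeriv, iteratedDeriv_one]

lemma integrable_test_mul {η : ℝ → ℝ} (hη : Continuous η) (hs : HasCompactSupport η) {f : ℝ → ℂ}
    (hf : LocallyIntegrable f) : Integrable (fun x => (η x : ℂ) * f x) := by
  have := hf.integrable_smul_left_of_hasCompactSupport hη hs
  simpa [Complex.real_smul] using this

/-- Integration by parts: `η * F` vanishes outside a compact set, so its derivative integrates to
zero over `[-R, R]` for large `R`. -/
lemma IsAntideriv.isWeakDeriv {F f : ℝ → ℂ} (h : IsAntideriv F f) : IsWeakDeriv 1 F f := by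
  refine isWeakDeriv_one_iff.2 ⟨h.continuous.locallyIntegrable, h.locInt, fun η hη hs => ?_⟩
  have hp := (isAntideriv_testFun hη).mul h
  have i1 : Integrable (fun x => ((deriv η x : ℝ) : ℂ) * F x) :=
    integrable_test_mul (hη.continuous_deriv (by simp)) hs.deriv h.continuous.locallyIntegrable
  have i2 : Integrable (fun x => (η x : ℂ) * f x) :=
    integrable_test_mul hη.continuous hs h.locInt
  have key : ∫ x, (((deriv η x : ℝ) : ℂ) * F x + (η x : ℂ) * f x) = 0 := by
    have t1 : Tendsto (fun R : ℝ => ∫ x in (-R)..R, (((deriv η x : ℝ) : ℂ) * F x + (η x : ℂ) * f x))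
        atTop (𝓝 (∫ x, (((deriv η x : ℝ) : ℂ) * F x + (η x : ℂ) * f x))) :=
      intervalIntegral_tendsto_integral (i1.add i2) tendsto_neg_atTop_atBot tendsto_id
    refine tendsto_nhds_unique t1 (tendsto_const_nhds.congr' ?_)
    rw [hasCompactSupport_iff_eventuallyEq, Filter.coclosedCompact_eq_cocompact] at hs
    have hb := hs.filter_mono _root_.atBot_le_cocompact
    have ht := hs.filter_mono _root_.atTop_le_cocompact
    filter_upwards [ht, tendsto_neg_atTop_atBot.eventually hb] with R h1 h2
    have := hp.sub_eq (-R) R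
    simp only [h1, h2, Pi.zero_apply, Complex.ofReal_zero, zero_mul, sub_zero] at this
    rw [this]
    congr 1; ext x; ring
  rw [integral_add i1 i2] at key
  exact eq_neg_of_add_eq_zero_left key

lemma isWeakDeriv_one_unique {f g h : ℝ → ℂ} (hg : IsWeakDeriv 1 f g) (hh : IsWeakDeriv 1 f h) :
    g =ᵐ[volume] h := by
  rw [isWeakDeriv_one_iff] at hg hh
  refine ae_eq_of_integral_contDiff_smul_eq hg.2.1 hh.2.1 fun η hη hs => ?_
  have := (hg.2.2 η hη hs).symm.trans (hh.2.2 η hη hs)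
  simpa [Complex.real_smul] using this

/-- A test function of integral zero is the derivative of a test function. -/
lemma exists_deriv_eq_of_integral_eq_zero {η : ℝ → ℝ} (hη : ContDiff ℝ ∞ η)
    (hs : HasCompactSupport η) (h0 : ∫ x, η x = 0) :
    ∃ ψ : ℝ → ℝ, ContDiff ℝ ∞ ψ ∧ HasCompactSupport ψ ∧ deriv ψ = η := by
  obtain ⟨R, hR⟩ : ∃ R : ℝ, ∀ x, R ≤ |x| → η x = 0 := by
    obtain ⟨R, hR⟩ := hs.isCompact.isBounded.subset_closedBall 0
    refine ⟨R + 1, fun x hx => ?_⟩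
    by_contra hne
    have := hR (subset_tsupport _ hne)
    simp at this
    linarith
  have hd : ∀ x, HasDerivAt (fun x => ∫ t in (-R)..x, η t) (η x) x := fun x =>
    (hη.continuous.integral_hasStrictDerivAt (-R) x).hasDerivAt
  have hde : deriv (fun x => ∫ t in (-R)..x, η t) = η := funext fun x => (hd x).deriv
  refine ⟨fun x => ∫ t in (-R)..x, η t, ?_, ?_, hde⟩
  · rw [contDiff_infty_iff_deriv]
    exact ⟨fun x => (hd x).differentiableAt, by rwa [hde]⟩
  -- To the left of the support the primitive is zero; to the right it equals the full integral of
  -- `η`, which is zero. The absolute value covers a negative `R`.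
  · refine HasCompactSupport.of_support_subset_isCompact (isCompact_Icc (a := -|R|) (b := |R|)) ?_
    intro x hx
    by_contra hxx
    apply hx
    have hi : Integrable η := hη.continuous.integrable_of_hasCompactSupport hs
    rw [Set.mem_Icc, not_and_or, not_le, not_le] at hxx
    have hRR := le_abs_self R
    rcases hxx with hxx | hxx
    · show ∫ t in (-R)..x, η t = 0
      rw [intervalIntegral.integral_congr (g := fun _ => (0 : ℝ))]
      · simp
      intro t ht
      apply hR
      rw [Set.mem_uIcc] at ht
      have : t ≤ -R := by
        rcases ht with h | h
        · have : -R ≤ x := h.1.trans h.2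
          linarith
        · exact h.2
      rw [le_abs]; right; linarith
    · have e1 : ∫ t in (-R)..x, η t = ∫ t, η t := by
        have t1 : Tendsto (fun S : ℝ => ∫ t in (-S)..S, η t) atTop (𝓝 (∫ x, η x)) :=
          intervalIntegral_tendsto_integral hi tendsto_neg_atTop_atBot tendsto_id
        refine tendsto_nhds_unique (tendsto_const_nhds.congr' ?_) t1
        filter_upwards [eventually_ge_atTop x] with S hS
        have a1 : ∫ t in (-S)..(-R), η t = 0 := by
          rw [intervalIntegral.integral_congr (g := fun _ => (0 : ℝ))]
          · simp
          intro t ht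
          apply hR
          rw [Set.uIcc_of_le (by linarith)] at ht
          rw [le_abs]; right; linarith [ht.2]
        have a2 : ∫ t in x..S, η t = 0 := by
          rw [intervalIntegral.integral_congr (g := fun _ => (0 : ℝ))]
          · simp
          intro t ht
          apply hR
          rw [Set.uIcc_of_le hS] at ht
          rw [le_abs]; left; linarith [ht.1]
        rw [← intervalIntegral.integral_add_adjacent_intervals (a := -S) (b := -R) (c := S)
          (hη.continuous.intervalIntegrable _ _) (hη.continuous.intervalIntegrable _ _),
          ← intervalIntegral.integral_add_adjacent_intervals (a := -R) (b := x) (c := S)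
          (hη.continuous.intervalIntegrable _ _) (hη.continuous.intervalIntegrable _ _), a1, a2]
        simp
      show ∫ t in (-R)..x, η t = 0
      rw [e1, h0]

lemma exists_testFun_integral_one :
    ∃ θ : ℝ → ℝ, ContDiff ℝ ∞ θ ∧ HasCompactSupport θ ∧ ∫ x, θ x = 1 := by
  let φ : ContDiffBump (0 : ℝ) := ⟨1, 2, one_pos, one_lt_two⟩
  exact ⟨φ.normed volume, φ.contDiff_normed, φ.hasCompactSupport_normed, φ.integral_normed⟩

/-- The lemma of du Bois-Reymond: a function with vanishing weak derivative is constant. -/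
lemma ae_eq_const_of_weakDeriv_zero {f : ℝ → ℂ} (hf : LocallyIntegrable f)
    (h : ∀ η : ℝ → ℝ, ContDiff ℝ ∞ η → HasCompactSupport η → ∫ x, ((deriv η x : ℝ) : ℂ) * f x = 0) :
    ∃ c : ℂ, f =ᵐ[volume] fun _ => c := by
  obtain ⟨θ, hθ, hθs, hθ1⟩ := exists_testFun_integral_one
  refine ⟨∫ x, (θ x : ℂ) * f x, ?_⟩
  refine ae_eq_of_integral_contDiff_smul_eq hf (locallyIntegrable_const _) fun η hη hs => ?_
  have hiη : Integrable η := hη.continuous.integrable_of_hasCompactSupport hs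
  have hiθ : Integrable θ := hθ.continuous.integrable_of_hasCompactSupport hθs
  -- Subtracting the multiple of `θ` with the same integral turns `η` into the derivative of a test
  -- function.
  obtain ⟨ψ, hψ, hψs, hψd⟩ := exists_deriv_eq_of_integral_eq_zero
    (η := fun x => η x - (∫ t, η t) * θ x) (hη.sub (contDiff_const.mul hθ))
    (hs.sub (hθs.mul_left))
    (by rw [integral_sub hiη (hiθ.const_mul _), integral_const_mul, hθ1]; ring)
  have := h ψ hψ hψs
  rw [hψd] at this
  have i1 := integrable_test_mul hη.continuous hs hf
  have i2 := integrable_test_mul hθ.continuous hθs hf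
  have e : ∀ x, ((η x - (∫ t, η t) * θ x : ℝ) : ℂ) * f x
      = (η x : ℂ) * f x - ((∫ t, η t : ℝ) : ℂ) * ((θ x : ℂ) * f x) := by
    intro x; push_cast; ring
  simp only [e] at this
  rw [integral_sub i1 (i2.const_mul _), integral_const_mul, sub_eq_zero] at this
  simp only [Complex.real_smul]
  rw [this, integral_mul_const, integral_complex_ofReal]

/-- The difference of `f` and a primitive of `g` has vanishing weak derivative, so it is almost
everywhere constant. -/
lemma IsWeakDeriv.exists_antideriv {f g : ℝ → ℂ} (h : IsWeakDeriv 1 f g) :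
    ∃ F : ℝ → ℂ, f =ᵐ[volume] F ∧ IsAntideriv F g := by
  rw [isWeakDeriv_one_iff] at h
  have hG := isAntideriv_primitive h.2.1 0 0
  have hG' := isWeakDeriv_one_iff.1 hG.isWeakDeriv
  obtain ⟨c, hc⟩ := ae_eq_const_of_weakDeriv_zero (h.1.sub hG'.1) (fun η hη hs => by
    have e := h.2.2 η hη hs
    rw [← hG'.2.2 η hη hs] at e
    have i1 := integrable_test_mul (hη.continuous_deriv (by simp)) hs.deriv h.1
    have i2 := integrable_test_mul (hη.continuous_deriv (by simp)) hs.deriv hG'.1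
    simp only [Pi.sub_apply, mul_sub]
    rw [integral_sub i1 i2, e, sub_self])
  refine ⟨_, ?_, isAntideriv_primitive h.2.1 c 0⟩
  filter_upwards [hc] with x hx
  simp at hx
  linear_combination hx

lemma isWeakDeriv_two_of {f g h : ℝ → ℂ} (h1 : IsWeakDeriv 1 f g) (h2 : IsWeakDeriv 1 g h) :
    IsWeakDeriv 2 f h := by
  rw [isWeakDeriv_one_iff] at h1 h2
  refine ⟨h1.1, h2.2.1, fun η hη hs => ?_⟩
  have := h1.2.2 (deriv η) (by
    exact (contDiff_infty_iff_deriv.1 hη).2) hs.deriv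
  rw [h2.2.2 η hη hs] at this
  simpa [iteratedDeriv_succ] using this

lemma isWeakDeriv_one_of_two {f g h : ℝ → ℂ} (h1 : IsWeakDeriv 1 f g) (h2 : IsWeakDeriv 2 f h) :
    IsWeakDeriv 1 g h := by
  rw [isWeakDeriv_one_iff] at h1 ⊢
  refine ⟨h1.2.1, h2.2.1, fun η hη hs => ?_⟩
  have := h1.2.2 (deriv η) (by
    exact (contDiff_infty_iff_deriv.1 hη).2) hs.deriv
  have h3 := h2.2.2 η hη hs
  simp [iteratedDeriv_succ] at h3
  rw [h3] at this
  rw [this, neg_neg]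

lemma IsWeakDeriv.congr {j : ℕ} {f g F : ℝ → ℂ} (h : IsWeakDeriv j f g) (hF : f =ᵐ[volume] F) :
    IsWeakDeriv j F g := by
  refine ⟨h.1.congr hF, h.2.1, fun η hη hs => ?_⟩
  rw [← h.2.2 η hη hs]
  refine integral_congr_ae ?_
  filter_upwards [hF] with x hx
  rw [hx]

lemma MemSobolev.congr {m : ℕ} {f F : ℝ → ℂ} (h : MemSobolev m f) (hF : f =ᵐ[volume] F) :
    MemSobolev m F :=
  ⟨h.1.ae_eq hF, fun j h1 h2 => (h.2 j h1 h2).imp fun _ hg => ⟨hg.1.congr hF, hg.2⟩⟩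

lemma MemL2s.congr {s : ℕ} {f F : ℝ → ℂ} (h : MemL2s s f) (hF : f =ᵐ[volume] F) : MemL2s s F :=
  ⟨h.1.ae_eq hF, h.2.ae_eq (by filter_upwards [hF] with x hx; rw [hx])⟩

lemma MemWeightedSobolev.congr {k s : ℕ} {f F : ℝ → ℂ} (h : MemWeightedSobolev k s f)
    (hF : f =ᵐ[volume] F) : MemWeightedSobolev k s F :=
  ⟨h.1.congr hF, fun j h1 h2 => (h.2 j h1 h2).imp fun _ hg => ⟨hg.1.congr hF, hg.2⟩⟩

/-! ### Continuous bounded functions in the weighted space -/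

lemma bracket_sq (x : ℝ) : bracket x ^ 2 = 1 + x ^ 2 := by
  rw [bracket, Real.sq_sqrt (by positivity), sq_abs]

lemma continuous_bracket : Continuous bracket := by
  unfold bracket; fun_prop

lemma bracket_neg (x : ℝ) : bracket (-x) = bracket x := by simp [bracket]

/-- Continuous bounded functions in `L^{2,1}(ℝ)`. -/
structure Decaying (u : ℝ → ℂ) : Prop where
  cont : Continuous u
  bdd : ∃ M : ℝ, ∀ x, ‖u x‖ ≤ M
  l2s : MemL2s 1 u

lemma MemL2s.of_le {u w : ℝ → ℂ} {s : ℕ} (hu : MemL2s s u) (hw : AEStronglyMeasurable w)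
    {C : ℝ} (h : ∀ x, ‖w x‖ ≤ C * ‖u x‖) : MemL2s s w := by
  refine ⟨hu.1.of_le_mul hw (ae_of_all _ h), hu.2.of_le_mul (c := C) ?_ (ae_of_all _ fun x => ?_)⟩
  · exact (Complex.continuous_ofReal.comp (continuous_bracket.pow s)).aestronglyMeasurable.mul hw
  · rw [norm_mul, norm_mul]
    nlinarith [h x, norm_nonneg ((bracket x ^ s : ℝ) : ℂ)]

lemma Decaying.of_le {u w : ℝ → ℂ} (hu : Decaying u) (hw : Continuous w) {C : ℝ}
    (hC : 0 ≤ C) (h : ∀ x, ‖w x‖ ≤ C * ‖u x‖) : Decaying w where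
  cont := hw
  bdd := by
    obtain ⟨M, hM⟩ := hu.bdd
    exact ⟨C * M, fun x => (h x).trans (mul_le_mul_of_nonneg_left (hM x) hC)⟩
  l2s := hu.l2s.of_le hw.aestronglyMeasurable h

lemma Decaying.add {u w : ℝ → ℂ} (hu : Decaying u) (hw : Decaying w) :
    Decaying (fun x => u x + w x) where
  cont := hu.cont.add hw.cont
  bdd := by
    obtain ⟨M, hM⟩ := hu.bdd
    obtain ⟨N, hN⟩ := hw.bdd
    exact ⟨M + N, fun x => (norm_add_le _ _).trans (add_le_add (hM x) (hN x))⟩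
  l2s := by
    refine ⟨hu.l2s.1.add hw.l2s.1, ?_⟩
    simp only [mul_add]
    exact hu.l2s.2.add hw.l2s.2

lemma Decaying.bdd_mul {u b : ℝ → ℂ} (hu : Decaying u) (hb : Continuous b) {M : ℝ}
    (hM : ∀ x, ‖b x‖ ≤ M) : Decaying (fun x => b x * u x) := by
  refine hu.of_le (hb.mul hu.cont) ((norm_nonneg _).trans (hM 0)) fun x => ?_
  rw [norm_mul]
  exact mul_le_mul_of_nonneg_right (hM x) (norm_nonneg _)

lemma Decaying.const_mul {u : ℝ → ℂ} (hu : Decaying u) (c : ℂ) : Decaying (fun x => c * u x) :=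
  hu.bdd_mul continuous_const (M := ‖c‖) fun _ => le_rfl

lemma Decaying.mul {u w : ℝ → ℂ} (hu : Decaying u) (hw : Decaying w) :
    Decaying (fun x => u x * w x) :=
  hw.bdd_mul hu.cont hu.bdd.choose_spec

lemma Decaying.conj {u : ℝ → ℂ} (hu : Decaying u) : Decaying (fun x => conj (u x)) :=
  hu.of_le (Complex.continuous_conj.comp hu.cont) zero_le_one (fun x => by simp)

lemma Decaying.comp_neg {u : ℝ → ℂ} (hu : Decaying u) : Decaying (fun x => u (-x)) where
  cont := hu.cont.comp continuous_neg
  bdd := hu.bdd.imp fun _ h x => h (-x)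
  l2s := by
    have hmp : MeasurePreserving (fun x : ℝ => -x) volume volume :=
      Measure.measurePreserving_neg volume
    refine ⟨hu.l2s.1.comp_measurePreserving hmp, ?_⟩
    have := hu.l2s.2.comp_measurePreserving hmp
    simpa [Function.comp_def, bracket_neg] using this

lemma Decaying.sq_integrable {u : ℝ → ℂ} (hu : Decaying u) : Integrable (fun x => ‖u x‖ ^ 2) :=
  hu.l2s.1.integrable_norm_pow (by norm_num)

lemma Decaying.weighted_sq_integrable {u : ℝ → ℂ} (hu : Decaying u) :
    Integrable (fun x => (1 + x ^ 2) * ‖u x‖ ^ 2) := by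
  have := hu.l2s.2.integrable_norm_pow (by norm_num)
  refine this.congr (ae_of_all _ fun x => ?_)
  simp only [pow_one, norm_mul, Complex.norm_real, Real.norm_eq_abs]
  rw [mul_pow, sq_abs, bracket_sq]

/-- L^{2,1} embeds in L¹: pointwise |u| ≤ (1 + x²)⁻¹ + (1 + x²)|u|², by the inequality t ≤ 1 + t²
with t = (1 + x²)|u|. This makes the Volterra kernels of the Jost equations integrable. -/
lemma Decaying.norm_integrable {u : ℝ → ℂ} (hu : Decaying u) : Integrable (fun x => ‖u x‖) := by
  refine (integrable_inv_one_add_sq.add hu.weighted_sq_integrable).mono'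
    hu.cont.norm.aestronglyMeasurable (ae_of_all _ fun x => ?_)
  simp only [Pi.add_apply, norm_norm]
  have h1 : (0 : ℝ) < 1 + x ^ 2 := by positivity
  have h2 : ‖u x‖ = (1 + x ^ 2)⁻¹ * ((1 + x ^ 2) * ‖u x‖) := by field_simp
  have h3 : (1 + x ^ 2) * ‖u x‖ ^ 2 = (1 + x ^ 2)⁻¹ * ((1 + x ^ 2) * ‖u x‖) ^ 2 := by field_simp
  rw [h3, h2, ← mul_one_add]
  have h4 : (0 : ℝ) < (1 + x ^ 2)⁻¹ := by positivity
  refine mul_le_mul_of_nonneg_left ?_ h4.le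
  rw [← h2]
  nlinarith [sq_nonneg ((1 + x ^ 2) * ‖u x‖ - 1)]

lemma decaying_of_weighted_sq_integrable {u : ℝ → ℂ} (hc : Continuous u) {M : ℝ}
    (hM : ∀ x, ‖u x‖ ≤ M) (h : Integrable (fun x => (1 + x ^ 2) * ‖u x‖ ^ 2)) : Decaying u := by
  refine ⟨hc, ⟨M, hM⟩, ?_, ?_⟩
  · rw [memLp_two_iff_integrable_sq_norm hc.aestronglyMeasurable]
    refine h.mono' (hc.norm.pow 2).aestronglyMeasurable (ae_of_all _ fun x => ?_)
    rw [norm_pow, norm_norm]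
    nlinarith [mul_nonneg (sq_nonneg x) (sq_nonneg ‖u x‖)]
  · have hc2 : Continuous (fun x => ((bracket x ^ 1 : ℝ) : ℂ) * u x) :=
      (Complex.continuous_ofReal.comp (continuous_bracket.pow 1)).mul hc
    rw [memLp_two_iff_integrable_sq_norm hc2.aestronglyMeasurable]
    refine h.congr (ae_of_all _ fun x => ?_)
    simp only [pow_one, norm_mul, Complex.norm_real, Real.norm_eq_abs]
    rw [mul_pow, sq_abs, bracket_sq]

/-! ### Regular potentials -/

lemma IsAntideriv.hasDerivAt {F f : ℝ → ℂ} (h : IsAntideriv F f) (hf : Continuous f) (x : ℝ) :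
    HasDerivAt F (f x) x := by
  rw [h.eq_add 0]
  exact ((hf.integral_hasStrictDerivAt 0 x).hasDerivAt).const_add _

lemma IsAntideriv.congr {F f g : ℝ → ℂ} (h : IsAntideriv F f) (hfg : f =ᵐ[volume] g) :
    IsAntideriv F g := by
  refine ⟨h.locInt.congr hfg, fun x y => ?_⟩
  rw [h.sub_eq]
  exact intervalIntegral.integral_congr_ae (by filter_upwards [hfg] with t ht _ using ht)

lemma IsAntideriv.congr_left {F G f : ℝ → ℂ} (h : IsAntideriv F f) (hFG : ∀ x, F x = G x) :
    IsAntideriv G f := by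
  rwa [← funext hFG]

/-- The embedding of H¹ in L^∞ on the line: compare F(x) with F(y) for y in [x, x + 1], average over
y, and bound t by 1 + t² to pass from L¹ to L² quantities. -/
lemma IsAntideriv.bdd {F f : ℝ → ℂ} (h : IsAntideriv F f) (hF : MemLp F 2) (hf : MemLp f 2) :
    ∃ M : ℝ, ∀ x, ‖F x‖ ≤ M := by
  have iF : Integrable (fun x => ‖F x‖ ^ 2) := hF.integrable_norm_pow (by norm_num)
  have jf : Integrable (fun x => ‖f x‖ ^ 2) := hf.integrable_norm_pow (by norm_num)
  refine ⟨2 + ∫ x, (‖F x‖ ^ 2 + ‖f x‖ ^ 2), fun x => ?_⟩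
  have hle : x ≤ x + 1 := by linarith
  have key : ∀ y ∈ Set.Icc x (x + 1), ‖F x‖ ≤ ‖F y‖ + ∫ s in x..(x + 1), ‖f s‖ := by
    intro y hy
    have h1 : F x = F y - ∫ s in x..y, f s := by rw [← h.sub_eq]; ring
    rw [h1]
    refine (norm_sub_le _ _).trans (add_le_add_right ?_ _)
    refine (intervalIntegral.norm_integral_le_integral_norm hy.1).trans ?_
    exact intervalIntegral.integral_mono_interval le_rfl hy.1 hy.2
      (ae_of_all _ fun _ => norm_nonneg _) (locInt_intervalIntegrable h.locInt _ _).norm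
  have hFi : IntervalIntegrable (fun y => ‖F y‖) volume x (x + 1) :=
    h.continuous.norm.intervalIntegrable _ _
  have hfi : IntervalIntegrable (fun y => ‖f y‖) volume x (x + 1) :=
    (locInt_intervalIntegrable h.locInt _ _).norm
  have h2 := intervalIntegral.integral_mono_on hle
    (intervalIntegrable_const (c := ‖F x‖)) (hFi.add intervalIntegrable_const) key
  rw [intervalIntegral.integral_add hFi intervalIntegrable_const] at h2
  simp only [intervalIntegral.integral_const, add_sub_cancel_left, one_smul] at h2
  rw [← intervalIntegral.integral_add hFi hfi] at h2
  refine h2.trans ?_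
  have iFi : IntervalIntegrable (fun y => ‖F y‖ ^ 2 + ‖f y‖ ^ 2) volume x (x + 1) :=
    (iF.add jf).intervalIntegrable
  calc ∫ y in x..(x + 1), (‖F y‖ + ‖f y‖)
      ≤ ∫ y in x..(x + 1), (2 + (‖F y‖ ^ 2 + ‖f y‖ ^ 2)) := by
        refine intervalIntegral.integral_mono_on hle (hFi.add hfi)
          (intervalIntegrable_const.add iFi) fun y _ => ?_
        nlinarith [sq_nonneg (‖F y‖ - 1), sq_nonneg (‖f y‖ - 1)]
    _ = 2 + ∫ y in x..(x + 1), (‖F y‖ ^ 2 + ‖f y‖ ^ 2) := by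
        rw [intervalIntegral.integral_add intervalIntegrable_const iFi]
        simp
    _ ≤ _ := by
        rw [intervalIntegral.integral_of_le hle]
        exact add_le_add_right (setIntegral_le_integral (iF.add jf)
          (ae_of_all _ fun y => by simp only [Pi.zero_apply, Pi.add_apply]; positivity)) _

/-- `q` is a representative of a function in `H² ∩ H^{1,1}` that is continuously differentiable
with absolutely continuous derivative. -/
def IsRegular (q : ℝ → ℂ) : Prop :=
  ∃ q₁ q₂ : ℝ → ℂ, Decaying q ∧ Decaying q₁ ∧ (∀ x, HasDerivAt q (q₁ x) x) ∧
    IsAntideriv q₁ q₂ ∧ MemLp q₂ 2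

lemma IsRegular.decaying {q : ℝ → ℂ} (h : IsRegular q) : Decaying q := by
  obtain ⟨_, _, h, _⟩ := h
  exact h

lemma exists_regular_representative {q : ℝ → ℂ} (h2 : MemSobolev 2 q)
    (h1 : MemWeightedSobolev 1 1 q) : ∃ Q, q =ᵐ[volume] Q ∧ IsRegular Q := by
  obtain ⟨g₁, hw₁, hg₁⟩ := h2.2 1 le_rfl one_le_two
  obtain ⟨g₂, hw₂, hg₂⟩ := h2.2 2 one_le_two le_rfl
  obtain ⟨k, hwk, hk⟩ := h1.2 1 le_rfl le_rfl
  obtain ⟨G, hG, hGa⟩ := (isWeakDeriv_one_of_two hw₁ hw₂).exists_antideriv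
  obtain ⟨Q, hQ, hQa⟩ := hw₁.exists_antideriv
  -- The two Sobolev conditions each provide a first weak derivative; uniqueness transfers the
  -- weighted bound to the one that has a second derivative.
  have hkG := (isWeakDeriv_one_unique hwk hw₁).trans hG
  have hQG := hQa.congr hG
  have lG : MemLp G 2 := hg₁.ae_eq hG
  have lQ : MemLp Q 2 := h2.1.ae_eq hQ
  exact ⟨Q, hQ, G, g₂, ⟨hQa.continuous, hQG.bdd lQ lG, h1.1.congr hQ⟩,
    ⟨hGa.continuous, hGa.bdd lG hg₂, hk.congr hkG⟩, hQG.hasDerivAt hGa.continuous, hGa, hg₂⟩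

lemma IsRegular.memSobolev {q : ℝ → ℂ} (h : IsRegular q) : MemSobolev 2 q := by
  obtain ⟨q₁, q₂, h0, h1, hd, ha, h2⟩ := h
  have w1 := (isAntideriv_of_hasDerivAt h1.cont hd).isWeakDeriv
  refine ⟨h0.l2s.1, fun j hj1 hj2 => ?_⟩
  interval_cases j
  · exact ⟨q₁, w1, h1.l2s.1⟩
  · exact ⟨q₂, isWeakDeriv_two_of w1 ha.isWeakDeriv, h2⟩

lemma IsRegular.memWeightedSobolev {q : ℝ → ℂ} (h : IsRegular q) : MemWeightedSobolev 1 1 q := by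
  obtain ⟨q₁, q₂, h0, h1, hd, ha, h2⟩ := h
  refine ⟨h0.l2s, fun j hj1 hj2 => ?_⟩
  interval_cases j
  exact ⟨q₁, (isAntideriv_of_hasDerivAt h1.cont hd).isWeakDeriv, h1.l2s⟩

/-- Bounded `C¹` functions with bounded derivative. -/
structure BddC1 (u u' : ℝ → ℂ) : Prop where
  hasDeriv : ∀ x, HasDerivAt u (u' x) x
  cont' : Continuous u'
  bdd : ∃ M : ℝ, ∀ x, ‖u x‖ ≤ M
  bdd' : ∃ M : ℝ, ∀ x, ‖u' x‖ ≤ M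

/-- `C¹` functions that decay together with their derivative. -/
structure DecayingC1 (u u' : ℝ → ℂ) : Prop where
  hasDeriv : ∀ x, HasDerivAt u (u' x) x
  dec : Decaying u
  dec' : Decaying u'

lemma BddC1.cont {u u' : ℝ → ℂ} (h : BddC1 u u') : Continuous u :=
  continuous_iff_continuousAt.2 fun x => (h.hasDeriv x).continuousAt

lemma DecayingC1.bddC1 {u u' : ℝ → ℂ} (h : DecayingC1 u u') : BddC1 u u' :=
  ⟨h.hasDeriv, h.dec'.cont, h.dec.bdd, h.dec'.bdd⟩

lemma hasDerivAt_conj {u : ℝ → ℂ} {u' : ℂ} {x : ℝ} (h : HasDerivAt u u' x) :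
    HasDerivAt (fun x => conj (u x)) (conj u') x :=
  (Complex.conjCLE.toContinuousLinearMap.hasFDerivAt.comp_hasDerivAt x h)

lemma DecayingC1.conj {u u' : ℝ → ℂ} (h : DecayingC1 u u') :
    DecayingC1 (fun x => conj (u x)) (fun x => conj (u' x)) :=
  ⟨fun x => hasDerivAt_conj (h.hasDeriv x), h.dec.conj, h.dec'.conj⟩

lemma BddC1.conj {u u' : ℝ → ℂ} (h : BddC1 u u') :
    BddC1 (fun x => conj (u x)) (fun x => conj (u' x)) :=
  ⟨fun x => hasDerivAt_conj (h.hasDeriv x), Complex.continuous_conj.comp h.cont',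
    h.bdd.imp fun _ hM x => by simpa using hM x, h.bdd'.imp fun _ hM x => by simpa using hM x⟩

lemma DecayingC1.add {u u' w w' : ℝ → ℂ} (hu : DecayingC1 u u') (hw : DecayingC1 w w') :
    DecayingC1 (fun x => u x + w x) (fun x => u' x + w' x) :=
  ⟨fun x => (hu.hasDeriv x).add (hw.hasDeriv x), hu.dec.add hw.dec, hu.dec'.add hw.dec'⟩

lemma DecayingC1.bdd_mul {u u' b b' : ℝ → ℂ} (hb : BddC1 b b') (hu : DecayingC1 u u') :
    DecayingC1 (fun x => b x * u x) (fun x => b' x * u x + b x * u' x) :=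
  ⟨fun x => (hb.hasDeriv x).mul (hu.hasDeriv x), hu.dec.bdd_mul hb.cont hb.bdd.choose_spec,
    (hu.dec.bdd_mul hb.cont' hb.bdd'.choose_spec).add
      (hu.dec'.bdd_mul hb.cont hb.bdd.choose_spec)⟩

lemma DecayingC1.const_mul {u u' : ℝ → ℂ} (c : ℂ) (hu : DecayingC1 u u') :
    DecayingC1 (fun x => c * u x) (fun x => c * u' x) :=
  ⟨fun x => (hu.hasDeriv x).const_mul c, hu.dec.const_mul c, hu.dec'.const_mul c⟩

lemma DecayingC1.mul {u u' w w' : ℝ → ℂ} (hu : DecayingC1 u u') (hw : DecayingC1 w w') :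
    DecayingC1 (fun x => u x * w x) (fun x => u' x * w x + u x * w' x) :=
  hw.bdd_mul hu.bddC1

/-- In the derivative of P every term is C¹ except α²q₁, which is only absolutely continuous and
contributes α²q₂ to the second derivative. -/
lemma isRegular_of_bddC1 {q P α α₁ α₂ γ γ₁ γ₂ : ℝ → ℂ} (hq : IsRegular q)
    (hα : BddC1 α α₁) (hα₁ : DecayingC1 α₁ α₂) (hγ : DecayingC1 γ γ₁) (hγ₁ : DecayingC1 γ₁ γ₂)
    (hP : ∀ x, P x = α x ^ 2 * q x + 2 * Complex.I * (α x * γ x)) : IsRegular P := by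
  obtain ⟨q₁, q₂, h0, h1, hd, ha, h2⟩ := hq
  have dq : DecayingC1 q q₁ := ⟨hd, h0, h1⟩
  have dP := ((dq.bdd_mul hα).bdd_mul hα).add ((hγ.bdd_mul hα).const_mul (2 * Complex.I))
  have hPe : (fun x => α x * (α x * q x) + 2 * Complex.I * (α x * γ x)) = P := by
    funext x; rw [hP]; ring
  rw [hPe] at dP
  have A := isAntideriv_of_hasDerivAt hα.cont' hα.hasDeriv
  have rest := (hα₁.mul (dq.bdd_mul hα)).add ((((hα₁.mul dq).bdd_mul hα)).add
    (((hα₁.mul hγ).add (hγ₁.bdd_mul hα)).const_mul (2 * Complex.I)))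
  have total := (isAntideriv_of_hasDerivAt rest.dec'.cont rest.hasDeriv).add (A.mul (A.mul ha))
  refine ⟨_, _, dP.dec, dP.dec', dP.hasDeriv, total.congr_left fun x => by ring, ?_⟩
  obtain ⟨M, hM⟩ := hα.bdd
  obtain ⟨M', hM'⟩ := hα.bdd'
  have m2 : MemLp (fun x => α x * (α x * q₂ x)) 2 := by
    refine h2.of_le_mul (c := M * M)
      (hα.cont.aestronglyMeasurable.mul (hα.cont.aestronglyMeasurable.mul h2.1))
      (ae_of_all _ fun x => ?_)
    rw [norm_mul, norm_mul, ← mul_assoc]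
    have h3 := hM x
    have h4 : 0 ≤ M := (norm_nonneg _).trans h3
    gcongr
  have l1 := (h1.bdd_mul hα.cont' hM').bdd_mul hα.cont hM
  have l2 := (h1.bdd_mul hα.cont hM).bdd_mul hα.cont' hM'
  refine (rest.dec'.l2s.1.add ((l2.add l1).l2s.1.add m2)).ae_eq (ae_of_all _ fun x => ?_)
  simp only [Pi.add_apply]
  ring

/-- The potential `α² q + 2i α γ` is regular when `q` is regular and `α`, `γ` solve the system of
differential equations satisfied by the coefficients of a Darboux matrix. -/
theorem isRegular_of_system {q P α γ : ℝ → ℂ} {κ : ℂ} (hq : IsRegular q)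
    (hα : ∀ x, ‖α x‖ = 1) (hγ : Decaying γ)
    (hP : ∀ x, P x = α x ^ 2 * q x + 2 * Complex.I * (α x * γ x))
    (hα' : ∀ x, HasDerivAt α
      (α x * (-(Complex.I / 4) * (P x * conj (P x)) + Complex.I / 4 * (q x * conj (q x)))) x)
    (hγ' : ∀ x, HasDerivAt γ (Complex.I / 4 * ((P x * conj (P x) + q x * conj (q x)) * γ x)
      + (-κ * (α x * P x) + κ * (conj (α x) * q x))) x) :
    IsRegular P := by
  have cα : Continuous α := continuous_iff_continuousAt.2 fun x => (hα' x).continuousAt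
  obtain ⟨q₁, dq⟩ : ∃ q₁, DecayingC1 q q₁ := by
    obtain ⟨q₁, q₂, h0, h1, hd, -⟩ := hq
    exact ⟨q₁, hd, h0, h1⟩
  have h0 := dq.dec
  -- The bootstrap: P decays by its formula, so α' and γ' decay; then P is C¹ with decaying
  -- derivative, so α' and γ' are themselves C¹ with decaying derivatives.
  have dP : Decaying P := by
    have := (h0.bdd_mul (cα.pow 2) (M := 1) fun x => by simp [hα x]).add
      ((hγ.bdd_mul cα (M := 1) fun x => by simp [hα x]).const_mul (2 * Complex.I))
    convert this using 2 with x
    exact hP x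
  have dα' := ((((dP.mul dP.conj).const_mul (-(Complex.I / 4))).add
    ((h0.mul h0.conj).const_mul (Complex.I / 4))).bdd_mul cα (M := 1) fun x => by simp [hα x])
  have bα : BddC1 α _ := ⟨hα', dα'.cont, ⟨1, fun x => (hα x).le⟩, dα'.bdd⟩
  have dγ' := ((((dP.mul dP.conj).add (h0.mul h0.conj)).mul hγ).const_mul (Complex.I / 4)).add
    (((dP.bdd_mul cα (M := 1) fun x => by simp [hα x]).const_mul (-κ)).add
    ((h0.bdd_mul bα.conj.cont (M := 1) fun x => by simp [hα x]).const_mul κ))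
  have dγ : DecayingC1 γ _ := ⟨hγ', hγ, dγ'⟩
  have dP1 := (DecayingC1.bdd_mul bα (dq.bdd_mul bα)).add
    ((dγ.bdd_mul bα).const_mul (2 * Complex.I))
  have hPe : (fun x => α x * (α x * q x) + 2 * Complex.I * (α x * γ x)) = P := by
    funext x; rw [hP]; ring
  rw [hPe] at dP1
  exact isRegular_of_bddC1 hq bα ((((dP1.mul dP1.conj).const_mul (-(Complex.I / 4))).add
      ((dq.mul dq.conj).const_mul (Complex.I / 4))).bdd_mul bα) dγ
    (((((dP1.mul dP1.conj).add (dq.mul dq.conj)).mul dγ).const_mul (Complex.I / 4)).add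
      (((dP1.bdd_mul bα).const_mul (-κ)).add ((dq.bdd_mul bα.conj).const_mul κ))) hP

/-! ### Volterra estimates on half-lines -/

section Volterra

variable {E : Type*} [NormedAddCommGroup E] [NormedSpace ℝ E] [CompleteSpace E]

lemma hasDerivAt_integral_Iic {h : ℝ → E} (hc : Continuous h)
    (hi : ∀ x, IntegrableOn h (Set.Iic x)) (x : ℝ) :
    HasDerivAt (fun x => ∫ y in Set.Iic x, h y) (h x) x := by
  have e : (fun x => ∫ y in Set.Iic x, h y)
      = fun x => (∫ y in Set.Iic 0, h y) + ∫ y in (0 : ℝ)..x, h y := by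
    funext x
    rw [← intervalIntegral.integral_Iic_sub_Iic (hi 0) (hi x)]
    abel
  rw [e]
  exact ((hc.integral_hasStrictDerivAt 0 x).hasDerivAt).const_add _

end Volterra

/-- The primitive of an integrable function vanishing at `-∞`. -/
noncomputable def tailInt (k : ℝ → ℝ) (x : ℝ) : ℝ := ∫ y in Set.Iic x, k y

section Weight

variable {k : ℝ → ℝ} (hc : Continuous k) (hi : Integrable k) (h0 : ∀ x, 0 ≤ k x)

include hc hi in
lemma hasDerivAt_tailInt (x : ℝ) : HasDerivAt (tailInt k) (k x) x :=
  hasDerivAt_integral_Iic hc (fun _ => hi.integrableOn) x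

include h0 in
lemma tailInt_nonneg (x : ℝ) : 0 ≤ tailInt k x := integral_nonneg h0

include hi h0 in
lemma tailInt_le (x : ℝ) : tailInt k x ≤ ∫ y, k y :=
  setIntegral_le_integral hi (ae_of_all _ h0)

lemma tendsto_tailInt : Tendsto (tailInt k) atBot (𝓝 0) := tendsto_integral_Iic_zero tendsto_id

include hc hi in
lemma continuous_exp_tailInt : Continuous fun x => Real.exp (2 * tailInt k x) := by
  have : Continuous (tailInt k) :=
    continuous_iff_continuousAt.2 fun x => (hasDerivAt_tailInt hc hi x).continuousAt
  fun_prop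

include hc hi h0 in
lemma integrable_mul_exp_tailInt : Integrable fun x => k x * Real.exp (2 * tailInt k x) := by
  refine hi.mul_bdd (c := Real.exp (2 * ∫ y, k y))
    (continuous_exp_tailInt hc hi).aestronglyMeasurable (ae_of_all _ fun x => ?_)
  rw [Real.norm_eq_abs, Real.abs_exp]
  have := tailInt_le hi h0 x
  gcongr

-- With K the tail integral of k, the integrand is the derivative of exp(2K)/2. The factor 2 in the
-- exponent produces the constant 1/2 that makes Volterra operators contract in the norm weighted by
-- exp(2K).
include hc hi h0 in
lemma integral_mul_exp_tailInt (x : ℝ) :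
    ∫ y in Set.Iic x, k y * Real.exp (2 * tailInt k y) = (Real.exp (2 * tailInt k x) - 1) / 2 := by
  have hd : ∀ y ∈ Set.Iic x, HasDerivAt (fun y => Real.exp (2 * tailInt k y) / 2)
      (k y * Real.exp (2 * tailInt k y)) y := fun y _ => by
    refine (((hasDerivAt_tailInt hc hi y).const_mul 2).exp.div_const 2).congr_deriv ?_
    ring
  have ht : Tendsto (fun y => Real.exp (2 * tailInt k y) / 2) atBot (𝓝 (1 / 2)) := by
    have := (((tendsto_tailInt (k := k)).const_mul 2).rexp).div_const 2
    simpa using this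
  rw [integral_Iic_of_hasDerivAt_of_tendsto' hd (integrable_mul_exp_tailInt hc hi h0).integrableOn
    ht]
  ring

include hc hi h0 in
/-- A Gronwall inequality on `(-∞, x]` for bounded functions. -/
lemma volterra_gronwall {φ : ℝ → ℝ} {ε M : ℝ} (hφc : Continuous φ) (hφ0 : ∀ x, 0 ≤ φ x)
    (hM : ∀ x, φ x ≤ M) (h : ∀ x, φ x ≤ ε + ∫ y in Set.Iic x, k y * φ y) (x : ℝ) :
    φ x ≤ 2 * ε * Real.exp (2 * tailInt k x) := by
  set W := fun x => Real.exp (2 * tailInt k x) with hW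
  have W1 : ∀ x, 1 ≤ W x := fun x => Real.one_le_exp (by have := tailInt_nonneg h0 x; linarith)
  have hkφ : Integrable (fun y => k y * φ y) :=
    hi.mul_bdd (c := M) hφc.aestronglyMeasurable (ae_of_all _ fun y => by
      rw [Real.norm_of_nonneg (hφ0 y)]; exact hM y)
  -- The weighted supremum will satisfy S ≤ ε + S/2, hence S ≤ 2ε.
  set S := ⨆ x, φ x / W x with hS
  have hbdd : BddAbove (Set.range fun x => φ x / W x) := by
    refine ⟨M, ?_⟩
    rintro _ ⟨x, rfl⟩
    exact (div_le_self (hφ0 x) (W1 x)).trans (hM x)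
  have hle : ∀ x, φ x ≤ S * W x := fun x => by
    rw [← div_le_iff₀ (by have := W1 x; linarith)]
    exact le_ciSup hbdd x
  have hS0 : 0 ≤ S := (div_nonneg (hφ0 0) (by have := W1 0; linarith)).trans (le_ciSup hbdd 0)
  have hε : ∀ x, φ x ≤ ε + S * ((W x - 1) / 2) := fun x => by
    refine (h x).trans (add_le_add_right ?_ _)
    rw [← integral_mul_exp_tailInt hc hi h0 x, ← integral_const_mul]
    refine integral_mono hkφ.integrableOn
      ((integrable_mul_exp_tailInt hc hi h0).integrableOn.const_mul _) fun y => ?_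
    have := mul_le_mul_of_nonneg_left (hle y) (h0 y)
    simp only
    linarith
  have hε0 : 0 ≤ ε := by
    -- Letting x → -∞ in the hypothesis shows that ε cannot be negative.
    have t : Tendsto (fun x => ε + ∫ y in Set.Iic x, k y * φ y) atBot (𝓝 (ε + 0)) :=
      (tendsto_integral_Iic_zero tendsto_id).const_add _
    rw [add_zero] at t
    exact ge_of_tendsto' t fun x => (hφ0 x).trans (h x)
  have hS2 : S ≤ ε + S / 2 := by
    refine ciSup_le fun x => ?_
    have hx := W1 x
    rw [div_le_iff₀ (by linarith)]
    have := hε x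
    nlinarith
  have := hle x
  have := W1 x
  nlinarith

end Weight

/-! ### The Duhamel integral -/

/-- The solution of `z' = κ z + h` vanishing at `-∞`. -/
noncomputable def duhamel (κ : ℂ) (h : ℝ → ℂ) (x : ℝ) : ℂ :=
  Complex.exp (κ * x) * ∫ y in Set.Iic x, Complex.exp (-κ * y) * h y

section Duhamel

variable {κ : ℂ} {h : ℝ → ℂ}

lemma norm_exp_mul_le {x y : ℝ} (hκ : κ.re ≤ 0) (hxy : y ≤ x) :
    ‖Complex.exp (-κ * y)‖ ≤ Real.exp (-κ.re * x) := by
  rw [Complex.norm_exp]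
  simp only [Complex.mul_re, Complex.neg_re, Complex.neg_im, Complex.ofReal_re, Complex.ofReal_im,
    mul_zero, sub_zero]
  exact Real.exp_le_exp.2 (by nlinarith)

lemma duhamel_integrableOn (hκ : κ.re ≤ 0) (hi : Integrable h) (x : ℝ) :
    IntegrableOn (fun y : ℝ => Complex.exp (-κ * y) * h y) (Set.Iic x) := by
  refine (hi.integrableOn (s := Set.Iic x)).bdd_mul (c := Real.exp (-κ.re * x))
    (Continuous.aestronglyMeasurable (by fun_prop)) ?_
  filter_upwards [ae_restrict_mem measurableSet_Iic] with y hy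
  exact norm_exp_mul_le hκ hy

lemma hasDerivAt_exp_mul (c : ℂ) (x : ℝ) :
    HasDerivAt (fun x : ℝ => Complex.exp (c * x)) (c * Complex.exp (c * x)) x := by
  have := ((Complex.ofRealCLM.hasDerivAt (x := x)).const_mul c).cexp
  simpa [mul_comm] using this

lemma hasDerivAt_duhamel (hκ : κ.re ≤ 0) (hc : Continuous h) (hi : Integrable h) (x : ℝ) :
    HasDerivAt (duhamel κ h) (κ * duhamel κ h x + h x) x := by
  have h1 := hasDerivAt_integral_Iic (h := fun y : ℝ => Complex.exp (-κ * y) * h y)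
    (by fun_prop) (duhamel_integrableOn hκ hi) x
  refine ((hasDerivAt_exp_mul κ x).mul h1).congr_deriv ?_
  have : Complex.exp (κ * x) * Complex.exp (-κ * x) = 1 := by
    rw [← Complex.exp_add]; simp
  simp only [duhamel]
  linear_combination h x * this

lemma continuous_duhamel (hκ : κ.re ≤ 0) (hc : Continuous h) (hi : Integrable h) :
    Continuous (duhamel κ h) :=
  continuous_iff_continuousAt.2 fun x => (hasDerivAt_duhamel hκ hc hi x).continuousAt

lemma duhamel_eq (x : ℝ) :
    duhamel κ h x = ∫ y in Set.Iic x, Complex.exp (κ * ((x - y : ℝ) : ℂ)) * h y := by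
  rw [duhamel, ← integral_const_mul]
  congr 1
  funext y
  rw [← mul_assoc, ← Complex.exp_add]
  congr 2
  push_cast
  ring

lemma norm_exp_mul_sub_le {x y : ℝ} (hκ : κ.re ≤ 0) (hxy : y ≤ x) :
    ‖Complex.exp (κ * ((x - y : ℝ) : ℂ))‖ ≤ 1 := by
  rw [Complex.norm_exp, Real.exp_le_one_iff, Complex.re_mul_ofReal]
  nlinarith

lemma norm_duhamel_le (hκ : κ.re ≤ 0) (hi : Integrable h) (x : ℝ) :
    ‖duhamel κ h x‖ ≤ ∫ y in Set.Iic x, ‖h y‖ := by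
  rw [duhamel_eq]
  refine norm_integral_le_of_norm_le hi.norm.integrableOn ?_
  filter_upwards [ae_restrict_mem measurableSet_Iic] with y hy
  rw [norm_mul]
  exact mul_le_of_le_one_left (norm_nonneg _) (norm_exp_mul_sub_le hκ hy)

lemma tendsto_duhamel (hκ : κ.re ≤ 0) (hi : Integrable h) :
    Tendsto (duhamel κ h) atBot (𝓝 0) :=
  squeeze_zero_norm (norm_duhamel_le hκ hi) (tendsto_integral_Iic_zero tendsto_id)

/-- Integrating factor: on the negative half-line exp(-κy) is bounded because Re κ ≤ 0, so exp(-κy)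
z still vanishes at -∞ and no homogeneous solution can be added. -/
lemma eq_duhamel (hκ : κ.re ≤ 0) (hi : Integrable h) {z : ℝ → ℂ}
    (hz : ∀ x, HasDerivAt z (κ * z x + h x) x) (ht : Tendsto z atBot (𝓝 0)) :
    z = duhamel κ h := by
  funext x
  have hd : ∀ y ∈ Set.Iic x, HasDerivAt (fun y : ℝ => Complex.exp (-κ * y) * z y)
      (Complex.exp (-κ * y) * h y) y := fun y _ =>
    ((hasDerivAt_exp_mul (-κ) y).mul (hz y)).congr_deriv (by ring)
  have hT : Tendsto (fun y : ℝ => Complex.exp (-κ * y) * z y) atBot (𝓝 0) := by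
    have t2 : Tendsto (fun y => Real.exp (-κ.re * 0) * ‖z y‖) atBot (𝓝 0) := by
      simpa using ht.norm.const_mul (Real.exp (-κ.re * 0))
    refine squeeze_zero_norm' ?_ t2
    filter_upwards [eventually_le_atBot 0] with y hy
    rw [norm_mul]
    exact mul_le_mul_of_nonneg_right (norm_exp_mul_le hκ hy) (norm_nonneg _)
  rw [duhamel, integral_Iic_of_hasDerivAt_of_tendsto' hd (duhamel_integrableOn hκ hi x) hT,
    sub_zero, ← mul_assoc, ← Complex.exp_add]
  simp

lemma duhamel_sub (hκ : κ.re ≤ 0) (hi : Integrable h) {h' : ℝ → ℂ} (hi' : Integrable h') (x : ℝ) :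
    duhamel κ h x - duhamel κ h' x = duhamel κ (fun y => h y - h' y) x := by
  simp only [duhamel, mul_sub]
  rw [integral_sub (duhamel_integrableOn hκ hi x) (duhamel_integrableOn hκ hi' x), mul_sub]

/-- Mean value inequality on the half-plane Re w ≤ -c, where the w-derivative of exp(wt) is at most
t exp(-ct) ≤ 1/c. The strict damping c > 0 is why dependence on λ is controlled only where Im λ² >
0. -/
lemma norm_exp_sub_exp_le {κ κ' : ℂ} {c t : ℝ} (hc : 0 < c) (hκ : κ.re ≤ -c) (hκ' : κ'.re ≤ -c)
    (ht : 0 ≤ t) : ‖Complex.exp (κ * t) - Complex.exp (κ' * t)‖ ≤ ‖κ - κ'‖ / c := by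
  have hs : Convex ℝ {w : ℂ | w.re ≤ -c} := convex_halfSpace_re_le _
  have := hs.norm_image_sub_le_of_norm_hasDerivWithin_le (f := fun w => Complex.exp (w * t))
    (f' := fun w => Complex.exp (w * t) * t) (C := 1 / c) (x := κ') (y := κ) (fun w hw => ?_)
    (fun w hw => ?_) hκ' hκ
  · rwa [one_div_mul_eq_div] at this
  · simpa using ((hasDerivAt_id w).mul_const (t : ℂ)).cexp.hasDerivWithinAt
  · rw [norm_mul, Complex.norm_exp, Complex.re_mul_ofReal, Complex.norm_real,
      Real.norm_of_nonneg ht, le_div_iff₀ hc]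
    have h1 : Real.exp (w.re * t) ≤ Real.exp (-(c * t)) :=
      Real.exp_le_exp.2 (by have : w.re ≤ -c := hw; nlinarith)
    have h2 : c * t ≤ Real.exp (c * t) := by linarith [Real.add_one_le_exp (c * t)]
    calc Real.exp (w.re * t) * t * c ≤ Real.exp (-(c * t)) * (c * t) := by
          rw [mul_assoc, mul_comm t c]; gcongr
      _ ≤ Real.exp (-(c * t)) * Real.exp (c * t) := by gcongr
      _ = 1 := by rw [← Real.exp_add]; simp

lemma norm_duhamel_sub_le {κ κ' : ℂ} {c : ℝ} (hc : 0 < c) (hκ : κ.re ≤ -c) (hκ' : κ'.re ≤ -c)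
    (hi : Integrable h) (x : ℝ) :
    ‖duhamel κ h x - duhamel κ' h x‖ ≤ ‖κ - κ'‖ / c * ∫ y, ‖h y‖ := by
  have i1 := duhamel_integrableOn (hκ.trans (by linarith)) hi x
  have i2 := duhamel_integrableOn (hκ'.trans (by linarith)) hi x
  rw [duhamel, duhamel, ← integral_const_mul, ← integral_const_mul,
    ← integral_sub (i1.const_mul _) (i2.const_mul _), ← integral_const_mul]
  refine (norm_integral_le_of_norm_le (hi.norm.const_mul (‖κ - κ'‖ / c)).integrableOn ?_).trans
    (setIntegral_le_integral (hi.norm.const_mul (‖κ - κ'‖ / c))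
      (ae_of_all _ fun y => by simp only [Pi.zero_apply]; positivity))
  filter_upwards [ae_restrict_mem measurableSet_Iic] with y hy
  have e : ∀ κ : ℂ, Complex.exp (κ * x) * (Complex.exp (-κ * y) * h y)
      = Complex.exp (κ * ((x - y : ℝ) : ℂ)) * h y := fun κ => by
    rw [← mul_assoc, ← Complex.exp_add]
    congr 2
    push_cast
    ring
  rw [e, e, ← sub_mul, norm_mul]
  exact mul_le_mul_of_nonneg_right (norm_exp_sub_exp_le hc hκ hκ' (sub_nonneg.2 hy))
    (norm_nonneg _)

end Duhamel

/-! ### Jost functions normalized at `-∞` -/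

/-- The potential part of the first equation for a Jost function. -/
noncomputable def srcA (p : ℝ → ℂ) (lam : ℂ) (u w : ℝ → ℂ) (y : ℝ) : ℂ :=
  Complex.I / 4 * (p y * conj (p y)) * u y + lam * p y * w y

/-- The potential part of the second equation for a Jost function. -/
noncomputable def srcB (p : ℝ → ℂ) (lam : ℂ) (u w : ℝ → ℂ) (y : ℝ) : ℂ :=
  -(lam * conj (p y)) * u y - Complex.I / 4 * (p y * conj (p y)) * w y

/-- The components of a Jost function `φ₋`, as solutions of differential equations. -/
structure IsJostLeft (p : ℝ → ℂ) (lam : ℂ) (u w : ℝ → ℂ) : Prop where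
  bdd : ∃ M : ℝ, ∀ x, ‖u x‖ ≤ M ∧ ‖w x‖ ≤ M
  deriv_fst : ∀ x, HasDerivAt u (srcA p lam u w x) x
  deriv_snd : ∀ x, HasDerivAt w (2 * Complex.I * lam ^ 2 * w x + srcB p lam u w x) x
  tendsto_fst : Tendsto u atBot (𝓝 1)
  tendsto_snd : Tendsto w atBot (𝓝 0)

/-- The Volterra weight. -/
noncomputable def weight (p : ℝ → ℂ) (Λ : ℝ) (y : ℝ) : ℝ := Λ * ‖p y‖ + ‖p y‖ ^ 2 / 4

section

variable {p : ℝ → ℂ} {lam : ℂ} {Λ : ℝ}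

lemma weight_nonneg (hΛ : 0 ≤ Λ) (x : ℝ) : 0 ≤ weight p Λ x := by
  unfold weight; positivity

lemma continuous_weight (hp : Decaying p) : Continuous (weight p Λ) := by
  have := hp.cont
  unfold weight; fun_prop

lemma integrable_weight (hp : Decaying p) : Integrable (weight p Λ) :=
  (hp.norm_integrable.const_mul Λ).add (hp.sq_integrable.div_const 4)

lemma norm_srcA_le {u w : ℝ → ℂ} {y m : ℝ} (hlam : ‖lam‖ ≤ Λ) (hu : ‖u y‖ ≤ m) (hw : ‖w y‖ ≤ m) :
    ‖srcA p lam u w y‖ ≤ weight p Λ y * m := by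
  have h0 : 0 ≤ m := (norm_nonneg _).trans hu
  have hΛ : 0 ≤ Λ := (norm_nonneg _).trans hlam
  calc ‖srcA p lam u w y‖ ≤ ‖p y‖ ^ 2 / 4 * ‖u y‖ + ‖lam‖ * ‖p y‖ * ‖w y‖ := by
        refine (norm_add_le _ _).trans (le_of_eq ?_)
        simp only [norm_mul, norm_div, Complex.norm_I, RCLike.norm_conj, Complex.norm_ofNat]
        ring
    _ ≤ ‖p y‖ ^ 2 / 4 * m + Λ * ‖p y‖ * m := by gcongr
    _ = _ := by unfold weight; ring

lemma norm_srcB_le {u w : ℝ → ℂ} {y m : ℝ} (hlam : ‖lam‖ ≤ Λ) (hu : ‖u y‖ ≤ m) (hw : ‖w y‖ ≤ m) :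
    ‖srcB p lam u w y‖ ≤ weight p Λ y * m := by
  have h0 : 0 ≤ m := (norm_nonneg _).trans hu
  have hΛ : 0 ≤ Λ := (norm_nonneg _).trans hlam
  calc ‖srcB p lam u w y‖ ≤ ‖lam‖ * ‖p y‖ * ‖u y‖ + ‖p y‖ ^ 2 / 4 * ‖w y‖ := by
        refine (norm_sub_le _ _).trans (le_of_eq ?_)
        simp only [norm_mul, norm_div, Complex.norm_I, RCLike.norm_conj, Complex.norm_ofNat, norm_neg]
        ring
    _ ≤ Λ * ‖p y‖ * m + ‖p y‖ ^ 2 / 4 * m := by gcongr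
    _ = _ := by unfold weight; ring

lemma continuous_srcA (hp : Decaying p) {u w : ℝ → ℂ} (hu : Continuous u) (hw : Continuous w) :
    Continuous (srcA p lam u w) := by
  have := hp.cont
  have := hp.conj.cont
  unfold srcA; fun_prop

lemma continuous_srcB (hp : Decaying p) {u w : ℝ → ℂ} (hu : Continuous u) (hw : Continuous w) :
    Continuous (srcB p lam u w) := by
  have := hp.cont
  have := hp.conj.cont
  unfold srcB; fun_prop

lemma integrable_srcA (hp : Decaying p) {u w : ℝ → ℂ} (hu : Continuous u) (hw : Continuous w)
    {M : ℝ} (hM : ∀ x, ‖u x‖ ≤ M ∧ ‖w x‖ ≤ M) : Integrable (srcA p lam u w) :=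
  ((integrable_weight (Λ := ‖lam‖) hp).mul_const M).mono'
    (continuous_srcA hp hu hw).aestronglyMeasurable
    (ae_of_all _ fun y => norm_srcA_le le_rfl (hM y).1 (hM y).2)

lemma integrable_srcB (hp : Decaying p) {u w : ℝ → ℂ} (hu : Continuous u) (hw : Continuous w)
    {M : ℝ} (hM : ∀ x, ‖u x‖ ≤ M ∧ ‖w x‖ ≤ M) : Integrable (srcB p lam u w) :=
  ((integrable_weight (Λ := ‖lam‖) hp).mul_const M).mono'
    (continuous_srcB hp hu hw).aestronglyMeasurable
    (ae_of_all _ fun y => norm_srcB_le le_rfl (hM y).1 (hM y).2)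

lemma re_two_I_mul_sq (lam : ℂ) : (2 * Complex.I * lam ^ 2).re = -2 * (lam ^ 2).im := by
  simp [Complex.mul_re]

lemma re_two_I_mul_sq_nonpos (h : 0 ≤ (lam ^ 2).im) : (2 * Complex.I * lam ^ 2).re ≤ 0 := by
  rw [re_two_I_mul_sq]; linarith

namespace IsJostLeft

variable {u w : ℝ → ℂ}

lemma cont_fst (h : IsJostLeft p lam u w) : Continuous u :=
  continuous_iff_continuousAt.2 fun x => (h.deriv_fst x).continuousAt

lemma cont_snd (h : IsJostLeft p lam u w) : Continuous w :=
  continuous_iff_continuousAt.2 fun x => (h.deriv_snd x).continuousAt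

lemma integrable_srcA (hp : Decaying p) (h : IsJostLeft p lam u w) :
    Integrable (srcA p lam u w) :=
  CLL.integrable_srcA hp h.cont_fst h.cont_snd h.bdd.choose_spec

lemma integrable_srcB (hp : Decaying p) (h : IsJostLeft p lam u w) :
    Integrable (srcB p lam u w) :=
  CLL.integrable_srcB hp h.cont_fst h.cont_snd h.bdd.choose_spec

lemma fst_eq (hp : Decaying p) (h : IsJostLeft p lam u w) (x : ℝ) :
    u x = 1 + duhamel 0 (srcA p lam u w) x := by
  have := congrFun (eq_duhamel (κ := 0) (z := fun x => u x - 1) (by simp) (h.integrable_srcA hp)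
    (fun x => by simpa using (h.deriv_fst x).sub_const 1)
    (by simpa using h.tendsto_fst.sub_const 1)) x
  rw [← this]; ring

lemma snd_eq (hp : Decaying p) (hlam : 0 ≤ (lam ^ 2).im) (h : IsJostLeft p lam u w) :
    w = duhamel (2 * Complex.I * lam ^ 2) (srcB p lam u w) :=
  eq_duhamel (re_two_I_mul_sq_nonpos hlam) (h.integrable_srcB hp) h.deriv_snd h.tendsto_snd

end IsJostLeft

lemma isJostLeft_of_integral (hp : Decaying p) (hlam : 0 ≤ (lam ^ 2).im) {u w : ℝ → ℂ}
    (hu : Continuous u) (hw : Continuous w) {M : ℝ} (hM : ∀ x, ‖u x‖ ≤ M ∧ ‖w x‖ ≤ M)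
    (hu' : ∀ x, u x = 1 + duhamel 0 (srcA p lam u w) x)
    (hw' : ∀ x, w x = duhamel (2 * Complex.I * lam ^ 2) (srcB p lam u w) x) :
    IsJostLeft p lam u w := by
  have ia := integrable_srcA (lam := lam) hp hu hw hM
  have ib := integrable_srcB (lam := lam) hp hu hw hM
  have hκ := re_two_I_mul_sq_nonpos hlam
  refine ⟨⟨M, hM⟩, fun x => ?_, fun x => ?_, ?_, ?_⟩
  · have := (hasDerivAt_duhamel (κ := 0) (by simp) (continuous_srcA hp hu hw) ia x).const_add 1
    rw [← funext hu'] at this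
    simpa using this
  · have := hasDerivAt_duhamel hκ (continuous_srcB hp hu hw) ib x
    rwa [← funext hw'] at this
  · rw [funext hu']
    simpa using (tendsto_duhamel (κ := 0) (by simp) ia).const_add 1
  · rw [funext hw']
    exact tendsto_duhamel hκ ib

/-- Stability of Jost functions under changes of the spectral parameter. -/
lemma IsJostLeft.stability (hp : Decaying p) {lam' : ℂ} {u w u' w' : ℝ → ℂ}
    (h : IsJostLeft p lam u w) (h' : IsJostLeft p lam' u' w')
    (hlam : 0 ≤ (lam ^ 2).im) (hlam' : 0 ≤ (lam' ^ 2).im) (hΛ : ‖lam‖ ≤ Λ) {M η : ℝ}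
    (hM : ∀ x, ‖u' x‖ ≤ M ∧ ‖w' x‖ ≤ M)
    (hη : ∀ x, ‖duhamel (2 * Complex.I * lam ^ 2) (srcB p lam' u' w') x
      - duhamel (2 * Complex.I * lam' ^ 2) (srcB p lam' u' w') x‖ ≤ η) (x : ℝ) :
    max ‖u x - u' x‖ ‖w x - w' x‖ ≤
      2 * (‖lam - lam'‖ * M * (∫ y, ‖p y‖) + η) * Real.exp (2 * ∫ y, weight p Λ y) := by
  have hΛ0 : 0 ≤ Λ := (norm_nonneg _).trans hΛ
  have hM0 : 0 ≤ M := (norm_nonneg _).trans (hM 0).1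
  have hη0 : 0 ≤ η := (norm_nonneg _).trans (hη 0)
  have hκ := re_two_I_mul_sq_nonpos hlam
  set φ := fun x => max ‖u x - u' x‖ ‖w x - w' x‖ with hφ
  obtain ⟨B, hB⟩ := h.bdd
  have cu := h.cont_fst
  have cw := h.cont_snd
  have cu' := h'.cont_fst
  have cw' := h'.cont_snd
  have cφ : Continuous φ := by fun_prop
  have hφB : ∀ x, φ x ≤ B + M := fun x => max_le
    ((norm_sub_le _ _).trans (add_le_add (hB x).1 (hM x).1))
    ((norm_sub_le _ _).trans (add_le_add (hB x).2 (hM x).2))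
  have hφ0 : ∀ x, 0 ≤ φ x := fun x => (norm_nonneg _).trans (le_max_left _ _)
  have ikφ : Integrable (fun y => weight p Λ y * φ y) :=
    (integrable_weight hp).mul_bdd (c := B + M) cφ.aestronglyMeasurable
      (ae_of_all _ fun y => by rw [Real.norm_of_nonneg (hφ0 y)]; exact hφB y)
  have ip : Integrable fun y => ‖lam - lam'‖ * M * ‖p y‖ := hp.norm_integrable.const_mul _
  -- The spectral parameter enters twice: through the coefficients, giving the terms with `lam -
  -- lam'` here, and through the exponential kernel, whose variation is bounded by `η`.
  have eA : ∀ y, srcA p lam u w y - srcA p lam' u' w' y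
      = srcA p lam (fun x => u x - u' x) (fun x => w x - w' x) y + (lam - lam') * p y * w' y :=
    fun y => by unfold srcA; ring
  have eB : ∀ y, srcB p lam u w y - srcB p lam' u' w' y
      = srcB p lam (fun x => u x - u' x) (fun x => w x - w' x) y
        - (lam - lam') * conj (p y) * u' y :=
    fun y => by unfold srcB; ring
  have bA : ∀ y, ‖srcA p lam u w y - srcA p lam' u' w' y‖
      ≤ weight p Λ y * φ y + ‖lam - lam'‖ * M * ‖p y‖ := fun y => by
    rw [eA]
    refine (norm_add_le _ _).trans (add_le_add
      (norm_srcA_le hΛ (le_max_left _ _) (le_max_right _ _)) ?_)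
    rw [norm_mul, norm_mul, mul_right_comm]
    gcongr
    exact (hM y).2
  have bB : ∀ y, ‖srcB p lam u w y - srcB p lam' u' w' y‖
      ≤ weight p Λ y * φ y + ‖lam - lam'‖ * M * ‖p y‖ := fun y => by
    rw [eB]
    refine (norm_sub_le _ _).trans (add_le_add
      (norm_srcB_le hΛ (le_max_left _ _) (le_max_right _ _)) ?_)
    rw [norm_mul, norm_mul, mul_right_comm, RCLike.norm_conj]
    gcongr
    exact (hM y).1
  have bint : ∀ (g : ℝ → ℂ), Integrable g →
      (∀ y, ‖g y‖ ≤ weight p Λ y * φ y + ‖lam - lam'‖ * M * ‖p y‖) → ∀ x,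
      ∫ y in Set.Iic x, ‖g y‖ ≤
        ‖lam - lam'‖ * M * (∫ y, ‖p y‖) + ∫ y in Set.Iic x, weight p Λ y * φ y := by
    intro g hg hb x
    refine (integral_mono hg.norm.integrableOn (ikφ.add ip).integrableOn hb).trans ?_
    simp only [Pi.add_apply]
    rw [integral_add ikφ.integrableOn ip.integrableOn, add_comm, ← integral_const_mul]
    exact add_le_add_left (setIntegral_le_integral ip
      (ae_of_all _ fun y => by simp only [Pi.zero_apply]; positivity)) _
  have iA := h.integrable_srcA hp
  have iA' := h'.integrable_srcA hp
  have iB := h.integrable_srcB hp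
  have iB' := h'.integrable_srcB hp
  have key : ∀ x, φ x ≤ (‖lam - lam'‖ * M * (∫ y, ‖p y‖) + η)
      + ∫ y in Set.Iic x, weight p Λ y * φ y := by
    intro x
    refine max_le ?_ ?_
    · rw [h.fst_eq hp, h'.fst_eq hp, add_sub_add_left_eq_sub, duhamel_sub (by simp) iA iA']
      have := (norm_duhamel_le (κ := 0) (by simp) (iA.sub iA') x).trans (bint _ (iA.sub iA') bA x)
      exact this.trans (by linarith)
    · have e : w x - w' x = duhamel (2 * Complex.I * lam ^ 2)
          (fun y => srcB p lam u w y - srcB p lam' u' w' y) x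
          + (duhamel (2 * Complex.I * lam ^ 2) (srcB p lam' u' w') x
            - duhamel (2 * Complex.I * lam' ^ 2) (srcB p lam' u' w') x) := by
        rw [← duhamel_sub hκ iB iB', ← h.snd_eq hp hlam, ← h'.snd_eq hp hlam']
        ring
      rw [e]
      refine (norm_add_le _ _).trans ?_
      have := (norm_duhamel_le hκ (iB.sub iB') x).trans (bint _ (iB.sub iB') bB x)
      have h3 := hη x
      have e2 : (srcB p lam u w - srcB p lam' u' w')
        = fun y => srcB p lam u w y - srcB p lam' u' w' y := rfl
      rw [e2] at this
      linarith
  refine (volterra_gronwall (continuous_weight hp) (integrable_weight hp) (weight_nonneg hΛ0)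
    cφ hφ0 hφB key x).trans ?_
  have := tailInt_le (integrable_weight (Λ := Λ) hp) (weight_nonneg hΛ0) x
  have : 0 ≤ ∫ y, ‖p y‖ := integral_nonneg fun y => norm_nonneg _
  gcongr

lemma IsJostLeft.unique (hp : Decaying p) {u w u' w' : ℝ → ℂ} (h : IsJostLeft p lam u w)
    (h' : IsJostLeft p lam u' w') (hlam : 0 ≤ (lam ^ 2).im) : u = u' ∧ w = w' := by
  obtain ⟨M, hM⟩ := h'.bdd
  have key := h.stability hp h' hlam hlam (Λ := ‖lam‖) (η := 0) le_rfl hM (fun x => by simp)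
  simp only [sub_self, norm_zero, zero_mul, add_zero, mul_zero, max_le_iff,
    norm_le_zero_iff, sub_eq_zero] at key
  exact ⟨funext fun x => (key x).1, funext fun x => (key x).2⟩

/-- The stability estimate, with kernel variation bounded by `norm_duhamel_sub_le`, has a right-hand
side that tends to zero as λ → λ₀. -/
lemma IsJostLeft.tendsto_param (hp : Decaying p) {lam₀ : ℂ} (hlam₀ : 0 < (lam₀ ^ 2).im)
    {U W : ℂ → ℝ → ℂ} (h : ∀ lam : ℂ, 0 ≤ (lam ^ 2).im → IsJostLeft p lam (U lam) (W lam))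
    (x : ℝ) :
    ContinuousAt (fun lam => U lam x) lam₀ ∧ ContinuousAt (fun lam => W lam x) lam₀ := by
  have h₀ := h lam₀ hlam₀.le
  obtain ⟨M, hM⟩ := h₀.bdd
  set c := (lam₀ ^ 2).im with hc
  set J := ∫ y, ‖srcB p lam₀ (U lam₀) (W lam₀) y‖
  set bound : ℂ → ℝ := fun lam => 2 * (‖lam - lam₀‖ * M * (∫ y, ‖p y‖)
    + ‖2 * Complex.I * lam ^ 2 - 2 * Complex.I * lam₀ ^ 2‖ / c * J)
    * Real.exp (2 * ∫ y, weight p (‖lam₀‖ + 1) y) with hbound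
  have hb0 : Tendsto bound (𝓝 lam₀) (𝓝 0) := by
    have : Continuous bound := by fun_prop
    have := this.tendsto lam₀
    simpa [hbound] using this
  -- The real part of the exponent is -2 Im λ², so Im λ² > c/2 keeps a common damping rate c near
  -- λ₀.
  have e1 : ∀ᶠ lam : ℂ in 𝓝 lam₀, c / 2 < (lam ^ 2).im :=
    ((Complex.continuous_im.comp (continuous_pow 2)).tendsto lam₀).eventually_const_lt
      (by simp only [Function.comp_apply]; linarith)
  have e2 : ∀ᶠ lam : ℂ in 𝓝 lam₀, ‖lam‖ < ‖lam₀‖ + 1 :=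
    (continuous_norm.tendsto lam₀).eventually_lt_const (by linarith)
  have hev : ∀ᶠ lam in 𝓝 lam₀, max ‖U lam x - U lam₀ x‖ ‖W lam x - W lam₀ x‖ ≤ bound lam := by
    filter_upwards [e1, e2] with lam h1 h2
    have hl : 0 ≤ (lam ^ 2).im := by linarith
    refine (h lam hl).stability hp h₀ hl hlam₀.le h2.le hM (fun x => ?_) x
    refine norm_duhamel_sub_le hlam₀ ?_ ?_ (h₀.integrable_srcB hp) x
    · rw [re_two_I_mul_sq]; linarith
    · rw [re_two_I_mul_sq]; linarith
  constructor
  · rw [ContinuousAt, tendsto_iff_norm_sub_tendsto_zero]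
    exact squeeze_zero' (Eventually.of_forall fun _ => norm_nonneg _)
      (hev.mono fun _ h => (le_max_left _ _).trans h) hb0
  · rw [ContinuousAt, tendsto_iff_norm_sub_tendsto_zero]
    exact squeeze_zero' (Eventually.of_forall fun _ => norm_nonneg _)
      (hev.mono fun _ h => (le_max_right _ _).trans h) hb0

-- Fixed point of the Volterra system. The unknown is the pair of components divided by W = exp(2K),
-- with K the tail integral of the weight; in the supremum norm the operator then contracts by 1/2,
-- without smallness of the potential.
open BoundedContinuousFunction in
lemma exists_isJostLeft (hp : Decaying p) (hlam : 0 ≤ (lam ^ 2).im) :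
    ∃ u w, IsJostLeft p lam u w := by
  set k := weight p ‖lam‖ with hk
  have kc : Continuous k := continuous_weight hp
  have ki : Integrable k := integrable_weight hp
  have k0 : ∀ x, 0 ≤ k x := weight_nonneg (norm_nonneg _)
  set W : ℝ → ℝ := fun x => Real.exp (2 * tailInt k x) with hW
  have Wc : Continuous W := continuous_exp_tailInt kc ki
  have W0 : ∀ x, 0 < W x := fun x => Real.exp_pos _
  have W1 : ∀ x, 1 ≤ W x := fun x => Real.one_le_exp (by have := tailInt_nonneg k0 x; linarith)
  set W' := Real.exp (2 * ∫ y, k y) with hW'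
  have hWW' : ∀ x, W x ≤ W' := fun x => Real.exp_le_exp.2 (by
    have := tailInt_le ki k0 x; linarith)
  have ikW : Integrable fun y => k y * W y := integrable_mul_exp_tailInt kc ki k0
  have hκ := re_two_I_mul_sq_nonpos hlam
  set κ := 2 * Complex.I * lam ^ 2
  let fst : (ℝ →ᵇ ℂ × ℂ) → ℝ → ℂ := fun F x => W x * (F x).1
  let snd : (ℝ →ᵇ ℂ × ℂ) → ℝ → ℂ := fun F x => W x * (F x).2
  have cf : ∀ F, Continuous (fst F) := fun F =>
    (Complex.continuous_ofReal.comp Wc).mul (continuous_fst.comp F.continuous)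
  have cs : ∀ F, Continuous (snd F) := fun F =>
    (Complex.continuous_ofReal.comp Wc).mul (continuous_snd.comp F.continuous)
  have bfs : ∀ F x, ‖fst F x‖ ≤ W' * ‖F‖ ∧ ‖snd F x‖ ≤ W' * ‖F‖ := fun F x => by
    have h1 : ‖(W x : ℂ)‖ = W x := by rw [Complex.norm_real, Real.norm_of_nonneg (W0 x).le]
    have h2 := F.norm_coe_le_norm x
    refine ⟨?_, ?_⟩
    · simp only [fst, norm_mul, h1]
      exact mul_le_mul (hWW' x) ((norm_fst_le _).trans h2) (norm_nonneg _) (by positivity)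
    · simp only [snd, norm_mul, h1]
      exact mul_le_mul (hWW' x) ((norm_snd_le _).trans h2) (norm_nonneg _) (by positivity)
  have iA : ∀ F, Integrable (srcA p lam (fst F) (snd F)) := fun F =>
    integrable_srcA hp (cf F) (cs F) (bfs F)
  have iB : ∀ F, Integrable (srcB p lam (fst F) (snd F)) := fun F =>
    integrable_srcB hp (cf F) (cs F) (bfs F)
  let N : (ℝ →ᵇ ℂ × ℂ) → ℝ → ℂ × ℂ := fun F x =>
    ((W x : ℂ)⁻¹ * (1 + duhamel 0 (srcA p lam (fst F) (snd F)) x),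
      (W x : ℂ)⁻¹ * duhamel κ (srcB p lam (fst F) (snd F)) x)
  have hWinv : ∀ x, ‖(W x : ℂ)⁻¹‖ = (W x)⁻¹ := fun x => by
    rw [norm_inv, Complex.norm_real, Real.norm_of_nonneg (W0 x).le]
  have cN : ∀ F, Continuous (N F) := fun F => by
    have cW : Continuous fun x => (W x : ℂ)⁻¹ :=
      (Complex.continuous_ofReal.comp Wc).inv₀ fun x => by
        simpa using (W0 x).ne'
    exact (cW.mul (continuous_const.add (continuous_duhamel (by simp)
      (continuous_srcA hp (cf F) (cs F)) (iA F)))).prodMk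
      (cW.mul (continuous_duhamel hκ (continuous_srcB hp (cf F) (cs F)) (iB F)))
  have bN : ∀ F, ∃ C : ℝ, ∀ x, ‖N F x‖ ≤ C := fun F => by
    refine ⟨1 + ((∫ y, ‖srcA p lam (fst F) (snd F) y‖) + ∫ y, ‖srcB p lam (fst F) (snd F) y‖),
      fun x => ?_⟩
    have a1 := (norm_duhamel_le (κ := 0) (by simp) (iA F) x).trans
      (setIntegral_le_integral (iA F).norm (ae_of_all _ fun _ => norm_nonneg _))
    have a2 := (norm_duhamel_le hκ (iB F) x).trans
      (setIntegral_le_integral (iB F).norm (ae_of_all _ fun _ => norm_nonneg _))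
    have a3 : (W x)⁻¹ ≤ 1 := inv_le_one_of_one_le₀ (W1 x)
    have a4 : 0 ≤ ∫ y, ‖srcA p lam (fst F) (snd F) y‖ := integral_nonneg fun _ => norm_nonneg _
    have a5 : 0 ≤ ∫ y, ‖srcB p lam (fst F) (snd F) y‖ := integral_nonneg fun _ => norm_nonneg _
    refine norm_prod_le_iff.2 ⟨?_, ?_⟩
    · simp only [N, norm_mul, hWinv]
      have : ‖1 + duhamel 0 (srcA p lam (fst F) (snd F)) x‖ ≤
          1 + ∫ y, ‖srcA p lam (fst F) (snd F) y‖ :=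
        (norm_add_le _ _).trans (by rw [norm_one]; linarith)
      exact (mul_le_of_le_one_left (norm_nonneg _) a3).trans (by linarith)
    · simp only [N, norm_mul, hWinv]
      exact (mul_le_of_le_one_left (norm_nonneg _) a3).trans (by linarith)
  let T : (ℝ →ᵇ ℂ × ℂ) → (ℝ →ᵇ ℂ × ℂ) := fun F =>
    BoundedContinuousFunction.ofNormedAddCommGroup (N F) (cN F) (bN F).choose (bN F).choose_spec
  have hT : ContractingWith (1 / 2) T := by
    refine ⟨by rw [← NNReal.coe_lt_coe]; norm_num, LipschitzWith.of_dist_le_mul fun F G => ?_⟩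
    rw [BoundedContinuousFunction.dist_le (by positivity)]
    intro x
    set d := dist F G
    have bd : ∀ y, ‖fst F y - fst G y‖ ≤ W y * d ∧ ‖snd F y - snd G y‖ ≤ W y * d := fun y => by
      have h1 : ‖(W y : ℂ)‖ = W y := by rw [Complex.norm_real, Real.norm_of_nonneg (W0 y).le]
      have h2 : ‖F y - G y‖ ≤ d := by
        rw [← dist_eq_norm]; exact BoundedContinuousFunction.dist_coe_le_dist y
      constructor
      · simp only [fst, ← mul_sub, norm_mul, h1]
        exact mul_le_mul_of_nonneg_left ((norm_fst_le (F y - G y)).trans h2) (W0 y).le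
      · simp only [snd, ← mul_sub, norm_mul, h1]
        exact mul_le_mul_of_nonneg_left ((norm_snd_le (F y - G y)).trans h2) (W0 y).le
    have half : ∀ g : ℝ → ℂ, Integrable g → (∀ y, ‖g y‖ ≤ k y * (W y * d)) →
        (W x)⁻¹ * ∫ y in Set.Iic x, ‖g y‖ ≤ 1 / 2 * d := fun g hg hb => by
      have : ∫ y in Set.Iic x, ‖g y‖ ≤ (W x - 1) / 2 * d := by
        rw [hW, ← integral_mul_exp_tailInt kc ki k0 x, ← integral_mul_const]
        refine integral_mono hg.norm.integrableOn (ikW.mul_const d).integrableOn fun y => ?_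
        simpa only [mul_assoc] using hb y
      rw [inv_mul_le_iff₀ (W0 x)]
      have := W1 x
      have : 0 ≤ d := dist_nonneg
      nlinarith
    have sA : ∀ y, srcA p lam (fst F) (snd F) y - srcA p lam (fst G) (snd G) y
        = srcA p lam (fun y => fst F y - fst G y) (fun y => snd F y - snd G y) y := fun y => by
      unfold srcA; ring
    have sB : ∀ y, srcB p lam (fst F) (snd F) y - srcB p lam (fst G) (snd G) y
        = srcB p lam (fun y => fst F y - fst G y) (fun y => snd F y - snd G y) y := fun y => by
      unfold srcB; ring
    have hd : dist (T F x) (T G x) ≤ 1 / 2 * d := by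
      rw [dist_eq_norm]
      refine norm_prod_le_iff.2 ⟨?_, ?_⟩
      · change ‖(W x : ℂ)⁻¹ * (1 + duhamel 0 (srcA p lam (fst F) (snd F)) x)
          - (W x : ℂ)⁻¹ * (1 + duhamel 0 (srcA p lam (fst G) (snd G)) x)‖ ≤ _
        rw [← mul_sub, add_sub_add_left_eq_sub, duhamel_sub (by simp) (iA F) (iA G), norm_mul,
          hWinv]
        refine (mul_le_mul_of_nonneg_left (norm_duhamel_le (by simp) ((iA F).sub (iA G)) x)
          (inv_nonneg.2 (W0 x).le)).trans (half _ ((iA F).sub (iA G)) fun y => ?_)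
        rw [Pi.sub_apply, sA]
        exact norm_srcA_le le_rfl (bd y).1 (bd y).2
      · change ‖(W x : ℂ)⁻¹ * duhamel κ (srcB p lam (fst F) (snd F)) x
          - (W x : ℂ)⁻¹ * duhamel κ (srcB p lam (fst G) (snd G)) x‖ ≤ _
        rw [← mul_sub, duhamel_sub hκ (iB F) (iB G), norm_mul, hWinv]
        refine (mul_le_mul_of_nonneg_left (norm_duhamel_le hκ ((iB F).sub (iB G)) x)
          (inv_nonneg.2 (W0 x).le)).trans (half _ ((iB F).sub (iB G)) fun y => ?_)
        rw [Pi.sub_apply, sB]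
        exact norm_srcB_le le_rfl (bd y).1 (bd y).2
    simpa using hd
  obtain ⟨F, hF⟩ : ∃ F, T F = F := ⟨_, hT.fixedPoint_isFixedPt⟩
  have hWne : ∀ x, (W x : ℂ) ≠ 0 := fun x => by simpa using (W0 x).ne'
  have hFx : ∀ x, F x = N F x := fun x => (congrArg (fun G => G x) hF).symm
  refine ⟨fst F, snd F, isJostLeft_of_integral hp hlam (cf F) (cs F) (bfs F) (fun x => ?_)
    fun x => ?_⟩
  · have h1 : (F x).1 = (W x : ℂ)⁻¹ * (1 + duhamel 0 (srcA p lam (fst F) (snd F)) x) :=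
      congrArg Prod.fst (hFx x)
    change (W x : ℂ) * (F x).1 = _
    rw [h1, mul_inv_cancel_left₀ (hWne x)]
  · have h1 : (F x).2 = (W x : ℂ)⁻¹ * duhamel κ (srcB p lam (fst F) (snd F)) x :=
      congrArg Prod.snd (hFx x)
    change (W x : ℂ) * (F x).2 = _
    rw [h1, mul_inv_cancel_left₀ (hWne x)]

end

/-! ### The spectral problem for continuous potentials -/

lemma laxU_mulVec (p : ℝ → ℂ) (lam : ℂ) (x : ℝ) (v : Fin 2 → ℂ) :
    (laxU p lam x).mulVec v =
      ![(-Complex.I * lam ^ 2) * v 0 + (Complex.I / 4 * (p x * conj (p x)) * v 0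
          + lam * p x * v 1),
        (Complex.I * lam ^ 2) * v 1 + (-(lam * conj (p x)) * v 0
          - Complex.I / 4 * (p x * conj (p x)) * v 1)] := by
  funext i
  fin_cases i <;> simp [laxU, Matrix.mulVec, dotProduct, Fin.sum_univ_two] <;> ring

/-- The integrated equation sees the potential only up to null sets, so Jost functions and
scattering coefficients are invariants of the almost everywhere class. -/
lemma IsSpectralSolution.congr_ae {q Q : ℝ → ℂ} (h : q =ᵐ[volume] Q) {lam : ℂ}
    {Φ : ℝ → Fin 2 → ℂ} (hΦ : IsSpectralSolution q lam Φ) : IsSpectralSolution Q lam Φ := by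
  have e : (fun s => (laxU q lam s).mulVec (Φ s)) =ᵐ[volume]
      fun s => (laxU Q lam s).mulVec (Φ s) := by
    filter_upwards [h] with s hs
    simp only [laxU, hs]
  refine ⟨hΦ.1, fun x y => ⟨(hΦ.2 x y).1.congr_ae (ae_restrict_of_ae e), ?_⟩⟩
  rw [(hΦ.2 x y).2]
  exact intervalIntegral.integral_congr_ae (by filter_upwards [e] with s hs _ using hs)

lemma isSpectralSolution_congr_ae {q Q : ℝ → ℂ} (h : q =ᵐ[volume] Q) (lam : ℂ) :
    IsSpectralSolution q lam = IsSpectralSolution Q lam :=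
  funext fun _ => propext ⟨fun hΦ => hΦ.congr_ae h, fun hΦ => hΦ.congr_ae h.symm⟩

lemma varphiMinus_congr_ae {q Q : ℝ → ℂ} (h : q =ᵐ[volume] Q) : varphiMinus q = varphiMinus Q := by
  funext lam
  unfold varphiMinus IsJostFirst
  rw [isSpectralSolution_congr_ae h]

lemma varphiPlus_congr_ae {q Q : ℝ → ℂ} (h : q =ᵐ[volume] Q) : varphiPlus q = varphiPlus Q := by
  funext lam
  unfold varphiPlus IsJostFirst
  rw [isSpectralSolution_congr_ae h]

lemma phiPlus_congr_ae {q Q : ℝ → ℂ} (h : q =ᵐ[volume] Q) : phiPlus q = phiPlus Q := by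
  funext lam
  unfold phiPlus IsJostSecond
  rw [isSpectralSolution_congr_ae h]

lemma scatA_congr_ae {q Q : ℝ → ℂ} (h : q =ᵐ[volume] Q) : scatA q = scatA Q := by
  funext lam
  rw [scatA, scatA, varphiMinus_congr_ae h, phiPlus_congr_ae h]

lemma scatB_congr_ae {q Q : ℝ → ℂ} (h : q =ᵐ[volume] Q) : scatB q = scatB Q := by
  funext lam
  rw [scatB, scatB, varphiMinus_congr_ae h, varphiPlus_congr_ae h]

/-- Classical solutions of the spectral problem, in components. -/
structure IsClassicalSolution (p : ℝ → ℂ) (lam : ℂ) (f g : ℝ → ℂ) : Prop where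
  deriv_fst : ∀ x, HasDerivAt f (-Complex.I * lam ^ 2 * f x + srcA p lam f g x) x
  deriv_snd : ∀ x, HasDerivAt g (Complex.I * lam ^ 2 * g x + srcB p lam f g x) x

lemma isSpectralSolution_iff {p : ℝ → ℂ} (hp : Continuous p) {lam : ℂ} {Φ : ℝ → Fin 2 → ℂ} :
    IsSpectralSolution p lam Φ ↔
      IsClassicalSolution p lam (fun x => Φ x 0) (fun x => Φ x 1) := by
  have hcF : Continuous Φ → Continuous fun s => (laxU p lam s).mulVec (Φ s) := fun hc => by
    have h0 : Continuous fun s => Φ s 0 := (continuous_apply 0).comp hc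
    have h1 : Continuous fun s => Φ s 1 := (continuous_apply 1).comp hc
    have hcp : Continuous fun s => conj (p s) := Complex.continuous_conj.comp hp
    simp only [laxU_mulVec]
    refine continuous_pi fun i => ?_
    fin_cases i
    · simp; fun_prop
    · simp; fun_prop
  have hder : (∀ x, HasDerivAt Φ ((laxU p lam x).mulVec (Φ x)) x) ↔
      IsClassicalSolution p lam (fun x => Φ x 0) (fun x => Φ x 1) := by
    constructor
    · intro h
      refine ⟨fun x => ?_, fun x => ?_⟩
      · have := hasDerivAt_pi.1 (h x) 0
        rw [laxU_mulVec] at this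
        exact this
      · have := hasDerivAt_pi.1 (h x) 1
        rw [laxU_mulVec] at this
        exact this
    · intro h x
      rw [laxU_mulVec]
      refine hasDerivAt_pi.2 fun i => ?_
      fin_cases i
      · exact h.deriv_fst x
      · exact h.deriv_snd x
  rw [← hder]
  constructor
  · intro h x
    have e : Φ = fun y => Φ 0 + ∫ s in (0 : ℝ)..y, (laxU p lam s).mulVec (Φ s) := by
      funext y; rw [← (h.2 0 y).2]; abel
    have := (((hcF h.1).integral_hasStrictDerivAt 0 x).hasDerivAt).const_add (Φ 0)
    rwa [← e] at this
  · intro h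
    have hc : Continuous Φ := continuous_iff_continuousAt.2 fun x => (h x).continuousAt
    exact ⟨hc, fun x y => ⟨(hcF hc).intervalIntegrable _ _,
      (intervalIntegral.integral_eq_sub_of_hasDerivAt (fun t _ => h t)
        ((hcF hc).intervalIntegrable _ _)).symm⟩⟩

lemma hasDerivAt_exp_mul_iff {c : ℂ} {v : ℝ → ℂ} {D : ℂ} {x : ℝ} :
    HasDerivAt (fun x : ℝ => Complex.exp (c * x) * v x) (Complex.exp (c * x) * D) x ↔
      HasDerivAt v (D - c * v x) x := by
  have hm : ∀ y : ℝ, Complex.exp (-c * y) * Complex.exp (c * y) = 1 := fun y => by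
    rw [← Complex.exp_add]; simp
  constructor
  · intro h
    have := (hasDerivAt_exp_mul (-c) x).mul h
    have e : (fun y : ℝ => Complex.exp (-c * y)) * (fun y : ℝ => Complex.exp (c * y) * v y) = v := by
      funext y
      simp only [Pi.mul_apply]
      rw [← mul_assoc, hm, one_mul]
    rw [e] at this
    refine this.congr_deriv ?_
    linear_combination (D - c * v x) * hm x
  · intro h
    exact ((hasDerivAt_exp_mul c x).mul h).congr_deriv (by ring)

lemma srcA_mul_left (p : ℝ → ℂ) (lam : ℂ) (e u w : ℝ → ℂ) (x : ℝ) :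
    srcA p lam (fun x => e x * u x) (fun x => e x * w x) x = e x * srcA p lam u w x := by
  unfold srcA; ring

lemma srcB_mul_left (p : ℝ → ℂ) (lam : ℂ) (e u w : ℝ → ℂ) (x : ℝ) :
    srcB p lam (fun x => e x * u x) (fun x => e x * w x) x = e x * srcB p lam u w x := by
  unfold srcB; ring

lemma isClassicalSolution_exp_iff {p : ℝ → ℂ} {lam c : ℂ} {u w : ℝ → ℂ} :
    IsClassicalSolution p lam (fun x : ℝ => Complex.exp (c * x) * u x)
      (fun x : ℝ => Complex.exp (c * x) * w x) ↔
    (∀ x, HasDerivAt u ((-Complex.I * lam ^ 2 - c) * u x + srcA p lam u w x) x) ∧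
      ∀ x, HasDerivAt w ((Complex.I * lam ^ 2 - c) * w x + srcB p lam u w x) x := by
  have h1 : ∀ x : ℝ, -Complex.I * lam ^ 2 * (Complex.exp (c * x) * u x)
      + srcA p lam (fun x : ℝ => Complex.exp (c * x) * u x)
        (fun x : ℝ => Complex.exp (c * x) * w x) x
      = Complex.exp (c * x) * (-Complex.I * lam ^ 2 * u x + srcA p lam u w x) := fun x => by
    rw [srcA_mul_left p lam (fun x : ℝ => Complex.exp (c * x))]; ring
  have h2 : ∀ x : ℝ, Complex.I * lam ^ 2 * (Complex.exp (c * x) * w x)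
      + srcB p lam (fun x : ℝ => Complex.exp (c * x) * u x)
        (fun x : ℝ => Complex.exp (c * x) * w x) x
      = Complex.exp (c * x) * (Complex.I * lam ^ 2 * w x + srcB p lam u w x) := fun x => by
    rw [srcB_mul_left p lam (fun x : ℝ => Complex.exp (c * x))]; ring
  constructor
  · rintro ⟨a, b⟩
    refine ⟨fun x => ?_, fun x => ?_⟩
    · have := a x
      rw [h1, hasDerivAt_exp_mul_iff] at this
      exact this.congr_deriv (by ring)
    · have := b x
      rw [h2, hasDerivAt_exp_mul_iff] at this
      exact this.congr_deriv (by ring)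
  · rintro ⟨a, b⟩
    refine ⟨fun x => ?_, fun x => ?_⟩
    · rw [h1, hasDerivAt_exp_mul_iff]
      exact (a x).congr_deriv (by ring)
    · rw [h2, hasDerivAt_exp_mul_iff]
      exact (b x).congr_deriv (by ring)

lemma exists_norm_le_iff {v : ℝ → Fin 2 → ℂ} :
    (∃ M : ℝ, ∀ x, ‖v x‖ ≤ M) ↔ ∃ M : ℝ, ∀ x, ‖v x 0‖ ≤ M ∧ ‖v x 1‖ ≤ M := by
  refine exists_congr fun M => forall_congr' fun x => ?_
  constructor
  · exact fun h => ⟨(norm_le_pi_norm _ 0).trans h, (norm_le_pi_norm _ 1).trans h⟩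
  · intro h
    refine (pi_norm_le_iff_of_nonneg ((norm_nonneg _).trans h.1)).2 ?_
    rw [Fin.forall_fin_two]
    exact h

lemma tendsto_fin_two_iff {l : Filter ℝ} {v : ℝ → Fin 2 → ℂ} {a b : ℂ} :
    Tendsto v l (𝓝 ![a, b]) ↔
      Tendsto (fun x => v x 0) l (𝓝 a) ∧ Tendsto (fun x => v x 1) l (𝓝 b) := by
  rw [tendsto_pi_nhds, Fin.forall_fin_two]
  rfl

lemma isJostFirst_iff {l : Filter ℝ} {p : ℝ → ℂ} (hp : Continuous p) {lam : ℂ}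
    {v : ℝ → Fin 2 → ℂ} : IsJostFirst l p lam v ↔
      (∃ M : ℝ, ∀ x, ‖v x 0‖ ≤ M ∧ ‖v x 1‖ ≤ M) ∧
      (∀ x, HasDerivAt (fun x => v x 0) (srcA p lam (fun x => v x 0) (fun x => v x 1) x) x) ∧
      (∀ x, HasDerivAt (fun x => v x 1) (2 * Complex.I * lam ^ 2 * v x 1
        + srcB p lam (fun x => v x 0) (fun x => v x 1) x) x) ∧
      Tendsto (fun x => v x 0) l (𝓝 1) ∧ Tendsto (fun x => v x 1) l (𝓝 0) := by
  rw [IsJostFirst, exists_norm_le_iff, isSpectralSolution_iff hp, tendsto_fin_two_iff]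
  simp only [Pi.smul_apply, smul_eq_mul]
  rw [isClassicalSolution_exp_iff, and_assoc]
  have e1 : -Complex.I * lam ^ 2 - -Complex.I * lam ^ 2 = 0 := by ring
  have e2 : Complex.I * lam ^ 2 - -Complex.I * lam ^ 2 = 2 * Complex.I * lam ^ 2 := by ring
  simp only [e1, e2, zero_mul, zero_add]

lemma isJostSecond_iff {l : Filter ℝ} {p : ℝ → ℂ} (hp : Continuous p) {lam : ℂ}
    {v : ℝ → Fin 2 → ℂ} : IsJostSecond l p lam v ↔
      (∃ M : ℝ, ∀ x, ‖v x 0‖ ≤ M ∧ ‖v x 1‖ ≤ M) ∧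
      (∀ x, HasDerivAt (fun x => v x 0) (-(2 * Complex.I * lam ^ 2) * v x 0
        + srcA p lam (fun x => v x 0) (fun x => v x 1) x) x) ∧
      (∀ x, HasDerivAt (fun x => v x 1) (srcB p lam (fun x => v x 0) (fun x => v x 1) x) x) ∧
      Tendsto (fun x => v x 0) l (𝓝 0) ∧ Tendsto (fun x => v x 1) l (𝓝 1) := by
  rw [IsJostSecond, exists_norm_le_iff, isSpectralSolution_iff hp, tendsto_fin_two_iff]
  simp only [Pi.smul_apply, smul_eq_mul]
  rw [isClassicalSolution_exp_iff, and_assoc]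
  have e1 : -Complex.I * lam ^ 2 - Complex.I * lam ^ 2 = -(2 * Complex.I * lam ^ 2) := by ring
  have e2 : Complex.I * lam ^ 2 - Complex.I * lam ^ 2 = 0 := by ring
  simp only [e1, e2, zero_mul, zero_add]

lemma isJostFirst_atBot_iff {p : ℝ → ℂ} (hp : Continuous p) {lam : ℂ} {v : ℝ → Fin 2 → ℂ} :
    IsJostFirst atBot p lam v ↔ IsJostLeft p lam (fun x => v x 0) (fun x => v x 1) := by
  rw [isJostFirst_iff hp]
  exact ⟨fun ⟨a, b, c, d, e⟩ => ⟨a, b, c, d, e⟩, fun ⟨a, b, c, d, e⟩ => ⟨a, b, c, d, e⟩⟩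

lemma hasDerivAt_comp_neg {f : ℝ → ℂ} {f' : ℂ} {x : ℝ} (h : HasDerivAt f f' (-x)) :
    HasDerivAt (fun x => f (-x)) (-f') x := by
  have := h.scomp x (hasDerivAt_neg x)
  rw [neg_one_smul] at this
  exact this

/-- The reflected potential `x ↦ conj (p (-x))`. -/
noncomputable def reflect (p : ℝ → ℂ) (x : ℝ) : ℂ := conj (p (-x))

lemma Decaying.reflect {p : ℝ → ℂ} (hp : Decaying p) : Decaying (reflect p) := hp.comp_neg.conj

/-- Reflection exchanges the Jost functions `ϕ₊` and `φ₋`. -/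
lemma isJostSecond_atTop_iff {p : ℝ → ℂ} (hp : Continuous p) {lam : ℂ} {v : ℝ → Fin 2 → ℂ} :
    IsJostSecond atTop p lam v ↔
      IsJostLeft (reflect p) lam (fun x => v (-x) 1) (fun x => v (-x) 0) := by
  rw [isJostSecond_iff hp]
  constructor
  · rintro ⟨⟨M, hM⟩, b, c, d, e⟩
    refine ⟨⟨M, fun x => ⟨(hM (-x)).2, (hM (-x)).1⟩⟩, fun x => ?_, fun x => ?_,
      e.comp tendsto_neg_atBot_atTop, d.comp tendsto_neg_atBot_atTop⟩
    · refine (hasDerivAt_comp_neg (c (-x))).congr_deriv ?_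
      simp only [srcA, srcB, reflect, Complex.conj_conj]; ring
    · refine (hasDerivAt_comp_neg (b (-x))).congr_deriv ?_
      simp only [srcA, srcB, reflect, Complex.conj_conj]; ring
  · rintro ⟨⟨M, hM⟩, b, c, d, e⟩
    have n : ∀ x : ℝ, - -x = x := neg_neg
    refine ⟨⟨M, fun x => ?_⟩, fun x => ?_, fun x => ?_, ?_, ?_⟩
    · simpa using (hM (-x)).symm
    · have := hasDerivAt_comp_neg (c (-x))
      simp only [n] at this
      refine this.congr_deriv ?_
      simp only [srcA, srcB, reflect, Complex.conj_conj, n]; ring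
    · have := hasDerivAt_comp_neg (b (-x))
      simp only [n] at this
      refine this.congr_deriv ?_
      simp only [srcA, srcB, reflect, Complex.conj_conj, n]; ring
    · simpa [Function.comp_def] using e.comp tendsto_neg_atTop_atBot
    · simpa [Function.comp_def] using d.comp tendsto_neg_atTop_atBot

/-- The symmetry (f, g) ↦ (-ḡ, f̄), λ ↦ λ̄ of the spectral problem. Together with its inverse
`IsJostSecond.conj` it reduces φ₊ on Im λ² ≤ 0 to ϕ₊ on Im λ² ≥ 0. -/
lemma IsJostFirst.conj {l : Filter ℝ} {p : ℝ → ℂ} (hp : Continuous p) {lam : ℂ}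
    {v : ℝ → Fin 2 → ℂ} (h : IsJostFirst l p lam v) :
    IsJostSecond l p (conj lam) (fun x => ![-conj (v x 1), conj (v x 0)]) := by
  rw [isJostFirst_iff hp] at h
  rw [isJostSecond_iff hp]
  obtain ⟨⟨M, hM⟩, b, c, d, e⟩ := h
  simp only [Matrix.cons_val_zero, Matrix.cons_val_one, norm_neg, RCLike.norm_conj]
  refine ⟨⟨M, fun x => (hM x).symm⟩, fun x => ?_, fun x => ?_, ?_, ?_⟩
  · refine (hasDerivAt_conj (c x)).neg.congr_deriv ?_
    simp only [srcA, srcB, map_add, map_sub, map_mul, map_neg, map_pow, map_div₀,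
      Complex.conj_I, Complex.conj_conj, Complex.conj_ofNat]
    ring
  · refine (hasDerivAt_conj (b x)).congr_deriv ?_
    simp only [srcA, srcB, map_add, map_mul, map_div₀,
      Complex.conj_I, Complex.conj_conj, Complex.conj_ofNat]
    ring
  · simpa using ((Complex.continuous_conj.tendsto _).comp e).neg
  · simpa [Function.comp_def] using (Complex.continuous_conj.tendsto _).comp d

lemma IsJostSecond.conj {l : Filter ℝ} {p : ℝ → ℂ} (hp : Continuous p) {lam : ℂ}
    {v : ℝ → Fin 2 → ℂ} (h : IsJostSecond l p lam v) :
    IsJostFirst l p (conj lam) (fun x => ![conj (v x 1), -conj (v x 0)]) := by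
  rw [isJostSecond_iff hp] at h
  rw [isJostFirst_iff hp]
  obtain ⟨⟨M, hM⟩, b, c, d, e⟩ := h
  simp only [Matrix.cons_val_zero, Matrix.cons_val_one, norm_neg, RCLike.norm_conj]
  refine ⟨⟨M, fun x => (hM x).symm⟩, fun x => ?_, fun x => ?_, ?_, ?_⟩
  · refine (hasDerivAt_conj (c x)).congr_deriv ?_
    simp only [srcA, srcB, map_sub, map_mul, map_neg, map_div₀,
      Complex.conj_I, Complex.conj_conj, Complex.conj_ofNat]
    ring
  · refine (hasDerivAt_conj (b x)).neg.congr_deriv ?_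
    simp only [srcA, srcB, map_add, map_mul, map_neg, map_pow, map_div₀,
      Complex.conj_I, Complex.conj_conj, Complex.conj_ofNat]
    ring
  · simpa [Function.comp_def] using (Complex.continuous_conj.tendsto _).comp e
  · simpa using ((Complex.continuous_conj.tendsto _).comp d).neg

lemma det2_eq (u v : Fin 2 → ℂ) : det2 u v = u 0 * v 1 - v 0 * u 1 := by
  simp [det2, Matrix.det_fin_two]
  ring

/-! ### Existence and uniqueness of the Jost functions -/

lemma conj_sq_im_nonneg {lam : ℂ} (h : (lam ^ 2).im ≤ 0) : 0 ≤ ((conj lam) ^ 2).im := by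
  rw [← map_pow, Complex.conj_im]; linarith

section Jost

variable {p : ℝ → ℂ} (hp : Decaying p) {lam : ℂ}

include hp

lemma varphiMinus_spec (h : 0 ≤ (lam ^ 2).im) :
    IsJostFirst atBot p lam (varphiMinus p lam) := by
  refine Classical.epsilon_spec ?_
  obtain ⟨u, w, hj⟩ := exists_isJostLeft hp h
  exact ⟨fun x => ![u x, w x], (isJostFirst_atBot_iff hp.cont).2 hj⟩

lemma phiPlus_spec (h : 0 ≤ (lam ^ 2).im) : IsJostSecond atTop p lam (phiPlus p lam) := by
  refine Classical.epsilon_spec ?_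
  obtain ⟨u, w, hj⟩ := exists_isJostLeft hp.reflect h
  exact ⟨fun x => ![w (-x), u (-x)], (isJostSecond_atTop_iff hp.cont).2 (by simpa using hj)⟩

lemma varphiPlus_spec (h : (lam ^ 2).im ≤ 0) :
    IsJostFirst atTop p lam (varphiPlus p lam) := by
  have := (phiPlus_spec hp (conj_sq_im_nonneg h)).conj hp.cont
  rw [Complex.conj_conj] at this
  exact Classical.epsilon_spec (p := IsJostFirst atTop p lam) ⟨_, this⟩

lemma varphiMinus_unique (h : 0 ≤ (lam ^ 2).im) {v : ℝ → Fin 2 → ℂ}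
    (hv : IsJostFirst atBot p lam v) : varphiMinus p lam = v := by
  have := ((isJostFirst_atBot_iff hp.cont).1 (varphiMinus_spec hp h)).unique hp
    ((isJostFirst_atBot_iff hp.cont).1 hv) h
  funext x i
  fin_cases i
  · exact congrFun this.1 x
  · exact congrFun this.2 x

lemma isJostSecond_unique (h : 0 ≤ (lam ^ 2).im) {v w : ℝ → Fin 2 → ℂ}
    (hv : IsJostSecond atTop p lam v) (hw : IsJostSecond atTop p lam w) : v = w := by
  have := ((isJostSecond_atTop_iff hp.cont).1 hv).unique hp.reflect
    ((isJostSecond_atTop_iff hp.cont).1 hw) h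
  funext x i
  fin_cases i
  · simpa using congrFun this.2 (-x)
  · simpa using congrFun this.1 (-x)

lemma phiPlus_unique (h : 0 ≤ (lam ^ 2).im) {v : ℝ → Fin 2 → ℂ}
    (hv : IsJostSecond atTop p lam v) : phiPlus p lam = v :=
  isJostSecond_unique hp h (phiPlus_spec hp h) hv

lemma varphiPlus_unique (h : (lam ^ 2).im ≤ 0) {v : ℝ → Fin 2 → ℂ}
    (hv : IsJostFirst atTop p lam v) : varphiPlus p lam = v := by
  have := isJostSecond_unique hp (conj_sq_im_nonneg h) ((varphiPlus_spec hp h).conj hp.cont)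
    (hv.conj hp.cont)
  funext x i
  have h0 := congrFun (congrFun this x) 0
  have h1 := congrFun (congrFun this x) 1
  simp only [Matrix.cons_val_zero, Matrix.cons_val_one, neg_inj] at h0 h1
  fin_cases i
  · exact (starRingEnd ℂ).injective h1
  · exact (starRingEnd ℂ).injective h0

lemma continuousAt_scatA {lam₀ : ℂ} (h : 0 < (lam₀ ^ 2).im) : ContinuousAt (scatA p) lam₀ := by
  have c1 := IsJostLeft.tendsto_param hp h
    (fun lam hl => (isJostFirst_atBot_iff hp.cont).1 (varphiMinus_spec hp hl)) 0
  have c2 := IsJostLeft.tendsto_param hp.reflect h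
    (fun lam hl => (isJostSecond_atTop_iff hp.cont).1 (phiPlus_spec hp hl)) 0
  simp only [neg_zero] at c2
  have e : scatA p = fun lam => varphiMinus p lam 0 0 * phiPlus p lam 0 1
      - phiPlus p lam 0 0 * varphiMinus p lam 0 1 := by
    funext lam
    rw [scatA, det2_eq]
  rw [e]
  exact (c1.1.mul c2.1).sub (c2.2.mul c1.2)

end Jost

/-! ### Nonvanishing of solutions and constancy of the determinant -/

/-- The coefficient matrix has trace zero. -/
lemma IsClassicalSolution.wronskian {p : ℝ → ℂ} {lam : ℂ} {f g f' g' : ℝ → ℂ}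
    (h : IsClassicalSolution p lam f g) (h' : IsClassicalSolution p lam f' g') (x y : ℝ) :
    f x * g' x - f' x * g x = f y * g' y - f' y * g y := by
  have hd : ∀ x, HasDerivAt (fun x => f x * g' x - f' x * g x) 0 x := fun x => by
    refine (((h.deriv_fst x).mul (h'.deriv_snd x)).sub
      ((h'.deriv_fst x).mul (h.deriv_snd x))).congr_deriv ?_
    simp only [srcA, srcB]; ring
  exact is_const_of_deriv_eq_zero (fun x => (hd x).differentiableAt) (fun x => (hd x).deriv) x y

lemma IsClassicalSolution.eq_zero {p : ℝ → ℂ} (hp : Decaying p) {lam : ℂ} {f g : ℝ → ℂ}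
    (h : IsClassicalSolution p lam f g) {x₀ : ℝ} (hf : f x₀ = 0) (hg : g x₀ = 0) (x : ℝ) :
    f x = 0 ∧ g x = 0 := by
  obtain ⟨M, hM⟩ := hp.bdd
  have hM0 : 0 ≤ M := (norm_nonneg _).trans (hM 0)
  let V : ℝ → ℂ × ℂ → ℂ × ℂ := fun t z =>
    (-Complex.I * lam ^ 2 * z.1 + srcA p lam (fun _ => z.1) (fun _ => z.2) t,
      Complex.I * lam ^ 2 * z.2 + srcB p lam (fun _ => z.1) (fun _ => z.2) t)
  have hsub : ∀ t z z', V t z - V t z' = V t (z - z') := fun t z z' => by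
    simp only [V, srcA, srcB, Prod.mk_sub_mk, Prod.fst_sub, Prod.snd_sub]
    congr 1 <;> ring
  have hw : ∀ t, weight p ‖lam‖ t ≤ ‖lam‖ * M + M ^ 2 / 4 := fun t => by
    unfold weight
    have := hM t
    gcongr
  have hV : ∀ t z, ‖V t z‖ ≤ (‖lam‖ ^ 2 + (‖lam‖ * M + M ^ 2 / 4)) * ‖z‖ := fun t z => by
    have h1 : ‖srcA p lam (fun _ => z.1) (fun _ => z.2) t‖ ≤ weight p ‖lam‖ t * ‖z‖ :=
      norm_srcA_le le_rfl (norm_fst_le z) (norm_snd_le z)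
    have h2 : ‖srcB p lam (fun _ => z.1) (fun _ => z.2) t‖ ≤ weight p ‖lam‖ t * ‖z‖ :=
      norm_srcB_le le_rfl (norm_fst_le z) (norm_snd_le z)
    have h3 := mul_le_mul_of_nonneg_right (hw t) (norm_nonneg z)
    have h4 := mul_le_mul_of_nonneg_left (norm_fst_le z) (sq_nonneg ‖lam‖)
    have h5 := mul_le_mul_of_nonneg_left (norm_snd_le z) (sq_nonneg ‖lam‖)
    refine norm_prod_le_iff.2 ⟨(norm_add_le _ _).trans ?_, (norm_add_le _ _).trans ?_⟩
    · simp only [norm_mul, norm_neg, Complex.norm_I, norm_pow, one_mul]; linarith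
    · simp only [norm_mul, Complex.norm_I, norm_pow, one_mul]; linarith
  have hL : ∀ t, LipschitzOnWith
      ⟨‖lam‖ ^ 2 + (‖lam‖ * M + M ^ 2 / 4), by positivity⟩ (V t) Set.univ := fun t =>
    (LipschitzWith.of_dist_le_mul fun z z' => by
      rw [dist_eq_norm, dist_eq_norm, hsub]; exact hV t _).lipschitzOnWith
  have hV0 : ∀ t, V t 0 = 0 := fun t => by simp [V, srcA, srcB]
  have := ODE_solution_unique_univ (t₀ := x₀) (f := fun t => (f t, g t)) (g := fun _ => 0) hL
    (fun t => ⟨(h.deriv_fst t).prodMk (h.deriv_snd t), Set.mem_univ _⟩)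
    (fun t => ⟨by rw [hV0]; exact hasDerivAt_const t 0, Set.mem_univ _⟩) (by simp [hf, hg])
  have hx := congrFun this x
  exact ⟨congrArg Prod.fst hx, congrArg Prod.snd hx⟩

/-! ### Darboux matrices -/

/-- The differential system for the coefficients of a Darboux matrix
`T = [[λ² α - κ ᾱ, λ γ], [-λ γ̄, λ² ᾱ - κ α]]` mapping solutions for `q` to solutions for `P`. -/
structure IsDarboux (q P α γ : ℝ → ℂ) (κ : ℝ) : Prop where
  norm_fst : ∀ x, ‖α x‖ = 1
  potential : ∀ x, P x = α x ^ 2 * q x + 2 * Complex.I * (α x * γ x)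
  deriv_fst : ∀ x, HasDerivAt α
    (α x * (-(Complex.I / 4) * (P x * conj (P x)) + Complex.I / 4 * (q x * conj (q x)))) x
  deriv_snd : ∀ x, HasDerivAt γ (Complex.I / 4 * ((P x * conj (P x) + q x * conj (q x)) * γ x)
    + (-(κ : ℂ) * (α x * P x) + κ * (conj (α x) * q x))) x

/-- Multiplication by a Darboux matrix. -/
noncomputable def darbouxApply (κ : ℝ) (lam a c : ℂ) (v : Fin 2 → ℂ) : Fin 2 → ℂ :=
  ![(lam ^ 2 * a - κ * conj a) * v 0 + lam * c * v 1,
    -(lam * conj c) * v 0 + (lam ^ 2 * conj a - κ * a) * v 1]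

lemma det2_darbouxApply (κ : ℝ) (lam a c : ℂ) (u v : Fin 2 → ℂ) :
    det2 (darbouxApply κ lam a c u) (darbouxApply κ lam a c v) =
      ((lam ^ 2 * a - κ * conj a) * (lam ^ 2 * conj a - κ * a) + lam ^ 2 * (c * conj c))
        * det2 u v := by
  simp only [det2_eq, darbouxApply, Matrix.cons_val_zero, Matrix.cons_val_one]
  ring

lemma det2_smul (a b : ℂ) (u v : Fin 2 → ℂ) : det2 (a • u) (b • v) = a * b * det2 u v := by
  simp only [det2_eq, Pi.smul_apply, smul_eq_mul]
  ring

/-- The λ² diagonal part of the intertwining relation. The letters `b`, `d`, `Q`, `R` stand for the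
conjugates of α, γ, q, P but are kept independent, so that the conjugate relation is another
instance, with `i` replaced by `-i`. -/
lemma darboux_relation {i a b c d q Q P R : ℂ} (hi : i ^ 2 = -1) (hab : a * b = 1)
    (hP : P = a ^ 2 * q + 2 * i * (a * c)) (hR : R = b ^ 2 * Q - 2 * i * (b * d)) :
    -(i / 2) * a * P * R + i / 2 * a * q * Q - c * Q + P * d = 0 := by
  linear_combination (-(i / 2) * a * P) * hR + (a * b * P * d - a * b * c * Q) * hi
    + (-P * d - i / 2 * b * P * Q - i / 2 * a * q * Q + c * Q) * hab + (-(i / 2) * b * Q) * hP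

section

variable {q P α γ : ℝ → ℂ} {κ : ℝ} {lam : ℂ}

/-- Compare powers of λ in T' + T U_q = U_P T: λ⁰ is the equation for α, λ¹ the equation for γ, λ³
the formula for P, and λ² then follows from `darboux_relation`. -/
lemma IsDarboux.isClassicalSolution (D : IsDarboux q P α γ κ) {u w : ℝ → ℂ}
    (h : IsClassicalSolution q lam u w) :
    IsClassicalSolution P lam
      (fun x => (lam ^ 2 * α x - κ * conj (α x)) * u x + lam * γ x * w x)
      (fun x => -(lam * conj (γ x)) * u x + (lam ^ 2 * conj (α x) - κ * α x) * w x) := by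
  have key : ∀ x, α x * conj (α x) = 1 := fun x => by
    rw [Complex.mul_conj, Complex.normSq_eq_norm_sq, D.norm_fst]; simp
  have hcP : ∀ x, conj (P x) = conj (α x) ^ 2 * conj (q x)
      - 2 * Complex.I * (conj (α x) * conj (γ x)) := fun x => by
    rw [D.potential x]
    simp only [map_add, map_mul, map_pow, Complex.conj_I, Complex.conj_ofNat]
    ring
  have r1 := fun x => darboux_relation Complex.I_sq (key x) (D.potential x) (hcP x)
  have r2 := fun x => darboux_relation (i := -Complex.I) (a := conj (α x)) (b := α x)
    (c := conj (γ x)) (d := γ x) (q := conj (q x)) (Q := q x) (P := conj (P x)) (R := P x)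
    (by simp) (by rw [mul_comm]; exact key x) (by rw [hcP x]; ring) (by rw [D.potential x]; ring)
  refine ⟨fun x => ?_, fun x => ?_⟩
  · refine (((((D.deriv_fst x).const_mul (lam ^ 2)).sub
      ((hasDerivAt_conj (D.deriv_fst x)).const_mul (κ : ℂ))).mul (h.deriv_fst x)).add
      (((D.deriv_snd x).const_mul lam).mul (h.deriv_snd x))).congr_deriv ?_
    simp only [srcA, srcB, map_add, map_mul, map_neg, map_div₀, Complex.conj_I, Complex.conj_conj,
      Complex.conj_ofNat, Pi.sub_apply]
    linear_combination lam ^ 2 * u x * r1 x + lam ^ 3 * w x *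
      (-(α x * q x + 2 * Complex.I * γ x) * key x - conj (α x) * D.potential x)
  · refine ((((((hasDerivAt_conj (D.deriv_snd x)).const_mul lam).neg).mul (h.deriv_fst x)).add
      ((((hasDerivAt_conj (D.deriv_fst x)).const_mul (lam ^ 2)).sub
      ((D.deriv_fst x).const_mul (κ : ℂ))).mul (h.deriv_snd x)))).congr_deriv ?_
    simp only [srcA, srcB, map_add, map_mul, map_neg, map_div₀, Complex.conj_I, Complex.conj_conj,
      Complex.conj_ofNat, Complex.conj_ofReal, Pi.sub_apply, Pi.neg_apply]
    linear_combination lam ^ 2 * w x * r2 x - lam ^ 3 * u x *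
      (-(conj (α x) * conj (q x) - 2 * Complex.I * conj (γ x)) * key x - α x * hcP x)

lemma IsClassicalSolution.const_mul {p u w : ℝ → ℂ} (h : IsClassicalSolution p lam u w) (c : ℂ) :
    IsClassicalSolution p lam (fun x => c * u x) (fun x => c * w x) := by
  refine ⟨fun x => ((h.deriv_fst x).const_mul c).congr_deriv ?_,
    fun x => ((h.deriv_snd x).const_mul c).congr_deriv ?_⟩
  · simp only [srcA]; ring
  · simp only [srcB]; ring

lemma IsDarboux.isSpectralSolution (D : IsDarboux q P α γ κ) (hq : Continuous q)
    (hP : Continuous P) {v : ℝ → Fin 2 → ℂ} {e : ℝ → ℂ}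
    (h : IsSpectralSolution q lam (fun x => e x • v x)) (c : ℂ) :
    IsSpectralSolution P lam
      (fun x => e x • (c • darbouxApply κ lam (α x) (γ x) (v x))) := by
  rw [isSpectralSolution_iff hq] at h
  rw [isSpectralSolution_iff hP]
  convert (D.isClassicalSolution h).const_mul c using 2 with x
  · simp [darbouxApply]; ring
  · simp [darbouxApply]; ring

lemma IsDarboux.cont_fst (D : IsDarboux q P α γ κ) : Continuous α :=
  continuous_iff_continuousAt.2 fun x => (D.deriv_fst x).continuousAt

lemma IsDarboux.cont_snd (D : IsDarboux q P α γ κ) : Continuous γ :=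
  continuous_iff_continuousAt.2 fun x => (D.deriv_snd x).continuousAt

lemma IsDarboux.continuous_potential (D : IsDarboux q P α γ κ) (hq : Continuous q) :
    Continuous P := by
  have := D.cont_fst
  have := D.cont_snd
  rw [funext D.potential]
  fun_prop

lemma IsDarboux.bdd_apply (D : IsDarboux q P α γ κ) {C : ℝ} (hC : ∀ x, ‖γ x‖ ≤ C)
    {v : ℝ → Fin 2 → ℂ} (hv : ∃ M : ℝ, ∀ x, ‖v x‖ ≤ M) (c : ℂ) :
    ∃ M : ℝ, ∀ x, ‖c • darbouxApply κ lam (α x) (γ x) (v x)‖ ≤ M := by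
  rw [exists_norm_le_iff] at hv ⊢
  obtain ⟨M, hM⟩ := hv
  have hM0 : 0 ≤ M := (norm_nonneg _).trans (hM 0).1
  have hC0 : 0 ≤ C := (norm_nonneg _).trans (hC 0)
  have b1 : ∀ x, ‖lam ^ 2 * α x - κ * conj (α x)‖ ≤ ‖lam‖ ^ 2 + |κ| := fun x => by
    refine (norm_sub_le _ _).trans (le_of_eq ?_)
    simp [D.norm_fst x]
  have b2 : ∀ x, ‖lam ^ 2 * conj (α x) - κ * α x‖ ≤ ‖lam‖ ^ 2 + |κ| := fun x => by
    refine (norm_sub_le _ _).trans (le_of_eq ?_)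
    simp [D.norm_fst x]
  refine ⟨‖c‖ * ((‖lam‖ ^ 2 + |κ|) * M + ‖lam‖ * C * M), fun x => ?_⟩
  have h0 := (hM x).1
  have h1 := (hM x).2
  have h2 := hC x
  simp only [darbouxApply, Pi.smul_apply, smul_eq_mul, Matrix.cons_val_zero, Matrix.cons_val_one,
    norm_mul]
  constructor
  · refine mul_le_mul_of_nonneg_left ((norm_add_le _ _).trans ?_) (norm_nonneg _)
    rw [norm_mul, norm_mul, norm_mul]
    have := b1 x
    gcongr
  · refine mul_le_mul_of_nonneg_left ((norm_add_le _ _).trans ?_) (norm_nonneg _)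
    rw [norm_mul, norm_mul, norm_neg, norm_mul, RCLike.norm_conj, add_comm]
    have := b2 x
    gcongr

lemma tendsto_darbouxApply {l : Filter ℝ} {v : ℝ → Fin 2 → ℂ} {a₀ v₀ v₁ : ℂ}
    (hα : Tendsto α l (𝓝 a₀)) (hγ : Tendsto γ l (𝓝 0)) (hv : Tendsto v l (𝓝 ![v₀, v₁])) (c : ℂ) :
    Tendsto (fun x => c • darbouxApply κ lam (α x) (γ x) (v x)) l
      (𝓝 ![c * ((lam ^ 2 * a₀ - κ * conj a₀) * v₀), c * ((lam ^ 2 * conj a₀ - κ * a₀) * v₁)]) := by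
  rw [tendsto_fin_two_iff] at hv ⊢
  have hα' := (Complex.continuous_conj.tendsto _).comp hα
  have hγ' := (Complex.continuous_conj.tendsto _).comp hγ
  rw [map_zero] at hγ'
  constructor
  · have := ((((hα.const_mul (lam ^ 2)).sub (hα'.const_mul (κ : ℂ))).mul hv.1).add
      ((hγ.const_mul lam).mul hv.2)).const_mul c
    simpa [darbouxApply] using this
  · have := (((hγ'.const_mul lam).neg.mul hv.1).add
      (((hα'.const_mul (lam ^ 2)).sub (hα.const_mul (κ : ℂ))).mul hv.2)).const_mul c
    simpa [darbouxApply] using this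

/-- Where γ → 0 the Darboux matrix becomes diagonal, so it sends a function tending to e₁ to one
tending to a multiple of e₁. That multiple must be nonzero to be divided out. -/
lemma IsDarboux.isJostFirst (D : IsDarboux q P α γ κ) (hq : Continuous q) {C : ℝ}
    (hC : ∀ x, ‖γ x‖ ≤ C) {l : Filter ℝ} {a₀ : ℂ} (hα : Tendsto α l (𝓝 a₀))
    (hγ : Tendsto γ l (𝓝 0)) (ha : lam ^ 2 * a₀ - κ * conj a₀ ≠ 0) {v : ℝ → Fin 2 → ℂ}
    (h : IsJostFirst l q lam v) :
    IsJostFirst l P lam (fun x => (lam ^ 2 * a₀ - κ * conj a₀)⁻¹ •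
      darbouxApply κ lam (α x) (γ x) (v x)) := by
  refine ⟨D.bdd_apply hC h.1 _, D.isSpectralSolution hq (D.continuous_potential hq) h.2.1 _, ?_⟩
  have := tendsto_darbouxApply (κ := κ) (lam := lam) hα hγ h.2.2 (lam ^ 2 * a₀ - κ * conj a₀)⁻¹
  simpa [ha] using this

lemma IsDarboux.isJostSecond (D : IsDarboux q P α γ κ) (hq : Continuous q) {C : ℝ}
    (hC : ∀ x, ‖γ x‖ ≤ C) {l : Filter ℝ} {a₀ : ℂ} (hα : Tendsto α l (𝓝 a₀))
    (hγ : Tendsto γ l (𝓝 0)) (ha : lam ^ 2 * conj a₀ - κ * a₀ ≠ 0) {v : ℝ → Fin 2 → ℂ}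
    (h : IsJostSecond l q lam v) :
    IsJostSecond l P lam (fun x => (lam ^ 2 * conj a₀ - κ * a₀)⁻¹ •
      darbouxApply κ lam (α x) (γ x) (v x)) := by
  refine ⟨D.bdd_apply hC h.1 _, D.isSpectralSolution hq (D.continuous_potential hq) h.2.1 _, ?_⟩
  have := tendsto_darbouxApply (κ := κ) (lam := lam) hα hγ h.2.2 (lam ^ 2 * conj a₀ - κ * a₀)⁻¹
  simpa [ha] using this

end

/-! ### The Darboux matrix attached to a solution -/

/-- The form `m_l(Φ, Φ)` for `Φ = (f, g)`. -/
noncomputable def seedForm (l f g : ℂ) : ℂ := l * (f * conj f) + conj l * (g * conj g)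

/-- The diagonal coefficient `m̄ / |m|` of the Darboux matrix. -/
noncomputable def seedAlpha (l f g : ℂ) : ℂ := conj (seedForm l f g) / ‖seedForm l f g‖

/-- The off-diagonal coefficient of the Darboux matrix. -/
noncomputable def seedGamma (l f g : ℂ) : ℂ :=
  -((l ^ 2 - conj l ^ 2) * (f * conj g)) / ‖seedForm l f g‖

section

variable {l f g : ℂ}

/-- Since Re l > 0, the form can vanish only where both components do; this keeps all denominators
away from zero. -/
lemma re_seedForm : (seedForm l f g).re = l.re * (‖f‖ ^ 2 + ‖g‖ ^ 2) := by
  rw [seedForm, Complex.mul_conj, Complex.mul_conj, Complex.normSq_eq_norm_sq,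
    Complex.normSq_eq_norm_sq, Complex.add_re, Complex.re_mul_ofReal, Complex.re_mul_ofReal,
    Complex.conj_re]
  ring

lemma le_norm_seedForm : l.re * (‖f‖ ^ 2 + ‖g‖ ^ 2) ≤ ‖seedForm l f g‖ := by
  rw [← re_seedForm]; exact Complex.re_le_norm _

lemma norm_seedForm_pos (hl : 0 < l.re) (h : f ≠ 0 ∨ g ≠ 0) : 0 < ‖seedForm l f g‖ := by
  refine lt_of_lt_of_le ?_ le_norm_seedForm
  rcases h with h | h
  · have := norm_pos_iff.2 h; positivity
  · have := norm_pos_iff.2 h; positivity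

lemma seedForm_smul (c : ℂ) : seedForm l (c * f) (c * g) = (‖c‖ ^ 2 : ℝ) * seedForm l f g := by
  have : ((‖c‖ ^ 2 : ℝ) : ℂ) = c * conj c := by
    rw [Complex.mul_conj, Complex.normSq_eq_norm_sq]
  rw [this]
  simp only [seedForm, map_mul]; ring

/-- Homogeneity of degree zero is what permits dropping the exponential in the seed and exchanging
φ₋ with ϕ₊ at a zero of a. -/
lemma seedAlpha_smul {c : ℂ} (hc : c ≠ 0) : seedAlpha l (c * f) (c * g) = seedAlpha l f g := by
  have h1 : ((‖c‖ ^ 2 : ℝ) : ℂ) ≠ 0 := by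
    simpa using hc
  have h2 : ‖((‖c‖ ^ 2 : ℝ) : ℂ)‖ = ‖c‖ ^ 2 := by simp
  rw [seedAlpha, seedForm_smul, map_mul, Complex.conj_ofReal, norm_mul, h2, Complex.ofReal_mul,
    mul_div_mul_left _ _ h1, seedAlpha]

lemma seedGamma_smul {c : ℂ} (hc : c ≠ 0) : seedGamma l (c * f) (c * g) = seedGamma l f g := by
  have h1 : ((‖c‖ ^ 2 : ℝ) : ℂ) ≠ 0 := by
    simpa using hc
  have h2 : ‖((‖c‖ ^ 2 : ℝ) : ℂ)‖ = ‖c‖ ^ 2 := by simp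
  have h3 : ((‖c‖ ^ 2 : ℝ) : ℂ) = c * conj c := by
    rw [Complex.mul_conj, Complex.normSq_eq_norm_sq]
  have h4 : -((l ^ 2 - conj l ^ 2) * (c * f * conj (c * g)))
      = ((‖c‖ ^ 2 : ℝ) : ℂ) * -((l ^ 2 - conj l ^ 2) * (f * conj g)) := by
    rw [h3, map_mul]; ring
  rw [seedGamma, seedForm_smul, norm_mul, h2, Complex.ofReal_mul, h4,
    mul_div_mul_left _ _ h1, seedGamma]

lemma norm_seedAlpha (hl : 0 < l.re) (h : f ≠ 0 ∨ g ≠ 0) : ‖seedAlpha l f g‖ = 1 := by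
  have := norm_seedForm_pos hl h
  rw [seedAlpha, norm_div, RCLike.norm_conj, Complex.norm_real, norm_norm, div_self this.ne']

/-- Follows from |m| ≥ Re l (|f|² + |g|²). It makes γ small as soon as one component of the seed is
small relative to the other. -/
lemma norm_seedGamma_le (hl : 0 < l.re) (h : f ≠ 0 ∨ g ≠ 0) :
    ‖seedGamma l f g‖ * (‖f‖ ^ 2 + ‖g‖ ^ 2) ≤ ‖l ^ 2 - conj l ^ 2‖ / l.re * (‖f‖ * ‖g‖) := by
  have h1 := norm_seedForm_pos hl h
  have h2 := le_norm_seedForm (l := l) (f := f) (g := g)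
  rw [seedGamma, norm_div, norm_neg, norm_mul, norm_mul, RCLike.norm_conj, Complex.norm_real,
    norm_norm, div_mul_eq_mul_div, div_mul_eq_mul_div, div_le_div_iff₀ h1 hl, mul_assoc]
  have := norm_nonneg (l ^ 2 - conj l ^ 2)
  refine mul_le_mul_of_nonneg_left ?_ (by positivity)
  linarith

lemma seedForm_mul_conj : seedForm l f g * conj (seedForm l f g) = (‖seedForm l f g‖ : ℂ) ^ 2 := by
  rw [Complex.mul_conj, Complex.normSq_eq_norm_sq]; push_cast; rfl

/-- The determinant is a monic quadratic in λ², as |α| = 1. The coefficients are chosen so that the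
matrix at λ = l annihilates (f, g), which gives the root l²; the conjugation symmetry gives the
other root. -/
lemma det_seed (hl : 0 < l.re) (h : f ≠ 0 ∨ g ≠ 0) (lam : ℂ) :
    (lam ^ 2 * seedAlpha l f g - (‖l‖ ^ 2 : ℝ) * conj (seedAlpha l f g))
      * (lam ^ 2 * conj (seedAlpha l f g) - (‖l‖ ^ 2 : ℝ) * seedAlpha l f g)
      + lam ^ 2 * (seedGamma l f g * conj (seedGamma l f g))
      = (lam ^ 2 - l ^ 2) * (lam ^ 2 - conj l ^ 2) := by
  have h0 : (‖seedForm l f g‖ : ℂ) ≠ 0 := by exact_mod_cast (norm_seedForm_pos hl h).ne'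
  have h3 : ((‖l‖ ^ 2 : ℝ) : ℂ) = l * conj l := by
    rw [Complex.mul_conj, Complex.normSq_eq_norm_sq]
  have hN := seedForm_mul_conj (l := l) (f := f) (g := g)
  rw [h3]
  simp only [seedAlpha, seedGamma, map_div₀, map_neg, map_mul, map_sub, map_pow,
    Complex.conj_conj, Complex.conj_ofReal]
  set N := (‖seedForm l f g‖ : ℂ)
  set M := seedForm l f g with hM
  have hMd : M = l * (f * conj f) + conj l * (g * conj g) := rfl
  have hMb : conj M = conj l * (f * conj f) + l * (g * conj g) := by
    rw [hMd]; simp only [map_add, map_mul, Complex.conj_conj]; ring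
  rw [hMb] at hN ⊢
  rw [hMd] at hN ⊢
  field_simp
  rw [← hN]
  ring

lemma hasDerivAt_norm_complex {m : ℝ → ℂ} {m' : ℂ} {x : ℝ} (h : HasDerivAt m m' x)
    (h0 : m x ≠ 0) :
    HasDerivAt (fun x => (‖m x‖ : ℂ)) ((m' * conj (m x) + m x * conj m') / (2 * ‖m x‖)) x := by
  have hn : ‖m x‖ ≠ 0 := norm_ne_zero_iff.2 h0
  have h1 := (h.norm_sq).sqrt (by positivity)
  simp only [Real.sqrt_sq (norm_nonneg _)] at h1
  refine h1.ofReal_comp.congr_deriv ?_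
  have hr : ((2 * inner ℝ (m x) m' : ℝ) : ℂ) = m' * conj (m x) + m x * conj m' := by
    rw [Complex.inner]
    push_cast
    rw [Complex.re_eq_add_conj, map_mul, Complex.conj_conj]
    ring
  rw [Complex.ofReal_div, hr]
  push_cast
  rfl

end

/-- As α² = m̄/m, the logarithmic derivative of α is (m̄'m - m'm̄)/(2|m|²); this is its numerator.
Capital `L`, `F`, `G`, `Q` stand for conjugates, `N` for m̄, and P = X/M with conjugate Y/N. -/
lemma darboux_alpha_identity {i l L f F g G q Q M N X Y δ : ℂ} (hi : i ^ 2 = -1)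
    (hδ : δ = l ^ 2 - L ^ 2) (hM : M = l * (f * F) + L * (g * G))
    (hN : N = L * (f * F) + l * (g * G)) (hX : X = N * q - 2 * i * δ * (f * G))
    (hY : Y = M * Q - 2 * i * δ * (F * g)) :
    (-i * δ * (L * (f * F) - l * (g * G)) - δ * Q * (f * G)) * M
      - (-i * δ * (l * (f * F) - L * (g * G)) + δ * q * (g * F)) * N
      = -(i / 2) * (X * Y - q * Q * (M * N)) := by
  subst hX hY
  have e : (-i * δ * (L * (f * F) - l * (g * G))) * M - (-i * δ * (l * (f * F) - L * (g * G))) * N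
      = 2 * i * δ ^ 2 * (f * F * (g * G)) := by subst hM hN hδ; ring
  linear_combination e + (2 * i * δ ^ 2 * (f * F * (g * G))
    - δ * (N * q * (F * g) + M * Q * (f * G))) * hi

/-- The equation for γ with denominators cleared, in the same notation; `l * L` is κ. -/
lemma darboux_gamma_identity {i l L f F g G q Q M N X Y δ : ℂ} (hi : i ^ 2 = -1)
    (hδ : δ = l ^ 2 - L ^ 2) (hM : M = l * (f * F) + L * (g * G))
    (hN : N = L * (f * F) + l * (g * G)) (hX : X = N * q - 2 * i * δ * (f * G))
    (hY : Y = M * Q - 2 * i * δ * (F * g)) :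
    -δ * ((((-i * (l ^ 2 + L ^ 2) + i / 2 * (q * Q)) * (f * G)
        + q * (l * (g * G) - L * (f * F))) * (M * N))
      - f * G * ((-i * δ * (l * (f * F) - L * (g * G)) + δ * q * (g * F)) * N
        + M * (-i * δ * (L * (f * F) - l * (g * G)) - δ * Q * (f * G))) / 2)
      = i / 4 * (X * Y + q * Q * (M * N)) * (-δ * (f * G)) - l * L * N ^ 2 * X
        + l * L * (M ^ 2 * N * q) := by
  subst hX hY
  have hc : -(-i * δ ^ 3 * (f * F * (g * G)) * (f * G)
      + δ ^ 2 * (N * q * (F * g) + M * Q * (f * G)) * (f * G) / 2) * (i ^ 2 + 1) = 0 := by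
    rw [hi]; ring
  rw [← sub_eq_zero, ← hc]
  subst hM hN hδ
  ring

/-- The coefficients attached to a nonvanishing solution at `l` define a Darboux matrix. -/
theorem isDarboux_seed {q f g : ℝ → ℂ} {l : ℂ} (hl : 0 < l.re)
    (h : IsClassicalSolution q l f g) (hne : ∀ x, f x ≠ 0 ∨ g x ≠ 0) :
    IsDarboux q (fun x => seedAlpha l (f x) (g x) ^ 2 * q x
        + 2 * Complex.I * (seedAlpha l (f x) (g x) * seedGamma l (f x) (g x)))
      (fun x => seedAlpha l (f x) (g x)) (fun x => seedGamma l (f x) (g x)) (‖l‖ ^ 2) := by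
  have hκ : ((‖l‖ ^ 2 : ℝ) : ℂ) = l * conj l := by
    rw [Complex.mul_conj, Complex.normSq_eq_norm_sq]
  set δ := l ^ 2 - conj l ^ 2 with hδ
  have hconjδ : conj δ = -δ := by
    rw [hδ]; simp only [map_sub, map_pow, Complex.conj_conj]; ring
  have dm : ∀ x, HasDerivAt (fun x => seedForm l (f x) (g x))
      (-Complex.I * δ * (l * (f x * conj (f x)) - conj l * (g x * conj (g x)))
        + δ * q x * (g x * conj (f x))) x := fun x => by
    refine ((((h.deriv_fst x).mul (hasDerivAt_conj (h.deriv_fst x))).const_mul l).add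
      (((h.deriv_snd x).mul (hasDerivAt_conj (h.deriv_snd x))).const_mul (conj l))).congr_deriv ?_
    simp only [srcA, srcB, map_add, map_sub, map_mul, map_neg, map_div₀, map_pow, Complex.conj_I,
      Complex.conj_conj, Complex.conj_ofNat, hδ]
    ring
  have hconjm : ∀ x, conj (seedForm l (f x) (g x))
      = conj l * (f x * conj (f x)) + l * (g x * conj (g x)) := fun x => by
    simp only [seedForm, map_add, map_mul, Complex.conj_conj]; ring
  have dmb : ∀ x, conj (-Complex.I * δ * (l * (f x * conj (f x)) - conj l * (g x * conj (g x)))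
        + δ * q x * (g x * conj (f x)))
      = -Complex.I * δ * (conj l * (f x * conj (f x)) - l * (g x * conj (g x)))
        - δ * conj (q x) * (f x * conj (g x)) := fun x => by
    simp only [map_add, map_sub, map_mul, map_neg, Complex.conj_I, Complex.conj_conj, hconjδ]
    ring
  have dfg : ∀ x, HasDerivAt (fun x => f x * conj (g x))
      ((-Complex.I * (l ^ 2 + conj l ^ 2) + Complex.I / 2 * (q x * conj (q x)))
          * (f x * conj (g x))
        + q x * (l * (g x * conj (g x)) - conj l * (f x * conj (f x)))) x := fun x => by
    refine ((h.deriv_fst x).mul (hasDerivAt_conj (h.deriv_snd x))).congr_deriv ?_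
    simp only [srcA, srcB, map_add, map_sub, map_mul, map_neg, map_div₀, map_pow, Complex.conj_I,
      Complex.conj_conj, Complex.conj_ofNat]
    ring
  have m0 : ∀ x, seedForm l (f x) (g x) ≠ 0 := fun x =>
    norm_pos_iff.1 (norm_seedForm_pos hl (hne x))
  have mb0 : ∀ x, conj (seedForm l (f x) (g x)) ≠ 0 := fun x => by simpa using m0 x
  have n0 : ∀ x, (‖seedForm l (f x) (g x)‖ : ℂ) ≠ 0 := fun x => by simpa using m0 x
  have hN : ∀ x, (‖seedForm l (f x) (g x)‖ : ℂ) ^ 2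
      = seedForm l (f x) (g x) * conj (seedForm l (f x) (g x)) := fun x => seedForm_mul_conj.symm
  have hPx : ∀ x, seedAlpha l (f x) (g x) ^ 2 * q x
        + 2 * Complex.I * (seedAlpha l (f x) (g x) * seedGamma l (f x) (g x))
      = (conj (seedForm l (f x) (g x)) * q x - 2 * Complex.I * δ * (f x * conj (g x)))
        / seedForm l (f x) (g x) := fun x => by
    have := hN x
    have := n0 x
    have := m0 x
    rw [seedAlpha, seedGamma, eq_div_iff (m0 x), ← hδ]
    field_simp
    rw [hN x]
    ring
  have hPb : ∀ x, conj ((conj (seedForm l (f x) (g x)) * q x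
        - 2 * Complex.I * δ * (f x * conj (g x))) / seedForm l (f x) (g x))
      = (seedForm l (f x) (g x) * conj (q x) - 2 * Complex.I * δ * (conj (f x) * g x))
        / conj (seedForm l (f x) (g x)) := fun x => by
    simp only [map_div₀, map_sub, map_mul, Complex.conj_conj, Complex.conj_I, Complex.conj_ofNat,
      hconjδ]
    ring
  refine ⟨fun x => norm_seedAlpha hl (hne x), fun x => rfl, fun x => ?_, fun x => ?_⟩
  · refine ((hasDerivAt_conj (dm x)).div (hasDerivAt_norm_complex (dm x) (m0 x))
      (n0 x)).congr_deriv ?_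
    simp only [hPx, hPb, dmb]
    simp only [seedAlpha]
    have key := darboux_alpha_identity (M := seedForm l (f x) (g x))
      (N := conj (seedForm l (f x) (g x))) (q := q x) (Q := conj (q x)) Complex.I_sq hδ rfl
      (hconjm x) rfl rfl
    have hNx := hN x
    have hn := n0 x
    have hm := m0 x
    have hmb := mb0 x
    -- Once every quantity is a free variable, only a rational identity with N² = M·Mb remains, and
    -- `key` settles its numerator.
    generalize (‖seedForm l (f x) (g x)‖ : ℂ) = N at *
    generalize conj (seedForm l (f x) (g x)) = Mb at *
    generalize seedForm l (f x) (g x) = M at *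
    rw [div_mul_div_comm]
    generalize (Mb * q x - 2 * Complex.I * δ * (f x * conj (g x))) = X at *
    generalize (M * conj (q x) - 2 * Complex.I * δ * (conj (f x) * g x)) = Y at *
    generalize (-Complex.I * δ * (conj l * (f x * conj (f x)) - l * (g x * conj (g x)))
        - δ * conj (q x) * (f x * conj (g x))) = B at *
    generalize (-Complex.I * δ * (l * (f x * conj (f x)) - conj l * (g x * conj (g x)))
        + δ * q x * (g x * conj (f x))) = A at *
    have e1 : (B * N - Mb * ((A * Mb + M * B) / (2 * N))) / N ^ 2
        = (2 * B * N ^ 2 - Mb * (A * Mb + M * B)) / (2 * N * N ^ 2) := by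
      field_simp
    rw [e1, hNx]
    field_simp
    linear_combination 4 * key
  · refine ((((dfg x).const_mul δ).neg).div (hasDerivAt_norm_complex (dm x) (m0 x))
      (n0 x)).congr_deriv ?_
    simp only [hPx, hPb, dmb]
    simp only [seedAlpha, seedGamma, hκ, Pi.neg_apply, map_div₀, Complex.conj_conj,
      Complex.conj_ofReal]
    have key := darboux_gamma_identity (M := seedForm l (f x) (g x))
      (N := conj (seedForm l (f x) (g x))) (q := q x) (Q := conj (q x)) Complex.I_sq hδ rfl
      (hconjm x) rfl rfl
    have hNx := hN x
    have hn := n0 x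
    have hm := m0 x
    have hmb := mb0 x
    rw [← hδ]
    generalize (‖seedForm l (f x) (g x)‖ : ℂ) = N at *
    generalize conj (seedForm l (f x) (g x)) = Mb at *
    generalize seedForm l (f x) (g x) = M at *
    rw [div_mul_div_comm]
    generalize (Mb * q x - 2 * Complex.I * δ * (f x * conj (g x))) = X at *
    generalize (M * conj (q x) - 2 * Complex.I * δ * (conj (f x) * g x)) = Y at *
    generalize (-Complex.I * δ * (conj l * (f x * conj (f x)) - l * (g x * conj (g x)))
        - δ * conj (q x) * (f x * conj (g x))) = B at *
    generalize (-Complex.I * δ * (l * (f x * conj (f x)) - conj l * (g x * conj (g x)))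
        + δ * q x * (g x * conj (f x))) = A at *
    generalize ((-Complex.I * (l ^ 2 + conj l ^ 2) + Complex.I / 2 * (q x * conj (q x)))
          * (f x * conj (g x))
        + q x * (l * (g x * conj (g x)) - conj l * (f x * conj (f x)))) = E at *
    have e1 : (-(δ * E) * N - -(δ * (f x * conj (g x))) * ((A * Mb + M * B) / (2 * N))) / N ^ 2
        = (-δ * (E * N ^ 2 - f x * conj (g x) * (A * Mb + M * B) / 2)) / (N * N ^ 2) := by
      field_simp
      ring
    have e2 : Complex.I / 4 * ((X * Y / (M * Mb) + q x * conj (q x))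
          * (-(δ * (f x * conj (g x))) / N))
        + (-(l * conj l) * (Mb / N * (X / M)) + l * conj l * (M / N * q x))
        = (Complex.I / 4 * (X * Y + q x * conj (q x) * (M * Mb)) * (-δ * (f x * conj (g x)))
            - l * conj l * Mb ^ 2 * X + l * conj l * (M ^ 2 * Mb * q x)) / (N * (M * Mb)) := by
      field_simp
      ring
    rw [e1, e2, hNx, key]

/-! ### Weighted decay of the off-diagonal component -/

/-- Energy estimate: integrate the derivative of |z|² over [X, 0] and absorb the cross term 2
Re(z̄F) into the damping. The a priori bound on z controls the boundary term at X uniformly. -/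
lemma sq_integrableOn_of_hasDerivAt {κ : ℂ} (hκ : κ.re < 0) {z F : ℝ → ℂ} (hF : Continuous F)
    (hz : ∀ x, HasDerivAt z (κ * z x + F x) x) {M : ℝ} (hM : ∀ x ≤ 0, ‖z x‖ ≤ M)
    (hi : IntegrableOn (fun x => ‖F x‖ ^ 2) (Set.Iic 0)) :
    IntegrableOn (fun x => ‖z x‖ ^ 2) (Set.Iic 0) := by
  set c := -κ.re with hc
  have hc0 : 0 < c := by simp only [hc]; linarith
  have cz : Continuous z := continuous_iff_continuousAt.2 fun x => (hz x).continuousAt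
  have hcint : Continuous fun x => 2 * inner ℝ (z x) (κ * z x + F x) := by fun_prop
  have hbound : ∀ x, c * ‖z x‖ ^ 2 ≤ ‖F x‖ ^ 2 / c - 2 * inner ℝ (z x) (κ * z x + F x) := by
    intro x
    have h1 : inner ℝ (z x) (κ * z x) = -c * ‖z x‖ ^ 2 := by
      rw [Complex.inner, mul_assoc, Complex.mul_conj, Complex.re_mul_ofReal,
        Complex.normSq_eq_norm_sq]
      simp [hc]
    have h2 := real_inner_le_norm (z x) (F x)
    rw [inner_add_right, h1]
    have h3 : 2 * (‖z x‖ * ‖F x‖) ≤ c * ‖z x‖ ^ 2 + ‖F x‖ ^ 2 / c := by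
      have := sq_nonneg (c * ‖z x‖ - ‖F x‖)
      rw [← sub_nonneg]
      have e : c * ‖z x‖ ^ 2 + ‖F x‖ ^ 2 / c - 2 * (‖z x‖ * ‖F x‖)
          = (c * ‖z x‖ - ‖F x‖) ^ 2 / c := by field_simp; ring
      rw [e]; positivity
    linarith
  refine integrableOn_Iic_of_intervalIntegral_norm_bounded
    ((((∫ x in Set.Iic 0, ‖F x‖ ^ 2) / c) + M ^ 2) / c) 0 (a := fun X : ℝ => X)
    (l := atBot) (fun X => ?_) tendsto_id ?_
  · exact ((cz.norm.pow 2).integrableOn_Icc (a := X) (b := 0)).mono_set Set.Ioc_subset_Icc_self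
  · filter_upwards [eventually_le_atBot 0] with X hX
    simp only [norm_pow, norm_norm]
    rw [le_div_iff₀ hc0, mul_comm, ← intervalIntegral.integral_const_mul]
    have hFi : IntervalIntegrable (fun x => ‖F x‖ ^ 2 / c) volume X 0 :=
      ((hF.norm.pow 2).div_const c).intervalIntegrable _ _
    refine (intervalIntegral.integral_mono_on hX
      ((continuous_const.mul (cz.norm.pow 2)).intervalIntegrable _ _)
      (hFi.sub (hcint.intervalIntegrable _ _)) fun x _ => hbound x).trans ?_
    rw [intervalIntegral.integral_sub hFi (hcint.intervalIntegrable _ _),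
      intervalIntegral.integral_eq_sub_of_hasDerivAt (fun x _ => (hz x).norm_sq)
        (hcint.intervalIntegrable _ _), intervalIntegral.integral_div]
    have h4 : ∫ x in X..0, ‖F x‖ ^ 2 ≤ ∫ x in Set.Iic 0, ‖F x‖ ^ 2 := by
      rw [intervalIntegral.integral_of_le hX]
      exact setIntegral_mono_set hi (ae_of_all _ fun x => by simp only [Pi.zero_apply]; positivity)
        (Set.Ioc_subset_Iic_self.eventuallyLE)
    have h5 : ‖z X‖ ^ 2 ≤ M ^ 2 := by
      have := hM X hX
      gcongr
    have h6 : 0 ≤ ‖z 0‖ ^ 2 := by positivity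
    have h7 : (∫ x in X..0, ‖F x‖ ^ 2) / c ≤ (∫ x in Set.Iic 0, ‖F x‖ ^ 2) / c := by gcongr
    linarith

/-- For y ≤ x ≤ 0 one has |x| ≤ |y|, so the factor |x| can be moved onto F; then 2ab ≤ a² + b²
splits the kernel from |y||F(y)|. It supplies the a priori bound needed to apply the energy estimate
to xz. -/
lemma norm_mul_duhamel_le {κ : ℂ} (hκ : κ.re < 0) {F : ℝ → ℂ}
    (hF2 : Integrable (fun x => (1 + x ^ 2) * ‖F x‖ ^ 2)) {x : ℝ} (hx : x ≤ 0) :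
    |x| * ‖duhamel κ F x‖ ≤ 1 / (-2 * κ.re) + ∫ y, (1 + y ^ 2) * ‖F y‖ ^ 2 := by
  have hc : 0 < -2 * κ.re := by linarith
  have ie : IntegrableOn (fun y => Real.exp (2 * κ.re * x) * Real.exp (-2 * κ.re * y))
      (Set.Iic x) := (integrableOn_exp_mul_Iic hc x).const_mul _
  have hval : ∫ y in Set.Iic x, Real.exp (2 * κ.re * x) * Real.exp (-2 * κ.re * y)
      = 1 / (-2 * κ.re) := by
    rw [integral_const_mul, integral_exp_mul_Iic hc, mul_div_assoc', ← Real.exp_add]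
    congr 1
    rw [Real.exp_eq_one_iff]
    ring
  have e : |x| * ‖duhamel κ F x‖
      = ‖∫ y in Set.Iic x, (x : ℂ) * (Complex.exp (κ * ((x - y : ℝ) : ℂ)) * F y)‖ := by
    rw [integral_const_mul, ← duhamel_eq, norm_mul, Complex.norm_real, Real.norm_eq_abs]
  rw [e, ← hval]
  refine (norm_integral_le_of_norm_le (ie.add hF2.integrableOn) ?_).trans ?_
  · filter_upwards [ae_restrict_mem measurableSet_Iic] with y hy
    have hy : y ≤ x := hy
    rw [norm_mul, norm_mul, Complex.norm_real, Real.norm_eq_abs, Complex.norm_exp,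
      Complex.re_mul_ofReal, Pi.add_apply, ← Real.exp_add]
    set a := Real.exp (κ.re * (x - y)) with ha
    have h1 : Real.exp (2 * κ.re * x + -2 * κ.re * y) = a ^ 2 := by
      rw [ha, ← Real.exp_nat_mul]; congr 1; push_cast; ring
    have h2 : |x| ≤ |y| := by rw [abs_of_nonpos hx, abs_of_nonpos (hy.trans hx)]; linarith
    have h3 : |x| * (a * ‖F y‖) ≤ |y| * (a * ‖F y‖) :=
      mul_le_mul_of_nonneg_right h2 (by positivity)
    rw [h1]
    have h4 : y ^ 2 = |y| ^ 2 := (sq_abs y).symm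
    rw [h4]
    nlinarith [sq_nonneg (a - |y| * ‖F y‖), sq_nonneg a, sq_nonneg (|y| * ‖F y‖), sq_nonneg ‖F y‖]
  · simp only [Pi.add_apply]
    rw [integral_add ie hF2.integrableOn]
    exact add_le_add_right (setIntegral_le_integral hF2
      (ae_of_all _ fun y => by simp only [Pi.zero_apply]; positivity)) _

/-- The second component satisfies w' = κw + F with Re κ < 0 and F in L^{2,1}. The energy estimate
applies first to w, then to xw, whose forcing w + xF is by then known to be in L². -/
lemma IsJostLeft.weighted_integrableOn {p u w : ℝ → ℂ} {lam : ℂ} (hp : Decaying p)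
    (hlam : 0 < (lam ^ 2).im) (h : IsJostLeft p lam u w) :
    IntegrableOn (fun x => (1 + x ^ 2) * ‖w x‖ ^ 2) (Set.Iic 0) := by
  set κ := 2 * Complex.I * lam ^ 2 with hκd
  have hκ : κ.re < 0 := by rw [hκd, re_two_I_mul_sq]; linarith
  obtain ⟨M, hM⟩ := h.bdd
  have hM0 : 0 ≤ M := (norm_nonneg _).trans (hM 0).1
  have cw := h.cont_snd
  have hF : Decaying (srcB p lam u w) := by
    obtain ⟨N, hN⟩ := hp.bdd
    have hN0 : 0 ≤ N := (norm_nonneg _).trans (hN 0)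
    refine hp.of_le (C := (‖lam‖ + N / 4) * M) (continuous_srcB hp h.cont_fst cw)
      (by positivity) fun x => ?_
    refine (norm_srcB_le le_rfl (hM x).1 (hM x).2).trans ?_
    have h1 : weight p ‖lam‖ x ≤ (‖lam‖ + N / 4) * ‖p x‖ := by
      unfold weight
      have := mul_le_mul_of_nonneg_right (hN x) (norm_nonneg (p x))
      linarith
    have := mul_le_mul_of_nonneg_right h1 hM0
    linarith
  have iF2 := hF.weighted_sq_integrable
  have i0 := sq_integrableOn_of_hasDerivAt hκ hF.cont h.deriv_snd (fun x _ => (hM x).2)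
    hF.sq_integrable.integrableOn
  have cG : Continuous fun x : ℝ => w x + (x : ℂ) * srcB p lam u w x :=
    cw.add (Complex.continuous_ofReal.mul hF.cont)
  have hz : ∀ x : ℝ, HasDerivAt (fun x : ℝ => (x : ℂ) * w x)
      (κ * ((x : ℂ) * w x) + (w x + (x : ℂ) * srcB p lam u w x)) x := fun x =>
    ((Complex.ofRealCLM.hasDerivAt (x := x)).mul (h.deriv_snd x)).congr_deriv (by
      simp only [Complex.ofRealCLM_apply, Complex.ofReal_one]; ring)
  have iG : IntegrableOn (fun x : ℝ => ‖w x + (x : ℂ) * srcB p lam u w x‖ ^ 2) (Set.Iic 0) := by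
    refine ((i0.const_mul 2).add ((iF2.const_mul 2).integrableOn)).mono'
      (cG.norm.pow 2).aestronglyMeasurable (ae_of_all _ fun x => ?_)
    simp only [norm_pow, norm_norm, Pi.add_apply]
    have h1 : ‖w x + (x : ℂ) * srcB p lam u w x‖ ≤ ‖w x‖ + |x| * ‖srcB p lam u w x‖ := by
      refine (norm_add_le _ _).trans (le_of_eq ?_)
      rw [norm_mul, Complex.norm_real, Real.norm_eq_abs]
    have h2 : ‖w x + (x : ℂ) * srcB p lam u w x‖ ^ 2 ≤ (‖w x‖ + |x| * ‖srcB p lam u w x‖) ^ 2 := by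
      gcongr
    have h4 : x ^ 2 = |x| ^ 2 := (sq_abs x).symm
    rw [h4]
    nlinarith [sq_nonneg (‖w x‖ - |x| * ‖srcB p lam u w x‖), sq_nonneg ‖srcB p lam u w x‖]
  have i1 := sq_integrableOn_of_hasDerivAt hκ cG hz (fun x hx => by
    have := norm_mul_duhamel_le hκ iF2 hx
    rw [← h.snd_eq hp hlam.le] at this
    rwa [norm_mul, Complex.norm_real, Real.norm_eq_abs]) iG
  refine (i0.add i1).congr_fun (fun x _ => ?_) measurableSet_Iic
  simp only [Pi.add_apply, norm_mul, Complex.norm_real, Real.norm_eq_abs, mul_pow, sq_abs]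
  ring

lemma weighted_integrableOn_of_eventually {G w : ℝ → ℂ} (hG : Continuous G) {C : ℝ}
    (h : ∀ᶠ x in atBot, ‖G x‖ ≤ C * ‖w x‖)
    (hi : IntegrableOn (fun x => (1 + x ^ 2) * ‖w x‖ ^ 2) (Set.Iic 0)) :
    IntegrableOn (fun x => (1 + x ^ 2) * ‖G x‖ ^ 2) (Set.Iic 0) := by
  obtain ⟨R, hR⟩ := eventually_atBot.1 h
  have cG : Continuous fun x => (1 + x ^ 2) * ‖G x‖ ^ 2 := by fun_prop
  have e : Set.Iic (0 : ℝ) ⊆ Set.Iic (min R 0) ∪ Set.Icc (min R 0) 0 := fun x hx => by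
    rcases le_total x (min R 0) with h | h
    · exact Or.inl h
    · exact Or.inr ⟨h, hx⟩
  refine IntegrableOn.mono_set (IntegrableOn.union ?_ cG.integrableOn_Icc) e
  refine ((hi.mono_set (Set.Iic_subset_Iic.2 (min_le_right _ _))).const_mul (C ^ 2)).mono'
    cG.aestronglyMeasurable ?_
  filter_upwards [ae_restrict_mem measurableSet_Iic] with x hx
  have h1 := hR x (le_trans hx (min_le_left _ _))
  rw [Real.norm_of_nonneg (by positivity)]
  have h2 : ‖G x‖ ^ 2 ≤ (C * ‖w x‖) ^ 2 := by gcongr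
  calc (1 + x ^ 2) * ‖G x‖ ^ 2 ≤ (1 + x ^ 2) * (C * ‖w x‖) ^ 2 := by gcongr
    _ = C ^ 2 * ((1 + x ^ 2) * ‖w x‖ ^ 2) := by ring

lemma decaying_of_eventually {G w₁ w₂ : ℝ → ℂ} (hG : Continuous G) {M C₁ C₂ : ℝ}
    (hM : ∀ x, ‖G x‖ ≤ M) (h₁ : ∀ᶠ x in atBot, ‖G x‖ ≤ C₁ * ‖w₁ x‖)
    (h₂ : ∀ᶠ x in atBot, ‖G (-x)‖ ≤ C₂ * ‖w₂ x‖)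
    (hi₁ : IntegrableOn (fun x => (1 + x ^ 2) * ‖w₁ x‖ ^ 2) (Set.Iic 0))
    (hi₂ : IntegrableOn (fun x => (1 + x ^ 2) * ‖w₂ x‖ ^ 2) (Set.Iic 0)) : Decaying G := by
  refine decaying_of_weighted_sq_integrable hG hM ?_
  have a := weighted_integrableOn_of_eventually hG h₁ hi₁
  have b := weighted_integrableOn_of_eventually (hG.comp continuous_neg) h₂ hi₂
  have b0 : IntegrableOn (fun x => (1 + x ^ 2) * ‖G (-x)‖ ^ 2) (Set.Iic (-0)) := by
    simpa using b
  have b' := b0.comp_neg_Ici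
  rw [← integrableOn_univ, ← Set.Iic_union_Ici (a := (0 : ℝ))]
  refine a.union ?_
  simpa using b'

/-! ### Asymptotics of the coefficients of the Darboux matrix -/

section

variable {l f g : ℂ}

lemma norm_seedGamma_le_const (hl : 0 < l.re) (h : f ≠ 0 ∨ g ≠ 0) :
    ‖seedGamma l f g‖ ≤ ‖l ^ 2 - conj l ^ 2‖ / l.re := by
  have key := norm_seedGamma_le hl h
  have hK : 0 ≤ ‖l ^ 2 - conj l ^ 2‖ / l.re := by positivity
  have hpos : 0 < ‖f‖ ^ 2 + ‖g‖ ^ 2 := by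
    rcases h with h | h
    · have := norm_pos_iff.2 h; positivity
    · have := norm_pos_iff.2 h; positivity
  have h2 : ‖f‖ * ‖g‖ ≤ ‖f‖ ^ 2 + ‖g‖ ^ 2 := by nlinarith [sq_nonneg (‖f‖ - ‖g‖)]
  exact le_of_mul_le_mul_right (key.trans (mul_le_mul_of_nonneg_left h2 hK)) hpos

lemma norm_seedGamma_le_snd (hl : 0 < l.re) (h : 1 / 2 ≤ ‖f‖) :
    ‖seedGamma l f g‖ ≤ 2 * (‖l ^ 2 - conj l ^ 2‖ / l.re) * ‖g‖ := by
  have hf : 0 < ‖f‖ := by linarith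
  have key := norm_seedGamma_le (g := g) hl (Or.inl (norm_pos_iff.1 hf))
  have hK : 0 ≤ ‖l ^ 2 - conj l ^ 2‖ / l.re := by positivity
  set K := ‖l ^ 2 - conj l ^ 2‖ / l.re
  have h1 : ‖seedGamma l f g‖ * ‖f‖ * ‖f‖ ≤ K * ‖g‖ * ‖f‖ := by
    nlinarith [mul_nonneg (norm_nonneg (seedGamma l f g)) (sq_nonneg ‖g‖)]
  have h2 := le_of_mul_le_mul_right h1 hf
  nlinarith [norm_nonneg (seedGamma l f g)]

lemma norm_seedGamma_le_fst (hl : 0 < l.re) (h : 1 / 2 ≤ ‖g‖) :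
    ‖seedGamma l f g‖ ≤ 2 * (‖l ^ 2 - conj l ^ 2‖ / l.re) * ‖f‖ := by
  have hg : 0 < ‖g‖ := by linarith
  have key := norm_seedGamma_le (f := f) hl (Or.inr (norm_pos_iff.1 hg))
  have hK : 0 ≤ ‖l ^ 2 - conj l ^ 2‖ / l.re := by positivity
  set K := ‖l ^ 2 - conj l ^ 2‖ / l.re
  have h1 : ‖seedGamma l f g‖ * ‖g‖ * ‖g‖ ≤ K * ‖f‖ * ‖g‖ := by
    nlinarith [mul_nonneg (norm_nonneg (seedGamma l f g)) (sq_nonneg ‖f‖)]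
  have h2 := le_of_mul_le_mul_right h1 hg
  nlinarith [norm_nonneg (seedGamma l f g)]

lemma tendsto_seed {F G : ℝ → ℂ} {fl : Filter ℝ} (hl : 0 < l.re) (h : f ≠ 0 ∨ g ≠ 0)
    (hF : Tendsto F fl (𝓝 f)) (hG : Tendsto G fl (𝓝 g)) :
    Tendsto (fun x => seedAlpha l (F x) (G x)) fl (𝓝 (seedAlpha l f g)) ∧
      Tendsto (fun x => seedGamma l (F x) (G x)) fl (𝓝 (seedGamma l f g)) := by
  have hF' := (Complex.continuous_conj.tendsto _).comp hF
  have hG' := (Complex.continuous_conj.tendsto _).comp hG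
  have hm : Tendsto (fun x => seedForm l (F x) (G x)) fl (𝓝 (seedForm l f g)) :=
    ((hF.mul hF').const_mul l).add ((hG.mul hG').const_mul (conj l))
  have hn : Tendsto (fun x => (‖seedForm l (F x) (G x)‖ : ℂ)) fl (𝓝 (‖seedForm l f g‖ : ℂ)) :=
    (Complex.continuous_ofReal.tendsto _).comp hm.norm
  have h0 : (‖seedForm l f g‖ : ℂ) ≠ 0 := by exact_mod_cast (norm_seedForm_pos hl h).ne'
  exact ⟨((Complex.continuous_conj.tendsto _).comp hm).div hn h0,
    ((hF.mul hG').const_mul _).neg.div hn h0⟩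

end

/-! ### The Darboux matrix of a bound state -/

section

variable {q : ℝ → ℂ} {l : ℂ}

lemma im_sq_pos (hl : l ∈ quadrantI) : 0 < (l ^ 2).im := by
  have h := mul_pos hl.1 hl.2
  rw [sq, Complex.mul_im]
  linarith

lemma ne_zero_of_mem_quadrantI (hl : l ∈ quadrantI) : l ≠ 0 := by
  rintro rfl
  exact lt_irrefl _ hl.1

lemma sq_sub_conj_sq_ne_zero (hl : l ∈ quadrantI) {lam : ℂ} (h : 0 ≤ (lam ^ 2).im) :
    lam ^ 2 - conj l ^ 2 ≠ 0 := fun h0 => by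
  have h1 := congrArg Complex.im h0
  rw [Complex.sub_im, ← map_pow, Complex.conj_im, Complex.zero_im] at h1
  linarith [im_sq_pos hl]

/-- Since |m|² = m m̄, one has m̄/m = α² and 1/m = α/|m|. -/
lemma darbouxB_eq {Φ : ℝ → Fin 2 → ℂ} (hl : 0 < l.re) {x : ℝ} (h : Φ x 0 ≠ 0 ∨ Φ x 1 ≠ 0) :
    darbouxB Φ l q x = seedAlpha l (Φ x 0) (Φ x 1) ^ 2 * q x
      + 2 * Complex.I * (seedAlpha l (Φ x 0) (Φ x 1) * seedGamma l (Φ x 0) (Φ x 1)) := by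
  have hpos := norm_seedForm_pos hl h
  have h0 : (‖seedForm l (Φ x 0) (Φ x 1)‖ : ℂ) ≠ 0 := by exact_mod_cast hpos.ne'
  have hm : seedForm l (Φ x 0) (Φ x 1) ≠ 0 := norm_pos_iff.1 hpos
  have hb : conj (seedForm l (Φ x 0) (Φ x 1)) ≠ 0 := by simpa using hm
  have hN := seedForm_mul_conj (l := l) (f := Φ x 0) (g := Φ x 1)
  have e1 : formM l (Φ x) (Φ x) = seedForm l (Φ x 0) (Φ x 1) := by
    simp only [formM, seedForm]; ring
  have e2 : formM (conj l) (Φ x) (Φ x) = conj (seedForm l (Φ x 0) (Φ x 1)) := by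
    simp only [formM, seedForm, map_add, map_mul, Complex.conj_conj]; ring
  simp only [darbouxB, coefC, coefD, seedAlpha, seedGamma, e1, e2]
  generalize (‖seedForm l (Φ x 0) (Φ x 1)‖ : ℂ) = N at *
  generalize conj (seedForm l (Φ x 0) (Φ x 1)) = B at *
  generalize seedForm l (Φ x 0) (Φ x 1) = M at *
  have e3 : B / M = (B / N) ^ 2 := by
    rw [div_pow, ← hN]; field_simp
  have e4 : ∀ z : ℂ, z / M = B / N * (z / N) := fun z => by
    rw [div_mul_div_comm, ← sq, ← hN, mul_comm M, mul_div_mul_left _ _ hb]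
  rw [e3, e4]
  ring

/-- A solution vanishing at one point vanishes identically, which a nonzero limit forbids. -/
lemma ne_zero_of_tendsto (hq : Decaying q) {lam : ℂ} {e : ℝ → ℂ} (he : ∀ x, e x ≠ 0)
    {v : ℝ → Fin 2 → ℂ} (h : IsSpectralSolution q lam (fun x => e x • v x)) {fl : Filter ℝ}
    [fl.NeBot] {z : Fin 2 → ℂ} (hv : Tendsto v fl (𝓝 z)) (hz : z ≠ 0) (x : ℝ) :
    v x 0 ≠ 0 ∨ v x 1 ≠ 0 := by
  by_contra! hx
  have hs := (isSpectralSolution_iff hq.cont).1 h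
  have h0 := hs.eq_zero hq (x₀ := x) (by simp [hx.1]) (by simp [hx.2])
  have hv0 : v = fun _ => 0 := by
    funext y i
    fin_cases i
    · simpa [he y] using (h0 y).1
    · simpa [he y] using (h0 y).2
  rw [hv0] at hv
  exact hz (tendsto_nhds_unique hv tendsto_const_nhds)

lemma exists_smul_of_det_eq_zero {a b c d : ℂ} (h : a * d - c * b = 0) (h₁ : a ≠ 0 ∨ b ≠ 0)
    (h₂ : c ≠ 0 ∨ d ≠ 0) : ∃ k : ℂ, k ≠ 0 ∧ c = k * a ∧ d = k * b := by
  have h' : a * d = c * b := sub_eq_zero.1 h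
  by_cases ha : a = 0
  · subst ha
    have hb : b ≠ 0 := by simpa using h₁
    have hc : c = 0 := by simpa [hb] using h'.symm
    subst hc
    have hd : d ≠ 0 := by simpa using h₂
    exact ⟨d / b, div_ne_zero hd hb, by simp, by field_simp⟩
  · have hd : d = c / a * b := by field_simp; linear_combination h'
    have hc : c ≠ 0 := by
      rintro rfl
      simp [hd] at h₂
    exact ⟨c / a, div_ne_zero hc ha, by field_simp, hd⟩

/-- The Darboux matrix attached to a bound state: it is built from the Jost function `φ₋`, which is
proportional to `ϕ₊`. -/
theorem exists_darboux (hq : Decaying q) (hl : l ∈ quadrantI) (h0 : scatA q l = 0) :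
    ∃ α γ : ℝ → ℂ, IsDarboux q (darbouxPotential q l) α γ (‖l‖ ^ 2) ∧ Decaying γ ∧
      Tendsto α atBot (𝓝 (conj l / ‖l‖)) ∧ Tendsto γ atBot (𝓝 0) ∧
      Tendsto α atTop (𝓝 (l / ‖l‖)) ∧ Tendsto γ atTop (𝓝 0) ∧
      ∀ (lam : ℂ) (x : ℝ), (lam ^ 2 * α x - (‖l‖ ^ 2 : ℝ) * conj (α x))
        * (lam ^ 2 * conj (α x) - (‖l‖ ^ 2 : ℝ) * α x) + lam ^ 2 * (γ x * conj (γ x))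
        = (lam ^ 2 - l ^ 2) * (lam ^ 2 - conj l ^ 2) := by
  have him := im_sq_pos hl
  have hre := hl.1
  have hv := varphiMinus_spec hq him.le
  have hw := phiPlus_spec hq him.le
  have hv' := (isJostFirst_atBot_iff hq.cont).1 hv
  have hw' := (isJostSecond_atTop_iff hq.cont).1 hw
  have ev : ∀ x : ℝ, Complex.exp (-Complex.I * l ^ 2 * x) ≠ 0 := fun x => Complex.exp_ne_zero _
  have ew : ∀ x : ℝ, Complex.exp (Complex.I * l ^ 2 * x) ≠ 0 := fun x => Complex.exp_ne_zero _
  have nv := ne_zero_of_tendsto hq ev hv.2.1 hv.2.2 (by simp)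
  have nw := ne_zero_of_tendsto hq ew hw.2.1 hw.2.2 (by simp)
  have sv := (isSpectralSolution_iff hq.cont).1 hv.2.1
  have sw := (isSpectralSolution_iff hq.cont).1 hw.2.1
  set v := varphiMinus q l with hvdef
  set w := phiPlus q l with hwdef
  -- The vanishing of a at l, stated at x = 0, propagates to all x by constancy of the Wronskian.
  have hdet : ∀ x, v x 0 * w x 1 - w x 0 * v x 1 = 0 := fun x => by
    have h1 := sv.wronskian sw x 0
    rw [scatA, det2_eq] at h0
    simp only [Pi.smul_apply, smul_eq_mul, Complex.ofReal_zero, mul_zero, Complex.exp_zero,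
      one_mul] at h1
    rw [h0] at h1
    refine mul_left_cancel₀ (mul_ne_zero (ev x) (ew x)) ?_
    rw [mul_zero, ← h1]
    ring
  have hαw : ∀ x, seedAlpha l (w x 0) (w x 1) = seedAlpha l (v x 0) (v x 1) ∧
      seedGamma l (w x 0) (w x 1) = seedGamma l (v x 0) (v x 1) := fun x => by
    obtain ⟨k, hk, h1, h2⟩ := exists_smul_of_det_eq_zero (hdet x) (nv x) (nw x)
    rw [h1, h2]
    exact ⟨seedAlpha_smul hk, seedGamma_smul hk⟩
  have D : IsDarboux q (darbouxPotential q l) (fun x => seedAlpha l (v x 0) (v x 1))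
      (fun x => seedGamma l (v x 0) (v x 1)) (‖l‖ ^ 2) := by
    have := isDarboux_seed hre sv fun x => by simpa [ev x] using nv x
    simp only [Pi.smul_apply, smul_eq_mul, seedAlpha_smul (ev _), seedGamma_smul (ev _)] at this
    convert this using 1
    funext x
    rw [darbouxPotential, darbouxB_eq hre (by simpa [seedPhi, ev x] using nv x)]
    simp only [seedPhi, Pi.smul_apply, smul_eq_mul, seedAlpha_smul (ev _), seedGamma_smul (ev _)]
    rfl
  have tv := tendsto_seed hre (Or.inl one_ne_zero) hv'.tendsto_fst hv'.tendsto_snd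
  have tw := tendsto_seed hre (Or.inr one_ne_zero) (tendsto_fin_two_iff.1 hw.2.2).1
    (tendsto_fin_two_iff.1 hw.2.2).2
  simp only [hαw] at tw
  have half : ∀ {F : ℝ → ℂ}, Tendsto F atBot (𝓝 1) → ∀ᶠ x in atBot, 1 / 2 ≤ ‖F x‖ := fun h =>
    h.norm.eventually (eventually_ge_nhds (by norm_num [norm_one]))
  refine ⟨_, _, D, ?_, ?_, ?_, ?_, ?_, fun lam x => det_seed hre (nv x) lam⟩
  · refine decaying_of_eventually (C₂ := 2 * (‖l ^ 2 - conj l ^ 2‖ / l.re)) D.cont_snd (fun x => norm_seedGamma_le_const hre (nv x))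
      ((half hv'.tendsto_fst).mono fun x hx => norm_seedGamma_le_snd hre hx)
      ((half hw'.tendsto_fst).mono fun x hx => ?_)
      (hv'.weighted_integrableOn hq him) (hw'.weighted_integrableOn hq.reflect him)
    -- Towards +∞ the coefficient γ is expressed through ϕ₊, whose second component is close to 1
    -- there, so its decaying first component bounds γ.
    rw [← (hαw (-x)).2]
    exact norm_seedGamma_le_fst hre hx
  · simpa [seedAlpha, seedForm] using tv.1
  · simpa [seedGamma] using tv.2
  · simpa [seedAlpha, seedForm] using tw.1
  · simpa [seedGamma] using tw.2

/-- The limiting diagonal entries of T. The first expression is the upper entry at -∞ and the lower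
entry at +∞; the second is the upper entry at +∞. -/
lemma mul_sub_mul_conj (lam : ℂ) :
    lam ^ 2 * (conj l / ‖l‖) - (‖l‖ ^ 2 : ℝ) * (l / ‖l‖) = conj l / ‖l‖ * (lam ^ 2 - l ^ 2) ∧
    lam ^ 2 * (l / ‖l‖) - (‖l‖ ^ 2 : ℝ) * (conj l / ‖l‖)
      = l / ‖l‖ * (lam ^ 2 - conj l ^ 2) := by
  have hκ : ((‖l‖ ^ 2 : ℝ) : ℂ) = l * conj l := by
    rw [Complex.mul_conj, Complex.normSq_eq_norm_sq]
  rw [hκ]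
  constructor <;> ring

lemma conj_div_norm : conj (conj l / (‖l‖ : ℂ)) = l / ‖l‖ ∧ conj (l / (‖l‖ : ℂ)) = conj l / ‖l‖ := by
  simp

/-! ### Regularity, scattering coefficients and zeros for the transformed potential -/

theorem isRegular_darbouxPotential (hq : IsRegular q) (hl : l ∈ quadrantI)
    (h0 : scatA q l = 0) : IsRegular (darbouxPotential q l) := by
  obtain ⟨α, γ, D, hγ, -⟩ := exists_darboux hq.decaying hl h0
  exact isRegular_of_system hq D.norm_fst hγ D.potential D.deriv_fst D.deriv_snd

/-- Both Jost functions are normalised by the same entry (l̄/|l|)(λ² - l²), so a is multiplied by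
det T divided by the square of this entry. -/
theorem scatA_darbouxPotential (hq : IsRegular q) (hl : l ∈ quadrantI)
    (h0 : scatA q l = 0) {lam : ℂ} (hlam : 0 ≤ (lam ^ 2).im) (hne : lam ^ 2 ≠ l ^ 2) :
    scatA (darbouxPotential q l) lam = transformedA q l lam := by
  obtain ⟨α, γ, D, hγ, a₁, g₁, a₂, g₂, hdet⟩ := exists_darboux hq.decaying hl h0
  obtain ⟨C, hC⟩ := hγ.bdd
  have hP := (isRegular_darbouxPotential hq hl h0).decaying
  have l0 := ne_zero_of_mem_quadrantI hl
  have ln : (‖l‖ : ℂ) ≠ 0 := by simpa using l0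
  have lc : conj l ≠ 0 := by simpa using l0
  have n1 := sub_ne_zero.2 hne
  have hc := div_ne_zero lc ln
  have j₁ := D.isJostFirst hq.decaying.cont hC a₁ g₁ (lam := lam)
    (by rw [conj_div_norm.1, (mul_sub_mul_conj lam).1]; exact mul_ne_zero hc n1)
    (varphiMinus_spec hq.decaying hlam)
  have j₂ := D.isJostSecond hq.decaying.cont hC a₂ g₂ (lam := lam)
    (by rw [conj_div_norm.2, (mul_sub_mul_conj lam).1]; exact mul_ne_zero hc n1)
    (phiPlus_spec hq.decaying hlam)
  rw [scatA, varphiMinus_unique hP hlam j₁, phiPlus_unique hP hlam j₂, det2_smul,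
    det2_darbouxApply, hdet, conj_div_norm.1, conj_div_norm.2, (mul_sub_mul_conj lam).1,
    transformedA, scatA]
  have hκ : (‖l‖ : ℂ) ^ 2 = l * conj l := by
    rw [Complex.mul_conj, Complex.normSq_eq_norm_sq]; push_cast; rfl
  field_simp
  rw [hκ]
  ring

/-- Here the two normalising entries are (l̄/|l|)(λ² - l²) and (l/|l|)(λ² - l̄²), whose product is
exactly det T. They do not vanish, as λ² is real and l² is not. -/
theorem scatB_darbouxPotential (hq : IsRegular q) (hl : l ∈ quadrantI)
    (h0 : scatA q l = 0) {lam : ℂ} (hlam : lam ∈ contSpectrum) :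
    scatB (darbouxPotential q l) lam = scatB q lam := by
  have him : (lam ^ 2).im = 0 := by
    rw [sq, Complex.mul_im]
    rcases hlam with h | h <;> rw [h] <;> ring
  obtain ⟨α, γ, D, hγ, a₁, g₁, a₂, g₂, hdet⟩ := exists_darboux hq.decaying hl h0
  obtain ⟨C, hC⟩ := hγ.bdd
  have hP := (isRegular_darbouxPotential hq hl h0).decaying
  have l0 := ne_zero_of_mem_quadrantI hl
  have ln : (‖l‖ : ℂ) ≠ 0 := by simpa using l0
  have lc : conj l ≠ 0 := by simpa using l0
  have n1 : lam ^ 2 - l ^ 2 ≠ 0 := fun h => by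
    have := congrArg Complex.im h
    rw [Complex.sub_im, him, Complex.zero_im] at this
    linarith [im_sq_pos hl]
  have n2 := sq_sub_conj_sq_ne_zero hl him.ge
  have j₁ := D.isJostFirst hq.decaying.cont hC a₁ g₁ (lam := lam)
    (by rw [conj_div_norm.1, (mul_sub_mul_conj lam).1]
        exact mul_ne_zero (div_ne_zero lc ln) n1)
    (varphiMinus_spec hq.decaying him.ge)
  have j₂ := D.isJostFirst hq.decaying.cont hC a₂ g₂ (lam := lam)
    (by rw [conj_div_norm.2, (mul_sub_mul_conj lam).2]
        exact mul_ne_zero (div_ne_zero l0 ln) n2)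
    (varphiPlus_spec hq.decaying him.le)
  rw [scatB, varphiMinus_unique hP him.ge j₁, varphiPlus_unique hP him.le j₂, det2_smul,
    det2_darbouxApply, hdet, conj_div_norm.1, conj_div_norm.2, (mul_sub_mul_conj lam).1,
    (mul_sub_mul_conj lam).2, scatB]
  have hκ : (‖l‖ : ℂ) ^ 2 = l * conj l := by
    rw [Complex.mul_conj, Complex.normSq_eq_norm_sq]; push_cast; rfl
  field_simp
  rw [hκ]

/-- At ±l the normalising entry vanishes, so the formula is not available pointwise. It holds on a
punctured neighbourhood, and a⁽¹⁾ is continuous at the point. -/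
theorem tendsto_transformedA (hq : IsRegular q) (hl : l ∈ quadrantI) (h0 : scatA q l = 0)
    {mu : ℂ} (hmu : mu ^ 2 = l ^ 2) :
    Tendsto (transformedA q l) (𝓝[≠] mu) (𝓝 (scatA (darbouxPotential q l) mu)) := by
  have hP := (isRegular_darbouxPotential hq hl h0).decaying
  have him : 0 < (mu ^ 2).im := hmu ▸ im_sq_pos hl
  have hmu0 : mu ≠ 0 := by
    rintro rfl
    simp at him
  refine ((continuousAt_scatA hP him).tendsto.mono_left nhdsWithin_le_nhds).congr' ?_
  have e1 : ∀ᶠ lam in 𝓝[≠] mu, 0 < (lam ^ 2).im :=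
    nhdsWithin_le_nhds ((Complex.continuous_im.comp (continuous_pow 2)).continuousAt.eventually
      (lt_mem_nhds him))
  -- The formula needs λ² ≠ l², which excludes -μ as well as μ.
  have e2 : ∀ᶠ lam in 𝓝[≠] mu, lam ≠ -mu := by
    refine nhdsWithin_le_nhds (isOpen_ne.mem_nhds fun h => hmu0 ?_)
    exact self_eq_neg.1 h
  filter_upwards [e1, e2, self_mem_nhdsWithin] with lam h1 h2 h3
  refine scatA_darbouxPotential hq hl h0 h1.le fun h => ?_
  rcases sq_eq_sq_iff_eq_or_eq_neg.1 (h.trans hmu.symm) with h | h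
  · exact h3 h
  · exact h2 h

/-- Near l the transformed coefficient is the difference quotient of a times (l/l̄)(λ² - l̄²)/(λ +
l), so its value at l is a'(l) times a nonzero number. -/
theorem scatA_darbouxPotential_self_ne_zero (hq : IsRegular q) (hl : l ∈ quadrantI)
    (h0 : scatA q l = 0) (hd : deriv (scatA q) l ≠ 0) :
    scatA (darbouxPotential q l) l ≠ 0 := by
  have l0 := ne_zero_of_mem_quadrantI hl
  have lc : conj l ≠ 0 := by simpa using l0
  -- Since `deriv` is zero where the derivative does not exist, simplicity of the zero already
  -- contains differentiability of a at l.
  have hs := (differentiableAt_of_deriv_ne_zero hd).hasDerivAt.tendsto_slope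
  have hc : ContinuousAt (fun lam : ℂ => l / conj l * ((lam ^ 2 - conj l ^ 2) / (lam + l))) l := by
    refine continuousAt_const.mul (ContinuousAt.div (by fun_prop) (by fun_prop) ?_)
    rw [← two_mul]
    exact mul_ne_zero two_ne_zero l0
  have ht := hs.mul (hc.tendsto.mono_left nhdsWithin_le_nhds)
  have hev : ∀ᶠ lam in 𝓝[≠] l,
      slope (scatA q) l lam * (l / conj l * ((lam ^ 2 - conj l ^ 2) / (lam + l)))
        = transformedA q l lam := by
    filter_upwards [self_mem_nhdsWithin] with lam h
    have h1 : lam - l ≠ 0 := sub_ne_zero.2 h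
    rw [slope_def_field, h0, sub_zero, transformedA,
      show lam ^ 2 - l ^ 2 = (lam - l) * (lam + l) by ring, ← div_div _ (lam - l)]
    ring
  rw [tendsto_nhds_unique (tendsto_transformedA hq hl h0 rfl) (ht.congr' hev)]
  refine mul_ne_zero hd (mul_ne_zero (div_ne_zero l0 lc) (div_ne_zero
    (sq_sub_conj_sq_ne_zero hl (im_sq_pos hl).le) ?_))
  rw [← two_mul]
  exact mul_ne_zero two_ne_zero l0

theorem darbouxPotential_mem_Z_zero (hq : IsRegular q) (hZ : q ∈ Z 1) (hl : l ∈ quadrantI)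
    (h0 : scatA q l = 0) : darbouxPotential q l ∈ Z 0 := by
  have hP := isRegular_darbouxPotential hq hl h0
  have l0 := ne_zero_of_mem_quadrantI hl
  have lc : conj l ≠ 0 := by simpa using l0
  have key : ∀ lam ∈ quadrantI, scatA (darbouxPotential q l) lam ≠ 0 := fun lam hlam => by
    by_cases hlam_eq : lam = l
    · rw [hlam_eq]
      exact scatA_darbouxPotential_self_ne_zero hq hl h0 (hZ.2.2.2 l hl h0)
    · have hsq : lam ^ 2 ≠ l ^ 2 := fun h => by
        rcases sq_eq_sq_iff_eq_or_eq_neg.1 h with h | h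
        · exact hlam_eq h
        · have h1 := hlam.1
          rw [h, Complex.neg_re] at h1
          linarith [hl.1]
      rw [scatA_darbouxPotential hq hl h0 (im_sq_pos hlam).le hsq, transformedA]
      -- l is the only zero of a in the quadrant.
      have ha : scatA q lam ≠ 0 := fun h => hlam_eq <|
        Set.encard_le_one_iff.1 hZ.2.2.1.le lam l ⟨hlam, h⟩ ⟨hl, h0⟩
      exact mul_ne_zero (mul_ne_zero ha (div_ne_zero l0 lc)) (div_ne_zero
        (sq_sub_conj_sq_ne_zero hl (im_sq_pos hlam).le) (sub_ne_zero.2 hsq))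
  refine ⟨hP.memSobolev, hP.memWeightedSobolev, ?_, fun lam hlam h => absurd h (key lam hlam)⟩
  rw [Set.encard_eq_zero.2 (Set.eq_empty_iff_forall_notMem.2 fun lam h => key lam h.1 h.2)]
  rfl

end

/-! ### Independence of the representative -/

section

variable {q Q : ℝ → ℂ}

lemma Z_congr_ae (h : q =ᵐ[volume] Q) {N : ℕ} (hq : q ∈ Z N) : Q ∈ Z N := by
  obtain ⟨h1, h2, h3, h4⟩ := hq
  rw [scatA_congr_ae h] at h3 h4
  exact ⟨h1.congr h, h2.congr h, h3, h4⟩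

lemma transformedA_congr_ae (h : q =ᵐ[volume] Q) : transformedA q = transformedA Q := by
  funext l lam
  simp only [transformedA, scatA_congr_ae h]

lemma darbouxPotential_congr_ae (h : q =ᵐ[volume] Q) (l : ℂ) :
    darbouxPotential q l =ᵐ[volume] darbouxPotential Q l := by
  filter_upwards [h] with x hx
  simp only [darbouxPotential, darbouxB, seedPhi, varphiMinus_congr_ae h, hx]

end

end CLL

theorem proposition4p3 (q : ℝ → ℂ) (hq : q ∈ CLL.Z 1) (lam₁ : ℂ)
    (hlam₁ : lam₁ ∈ CLL.quadrantI) (hzero : CLL.scatA q lam₁ = 0) :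
    CLL.darbouxPotential q lam₁ ∈ CLL.Z 0 ∧
    (∀ lam : ℂ, 0 ≤ (lam ^ 2).im → lam ^ 2 ≠ lam₁ ^ 2 →
      CLL.scatA (CLL.darbouxPotential q lam₁) lam = CLL.transformedA q lam₁ lam) ∧
    (∀ mu : ℂ, mu ^ 2 = lam₁ ^ 2 →
      Tendsto (CLL.transformedA q lam₁) (𝓝[≠] mu)
        (𝓝 (CLL.scatA (CLL.darbouxPotential q lam₁) mu))) ∧
    (∀ lam ∈ CLL.contSpectrum,
      CLL.scatB (CLL.darbouxPotential q lam₁) lam = CLL.scatB q lam) := by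
  -- All objects in the statement are unchanged, or change only on a null set, when q is replaced by
  -- its regular representative.
  obtain ⟨Q, hQ, hreg⟩ := CLL.exists_regular_representative hq.1 hq.2.1
  have hP := CLL.darbouxPotential_congr_ae hQ lam₁
  rw [CLL.scatA_congr_ae hQ] at hzero
  rw [CLL.scatA_congr_ae hP, CLL.scatB_congr_ae hP, CLL.scatB_congr_ae hQ,
    CLL.transformedA_congr_ae hQ]
  exact ⟨CLL.Z_congr_ae hP.symm
      (CLL.darbouxPotential_mem_Z_zero hreg (CLL.Z_congr_ae hQ hq) hlam₁ hzero),
    fun lam h h' => CLL.scatA_darbouxPotential hreg hlam₁ hzero h h',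
    fun mu h => CLL.tendsto_transformedA hreg hlam₁ hzero h,
    fun lam h => CLL.scatB_darbouxPotential hreg hlam₁ hzero h⟩
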